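/- Let $\{P_n\}_{n\ge 0}$ be a sequence of monic real polynomials, $\deg P_n=n$, orthogonal with respect to a positive measure on $\mathbb R$ with finite moments: $\int P_mP_n\,d\mu=0$ for $m\ne n$ and $\int P_n^2\,d\mu>0$. Let $x(s)$, $s\in\mathbb C$, be either a $q$-quadratic lattice $$x(s)=c_1q^{-s}+c_2q^{s}+c_3,\qquad c_1,c_2,c_3\in\mathbb C,\ c_1c_2\neq0,$$ where $q\in\mathbb C\setminus\{0\}$ is not a root of unity (in particular $q\ne1$), or a quadratic lattice $$x(s)=c_4s^2+c_5s+c_6,\qquad c_4,c_5,c_6\in\mathbb C,\ c_4\neq 0 .$$ Powers of complex numbers are principal. Let $\mathbb D_x f(x(s))=\dfrac{f(x(s+\frac12))-f(x(s-\frac12))}{x(s+\frac12)-x(s-\frac12)}$. We say that $\{P_n\}$ satisfies the first structure relation on $x(s)$ if there are a polynomial $\pi\in\mathbb C[x]$ of degree at most $4$ and complex numbers $a_{n,n+k}$ ($n\ge2$, $-2\le k\le2$) with $a_{n,n-2}\ne0$ such that $$\pi(x)\,\mathbb D_x^2P_n(x)=\sum_{k=-2}^{2}a_{n,n+k}P_{n+k}(x),\qquad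 x=x(s),\quad n\ge2 .$$ (1) On a $q$-quadratic lattice put $u=c_2/c_1$ and $\cos\theta=\frac12\left(u^{1/2}q^s+u^{-1/2}q^{-s}\right)$ with $e^{i\theta}=u^{1/2}q^s$, so that $x(s)=2c_1u^{1/2}\cos\theta+c_3$. Then $\{P_n\}$ satisfies the first structure relation if and only if one of the following holds: - there are $a,b,c,d\in\mathbb C$ such that, for every $n$, $P_n(x(s))$ is a constant multiple of the Askey--Wilson polynomial $p_n(\cos\theta;a,b,c,d\,|\,q)$. Some or all parameters may be zero, and $p_n(\cos\theta;0,0,0,0\,|\,q)$ is the continuous $q$-Hermite polynomial $H_n(\cos\theta\,|\,q)=\sum_{k=0}^n\frac{(q;q)_n}{(q;q)_k(q;q)_{n-k}}e^{i(n-2k)\theta}$; - for every $n$, $P_n(x(s))$ is a limit of constant multiples (the constants depending on $n$ and the parameters only) of $p_n(\cos\theta;a,b,c,d\,|\,q)$ as one or more of the parameters $a,b,c,d$ tend jointly to $\infty$, the others being kept fixed at complex numbers; which parameters tend to $\infty$ and the values of the others do not depend on $n$. Here $p_n$ is symmetric in its parameters and, for $a\neq0$, $$p_n(\cos\theta;a,b,c,d\,|\,q)=\frac{(ab,ac,ad;q)_n}{a^n}\,{}_4\phi_3\!\left(\begin{matrix}q^{-n},abcdq^{n-1},ae^{-i\theta},ae^{i\theta}\\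 ab,ac,ad\end{matrix};q,q\right),$$ with $(e;q)_n/(e;q)_k$ read as $(eq^k;q)_{n-k}$. (2) On a quadratic lattice put $u=c_5/c_4$. Then $\{P_n\}$ satisfies the first structure relation if and only if one of the following holds: - there are $a,b,c,d\in\mathbb C$ such that, for every $n$, $P_n(x(s))$ is a constant multiple of the Wilson polynomial $W_n\!\left(-(s+\frac u2)^2;a,b,c,d\right)$, where $$W_n(y^2;a,b,c,d)=(a+b)_n(a+c)_n(a+d)_n\,{}_4F_3\!\left(\begin{matrix}-n,n+a+b+c+d-1,a-iy,a+iy\\ a+b,a+c,a+d\end{matrix};1\right);$$ - there are $a,b,c\in\mathbb C$ such that, for every $n$, $P_n(x(s))$ is a constant multiple of the continuous dual Hahn polynomial $S_n\!\left(-(s+\frac u2)^2;a,b,c\right)$, where $$S_n(y^2;a,b,c)=(a+b)_n(a+c)_n\,{}_3F_2\!\left(\begin{matrix}-n,a-iy,a+iy\\ a+b,a+c\end{matrix};1\right),$$ with $(e)_n/(e)_k$ read as $(e+k)_{n-k}$. -/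

import Mathlib

open Polynomial MeasureTheory Filter Topology

noncomputable section

/-- `P` is a sequence of monic polynomials, `deg (P n) = n`, orthogonal with respect to a
positive measure on `ℝ` (all moments finite, all square norms positive). -/
def IsMonicOPS (P : ℕ → ℝ[X]) : Prop :=
  (∀ n, (P n).Monic ∧ (P n).natDegree = n) ∧
    ∃ μ : Measure ℝ,
      (∀ k : ℕ, Integrable (fun t : ℝ => t ^ k) μ) ∧
      (∀ m n : ℕ, m ≠ n → ∫ t, (P m).eval t * (P n).eval t ∂μ = 0) ∧
      ∀ n : ℕ, 0 < ∫ t, (P n).eval t * (P n).eval t ∂μ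

/-- The `q`-quadratic lattice `x(s) = c₁ q^(-s) + c₂ q^s + c₃`. -/
def qQuadraticLattice (q c₁ c₂ c₃ : ℂ) (s : ℂ) : ℂ :=
  c₁ * q ^ (-s) + c₂ * q ^ s + c₃

/-- The quadratic lattice `x(s) = c₄ s² + c₅ s + c₆`. -/
def quadraticLattice (c₄ c₅ c₆ : ℂ) (s : ℂ) : ℂ :=
  c₄ * s ^ 2 + c₅ * s + c₆

/-- The divided-difference operator `𝔻ₓ` of the lattice `x`, acting on functions of `s`
(a polynomial `f` is viewed as the function `s ↦ f (x s)`). -/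
def dividedDiff (x : ℂ → ℂ) (F : ℂ → ℂ) (s : ℂ) : ℂ :=
  (F (s + 1 / 2) - F (s - 1 / 2)) / (x (s + 1 / 2) - x (s - 1 / 2))

/-- The first structure relation on the lattice `x`: there are a polynomial `π` of degree at most
four and numbers `a_{n,m}` (`n ≥ 2`, `n - 2 ≤ m ≤ n + 2`), `a_{n,n-2} ≠ 0`, such that
`π 𝔻ₓ² P_n = ∑_{m=n-2}^{n+2} a_{n,m} P_m` for all `n ≥ 2`. The identity is between polynomials
in `x(s)`; it is evaluated at every `s` at which no denominator in `𝔻ₓ²` vanishes. -/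
def FirstStructureRelation (x : ℂ → ℂ) (P : ℕ → ℝ[X]) : Prop :=
  ∃ (π : ℂ[X]) (a : ℕ → ℕ → ℂ), π.natDegree ≤ 4 ∧
    ∀ n : ℕ, 2 ≤ n → a n (n - 2) ≠ 0 ∧
      ∀ s : ℂ, x (s + 1 / 2) ≠ x (s - 1 / 2) → x (s + 1) ≠ x s → x s ≠ x (s - 1) →
        π.eval (x s) * dividedDiff x (dividedDiff x (fun t => aeval (x t) (P n))) s =
          ∑ m ∈ Finset.Icc (n - 2) (n + 2), a n m * aeval (x s) (P m)

/-- The rising factorial `(a)_k = ∏_{j<k} (a + j)`. -/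
def risingFactorial (a : ℂ) (k : ℕ) : ℂ := ∏ j ∈ Finset.range k, (a + j)

/-- The `q`-shifted factorial `(a; q)_k = ∏_{j<k} (1 - a q^j)`. -/
def qShiftedFactorial (q a : ℂ) (k : ℕ) : ℂ := ∏ j ∈ Finset.range k, (1 - a * q ^ j)

/-- The Wilson polynomial `W_n(x²; a, b, c, d)`, as a function of `x`:
`(a+b)_n (a+c)_n (a+d)_n ₄F₃(-n, n+a+b+c+d-1, a-ix, a+ix; a+b, a+c, a+d; 1)`,
where `(e)_n / (e)_k` is written as `(e+k)_{n-k}`. -/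
def wilson (n : ℕ) (a b c d x : ℂ) : ℂ :=
  ∑ k ∈ Finset.range (n + 1),
    risingFactorial (-n) k * risingFactorial (n + a + b + c + d - 1) k *
      risingFactorial (a - Complex.I * x) k * risingFactorial (a + Complex.I * x) k *
      risingFactorial (a + b + k) (n - k) * risingFactorial (a + c + k) (n - k) *
      risingFactorial (a + d + k) (n - k) / (k.factorial : ℂ)

/-- The continuous dual Hahn polynomial `S_n(x²; a, b, c)`, as a function of `x`:
`(a+b)_n (a+c)_n ₃F₂(-n, a-ix, a+ix; a+b, a+c; 1)`, with `(e)_n / (e)_k = (e+k)_{n-k}`. -/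
def continuousDualHahn (n : ℕ) (a b c x : ℂ) : ℂ :=
  ∑ k ∈ Finset.range (n + 1),
    risingFactorial (-n) k *
      risingFactorial (a - Complex.I * x) k * risingFactorial (a + Complex.I * x) k *
      risingFactorial (a + b + k) (n - k) * risingFactorial (a + c + k) (n - k) /
      (k.factorial : ℂ)

/-- The Askey--Wilson polynomial `p_n((z + z⁻¹)/2; a, b, c, d | q)` (`z = e^{iθ}`), for `a ≠ 0`:
`a^(-n) (ab, ac, ad; q)_n ₄φ₃(q^(-n), abcd q^(n-1), a/z, a z; ab, ac, ad; q, q)`,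
where `(e; q)_n / (e; q)_k` is written as `(e q^k; q)_{n-k}`. -/
def askeyWilson (q : ℂ) (n : ℕ) (a b c d z : ℂ) : ℂ :=
  (a ^ n)⁻¹ * ∑ k ∈ Finset.range (n + 1),
    qShiftedFactorial q (q ^ n)⁻¹ k * qShiftedFactorial q (a * b * c * d * q ^ ((n : ℤ) - 1)) k *
      qShiftedFactorial q (a * z⁻¹) k * qShiftedFactorial q (a * z) k *
      qShiftedFactorial q (a * b * q ^ k) (n - k) * qShiftedFactorial q (a * c * q ^ k) (n - k) *
      qShiftedFactorial q (a * d * q ^ k) (n - k) * q ^ k / qShiftedFactorial q q k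

/-- The continuous `q`-Hermite polynomial `H_n((z + z⁻¹)/2 | q)` (`z = e^{iθ}`), that is, the
Askey--Wilson polynomial all of whose parameters are zero:
`∑_k (q; q)_n / ((q; q)_k (q; q)_{n-k}) z^(n-2k)`. -/
def continuousQHermite (q : ℂ) (n : ℕ) (z : ℂ) : ℂ :=
  ∑ k ∈ Finset.range (n + 1),
    qShiftedFactorial q q n / (qShiftedFactorial q q k * qShiftedFactorial q q (n - k)) *
      (z ^ (n - k) * z⁻¹ ^ k)

/-- The value of `z = e^{iθ}` at the lattice point `x(s) = c₁ q^(-s) + c₂ q^s + c₃`: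
`z = u^(1/2) q^s` with `u = c₂ / c₁`. Then `x(s) = 2 c₁ u^(1/2) cos θ + c₃`. -/
def latticeExp (q c₁ c₂ s : ℂ) : ℂ := (c₂ / c₁) ^ (1 / 2 : ℂ) * q ^ s

/-- Each `P_n` is a multiple of an Askey--Wilson polynomial. One nonzero parameter is listed first
(the Askey--Wilson polynomials are symmetric in their parameters); the others may vanish. -/
def IsAskeyWilsonFamily (q c₁ c₂ c₃ : ℂ) (P : ℕ → ℝ[X]) : Prop :=
  ∃ a b c d : ℂ, a ≠ 0 ∧ ∀ n, ∃ κ : ℂ, ∀ s,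
    aeval (qQuadraticLattice q c₁ c₂ c₃ s) (P n) =
      κ * askeyWilson q n a b c d (latticeExp q c₁ c₂ s)

/-- Each `P_n` is a multiple of a continuous `q`-Hermite polynomial. -/
def IsContinuousQHermiteFamily (q c₁ c₂ c₃ : ℂ) (P : ℕ → ℝ[X]) : Prop :=
  ∀ n, ∃ κ : ℂ, ∀ s,
    aeval (qQuadraticLattice q c₁ c₂ c₃ s) (P n) =
      κ * continuousQHermite q n (latticeExp q c₁ c₂ s)

/-- A parameter that is kept fixed at a finite value, or that tends to infinity. -/
def paramFilter (A : OnePoint ℂ) : Filter ℂ :=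
  A.elim (Bornology.cobounded ℂ) (fun a => pure a)

/-- Each `P_n` is a limit of multiples of Askey--Wilson polynomials as one or more of the four
parameters tend (jointly) to infinity, the others being fixed. By symmetry the first parameter is
either a fixed nonzero number or one of those that tend to infinity. -/
def IsAskeyWilsonLimitFamily (q c₁ c₂ c₃ : ℂ) (P : ℕ → ℝ[X]) : Prop :=
  ∃ A B C D : OnePoint ℂ, A ≠ ((0 : ℂ) : OnePoint ℂ) ∧
    (A = OnePoint.infty ∨ B = OnePoint.infty ∨ C = OnePoint.infty ∨ D = OnePoint.infty) ∧
    ∀ n, ∃ κ : ℂ → ℂ → ℂ → ℂ → ℂ, ∀ s,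
      Tendsto
        (fun t : ℂ × ℂ × ℂ × ℂ =>
          κ t.1 t.2.1 t.2.2.1 t.2.2.2 *
            askeyWilson q n t.1 t.2.1 t.2.2.1 t.2.2.2 (latticeExp q c₁ c₂ s))
        (paramFilter A ×ˢ paramFilter B ×ˢ paramFilter C ×ˢ paramFilter D)
        (𝓝 (aeval (qQuadraticLattice q c₁ c₂ c₃ s) (P n)))

/-- Each `P_n(x(s))` is a multiple of the Wilson polynomial
`W_n(-(s + u/2)²; a, b, c, d)`, `u = c₅ / c₄`, on `x(s) = c₄ s² + c₅ s + c₆`. -/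
def IsWilsonFamily (c₄ c₅ c₆ : ℂ) (P : ℕ → ℝ[X]) : Prop :=
  ∃ a b c d : ℂ, ∀ n, ∃ κ : ℂ, ∀ s,
    aeval (quadraticLattice c₄ c₅ c₆ s) (P n) =
      κ * wilson n a b c d (Complex.I * (s + c₅ / c₄ / 2))

/-- Each `P_n(x(s))` is a multiple of the continuous dual Hahn polynomial
`S_n(-(s + u/2)²; a, b, c)`, `u = c₅ / c₄`, on `x(s) = c₄ s² + c₅ s + c₆`. -/
def IsContinuousDualHahnFamily (c₄ c₅ c₆ : ℂ) (P : ℕ → ℝ[X]) : Prop :=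
  ∃ a b c : ℂ, ∀ n, ∃ κ : ℂ, ∀ s,
    aeval (quadraticLattice c₄ c₅ c₆ s) (P n) =
      κ * continuousDualHahn n a b c (Complex.I * (s + c₅ / c₄ / 2))

end

/-! Write x(s ± 1/2) = αx + β ± ε with ε² = U₂(x). Then f(x(s ± 1/2)) = S f ± ε D f for polynomials
S f and D f, so the divided difference becomes an operator D on ℂ[X], and both kinds of lattice are
treated at once through α, β, δ. The pivot is `structure_iff`: for a sequence orthogonal with
respect to a regular functional L, the structure relation holds if and only if all P_n are
eigenfunctions of one operator T f = φ D²f + ψ S D f with deg φ ≤ 2, deg ψ ≤ 1 and (φ, ψ) ≠ 0.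

From the relation to T: since a_{n,n-2} ≠ 0, the D²P_{n+2} are orthogonal with respect to M = πL. A
dimension count gives a Pearson equation for M (`exists_pearson`), so the D²P_n are eigenfunctions
of a second order operator. Every such operator is a lift (`exists_lift_eq`); undoing two lifts
gives T with D²(T P_n - λ_n P_n) = 0. The remainders have degree at most one, and the identity
`hyp_X_X_mul`, the three-term recurrence and orthogonality force them to vanish
(`hyp_eq_of_natDegree_sub_le`).

From T to the relation: L satisfies a Pearson equation, and two summations by parts give L(T(T -
λ₁)f · g) = L(π D²f D²g) with π = φ² - U₂ψ² (`map_hyp_mul_eq`). With g chosen so that D²g = P_m, the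
coefficients of π D²P_n below index n - 2 vanish, and the one at n - 2 is a nonzero multiple of
λ_n(λ_n - λ₁). This is nonzero because regularity of L forces admissibility
(`LatticeParams.adm_ne_zero`), which makes the eigenvalues distinct.

Classification: the five coefficients of (φ, ψ) amount to a quartic h, the coefficient of the
forward shift in T. On a q-quadratic lattice h(z) = ∏(u_i - v_i z) and the Askey–Wilson parameters
are v_i/u_i. If h(0) ≠ 0 they are all finite, and all zero exactly for q-Hermite; if h(0) = 0 some
are infinite, and continuity of eigenfunctions (`tendsto_coeff_of_eigen`) yields the limit families.
On a quadratic lattice admissibility leaves degree four (Wilson) and degree three (continuous dual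
Hahn). The explicit polynomials are eigenfunctions because T is bidiagonal on a basis adapted to one
root of h, or by a generating function for q-Hermite; `eq_C_mul_of_hyp_eq` then identifies them with
P_n up to a constant. -/

/-! ### The operators S and D on polynomials and their identities. -/

/-- The constants of a lattice `x` with `x(s+1/2) + x(s-1/2) = 2αx(s) + 2β` and
`(x(s+1/2) - x(s-1/2))² = 4 U₂(x(s))`, where `U₂ = (α²-1)X² + 2β(α+1)X + δ`. -/
structure LatticeParams where
  /-- half the coefficient of `x(s)` in `x(s+1/2) + x(s-1/2)` -/
  α : ℂ
  /-- half the constant term of `x(s+1/2) + x(s-1/2)` -/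
  β : ℂ
  /-- the constant term of `U₂` -/
  δ : ℂ

noncomputable section

namespace LatticeParams

variable (Λ : LatticeParams)

/-- The polynomial `αX + β`. -/
def ell : ℂ[X] := C Λ.α * X + C Λ.β

/-- The polynomial `U₂ = (α²-1)X² + 2β(α+1)X + δ`. -/
def U₂ : ℂ[X] := C (Λ.α ^ 2 - 1) * X ^ 2 + C (2 * Λ.β * (Λ.α + 1)) * X + C Λ.δ

/-- The polynomial `U₁ = (α²-1)X + β(α+1)`. -/
def U₁ : ℂ[X] := C (Λ.α ^ 2 - 1) * X + C (Λ.β * (Λ.α + 1))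

/-- The polynomial `A` with `A(x(s)) = (x(s+1) + x(s-1)) / 2`. -/
def midpoint : ℂ[X] := C (2 * Λ.α ^ 2 - 1) * X + C (2 * Λ.β * (Λ.α + 1))

/-- The substitution `X ↦ αX + β + ε`, `ε² = U₂`. -/
def shiftHom : ℂ[X] →ₐ[ℂ] QuadraticAlgebra ℂ[X] Λ.U₂ 0 := aeval ⟨Λ.ell, 1⟩

/-- The averaging operator: `f(αX + β + ε) = S f + ε D f`. -/
def S : ℂ[X] →ₗ[ℂ] ℂ[X] where
  toFun f := (Λ.shiftHom f).re
  map_add' f g := by simp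
  map_smul' c f := by simp

/-- The divided difference operator: `f(αX + β + ε) = S f + ε D f`. -/
def D : ℂ[X] →ₗ[ℂ] ℂ[X] where
  toFun f := (Λ.shiftHom f).im
  map_add' f g := by simp
  map_smul' c f := by simp

theorem S_apply (f : ℂ[X]) : Λ.S f = (Λ.shiftHom f).re := rfl
theorem D_apply (f : ℂ[X]) : Λ.D f = (Λ.shiftHom f).im := rfl

/-- Together with `D_mul`, this is multiplicativity of `shiftHom` read off in the two components. -/
theorem S_mul (f g : ℂ[X]) : Λ.S (f * g) = Λ.S f * Λ.S g + Λ.U₂ * (Λ.D f * Λ.D g) := by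
  simp [S_apply, D_apply, mul_assoc]

theorem D_mul (f g : ℂ[X]) : Λ.D (f * g) = Λ.D f * Λ.S g + Λ.S f * Λ.D g := by
  simp [S_apply, D_apply]; ring

@[simp] theorem S_C (c : ℂ) : Λ.S (C c) = C c := by
  have h : Λ.shiftHom (C c) = algebraMap ℂ[X] _ (C c) := by
    rw [shiftHom, aeval_C]; rfl
  rw [S_apply, h]; simp

@[simp] theorem D_C (c : ℂ) : Λ.D (C c) = 0 := by
  have h : Λ.shiftHom (C c) = algebraMap ℂ[X] _ (C c) := by
    rw [shiftHom, aeval_C]; rfl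
  rw [D_apply, h]; simp

@[simp] theorem S_X : Λ.S X = Λ.ell := by simp [S_apply, shiftHom]
@[simp] theorem D_X : Λ.D X = 1 := by simp [D_apply, shiftHom]
@[simp] theorem S_one : Λ.S 1 = 1 := by simpa using Λ.S_C 1
@[simp] theorem D_one : Λ.D 1 = 0 := by simpa using Λ.D_C 1

theorem S_X_mul (f : ℂ[X]) : Λ.S (X * f) = Λ.ell * Λ.S f + Λ.U₂ * Λ.D f := by simp [S_mul]
theorem D_X_mul (f : ℂ[X]) : Λ.D (X * f) = Λ.S f + Λ.ell * Λ.D f := by simp [D_mul]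
theorem S_C_mul (c : ℂ) (f : ℂ[X]) : Λ.S (C c * f) = C c * Λ.S f := by simp [S_mul]
theorem D_C_mul (c : ℂ) (f : ℂ[X]) : Λ.D (C c * f) = C c * Λ.D f := by simp [D_mul]

theorem S_ell : Λ.S Λ.ell = C Λ.α * Λ.ell + C Λ.β := by simp [ell, S_mul]
theorem D_ell : Λ.D Λ.ell = C Λ.α := by simp [ell, D_mul]

theorem S_U₁ : Λ.S Λ.U₁ = C (Λ.α ^ 2 - 1) * Λ.ell + C (Λ.β * (Λ.α + 1)) := by
  simp only [U₁, map_add Λ.S, S_C_mul, S_C, S_X]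
theorem D_U₁ : Λ.D Λ.U₁ = C (Λ.α ^ 2 - 1) := by
  simp only [U₁, map_add Λ.D, D_C_mul, D_C, D_X, mul_one, add_zero]

theorem S_U₂ : Λ.S Λ.U₂ = C (Λ.α ^ 2 - 1) * (Λ.ell ^ 2 + Λ.U₂)
    + C (2 * Λ.β * (Λ.α + 1)) * Λ.ell + C Λ.δ := by
  rw [U₂]
  simp only [map_add, pow_two (X : ℂ[X]), S_C_mul, S_X_mul, S_C, S_X, D_X]
  rw [U₂]; ring

theorem D_U₂ : Λ.D Λ.U₂ = C 2 * (C (Λ.α ^ 2 - 1) * Λ.ell + C (Λ.β * (Λ.α + 1))) := by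
  rw [U₂]
  simp only [map_add, pow_two (X : ℂ[X]), D_C_mul, D_X_mul, D_C, S_X, D_X]
  simp only [ell, map_sub, map_mul, map_add, map_pow, map_one, C_ofNat]; ring

/-- The commutation relations `D S = α S D + U₁ D²` and `S² = 1 + U₁ S D + α U₂ D²`. -/
theorem D_S_and_S_S (f : ℂ[X]) :
    Λ.D (Λ.S f) = C Λ.α * Λ.S (Λ.D f) + Λ.U₁ * Λ.D (Λ.D f) ∧
    Λ.S (Λ.S f) = f + Λ.U₁ * Λ.S (Λ.D f) + C Λ.α * Λ.U₂ * Λ.D (Λ.D f) := by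
  induction f using Polynomial.induction_on with
  | C a => simp
  | add f g hf hg =>
    simp only [map_add, hf.1, hf.2, hg.1, hg.2]
    constructor <;> ring
  | monomial n a ih =>
    have h : C a * X ^ (n + 1) = X * (C a * X ^ n) := by ring
    rw [h]
    generalize C a * X ^ n = g at ih
    simp only [map_add, D_mul, S_mul, D_X, S_X, D_one, S_one, D_ell, S_ell, S_U₂, D_U₂,
      ih.1, ih.2]
    simp only [U₁, U₂, ell, map_sub, map_mul, map_add, map_pow, map_one, C_ofNat]
    constructor <;> ring

theorem D_S (f : ℂ[X]) :
    Λ.D (Λ.S f) = C Λ.α * Λ.S (Λ.D f) + Λ.U₁ * Λ.D (Λ.D f) := (Λ.D_S_and_S_S f).1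

theorem S_S (f : ℂ[X]) :
    Λ.S (Λ.S f) = f + Λ.U₁ * Λ.S (Λ.D f) + C Λ.α * Λ.U₂ * Λ.D (Λ.D f) := (Λ.D_S_and_S_S f).2

/-- The first order operator `F ↦ φ D F + ψ S F`. -/
def pearson (φ ψ : ℂ[X]) : ℂ[X] →ₗ[ℂ] ℂ[X] :=
  LinearMap.mulLeft ℂ φ ∘ₗ Λ.D + LinearMap.mulLeft ℂ ψ ∘ₗ Λ.S

/-- The second order operator `f ↦ φ D² f + ψ S D f`. -/
def hyp (φ ψ : ℂ[X]) : ℂ[X] →ₗ[ℂ] ℂ[X] := Λ.pearson φ ψ ∘ₗ Λ.D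

theorem pearson_apply (φ ψ F : ℂ[X]) : Λ.pearson φ ψ F = φ * Λ.D F + ψ * Λ.S F := rfl

theorem hyp_apply (φ ψ f : ℂ[X]) :
    Λ.hyp φ ψ f = φ * Λ.D (Λ.D f) + ψ * Λ.S (Λ.D f) := rfl

theorem hyp_eq_pearson (φ ψ f : ℂ[X]) : Λ.hyp φ ψ f = Λ.pearson φ ψ (Λ.D f) := rfl

/-- The leading coefficient of the operator `D ∘ hyp φ ψ`, as an operator acting on `D f`. -/
def liftφ (φ ψ : ℂ[X]) : ℂ[X] := Λ.S φ + C Λ.α * Λ.U₂ * Λ.D ψ + Λ.U₁ * Λ.S ψ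

/-- The first order coefficient of the operator `D ∘ hyp φ ψ`, as an operator acting on `D f`. -/
def liftψ (φ ψ : ℂ[X]) : ℂ[X] := Λ.D φ + Λ.U₁ * Λ.D ψ + C Λ.α * Λ.S ψ

/-- Product rule and commutation relations. When ψ has degree at most one, `D ψ` is a constant, so D
carries eigenfunctions to eigenfunctions of the lifted operator. -/
theorem D_hyp (φ ψ f : ℂ[X]) :
    Λ.D (Λ.hyp φ ψ f) =
      Λ.hyp (Λ.liftφ φ ψ) (Λ.liftψ φ ψ) (Λ.D f) + Λ.D ψ * Λ.D f := by
  simp only [hyp_apply, liftφ, liftψ, map_add, D_mul, S_S, D_S]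
  ring

/-- Lagrange identity: it makes `hyp φ ψ` symmetric for every functional that annihilates the range
of `pearson φ ψ`. -/
theorem hyp_mul_sub_mul_hyp (φ ψ f g : ℂ[X]) :
    Λ.hyp φ ψ f * g - f * Λ.hyp φ ψ g =
      Λ.pearson φ ψ (Λ.D f * Λ.S g - Λ.S f * Λ.D g) := by
  simp only [hyp_apply, pearson_apply, map_sub, D_mul, S_mul, S_S, D_S]
  ring

-- Summation by parts: for a functional L annihilating the range of `pearson φ ψ`, the form L(T f ·
-- g) depends only on the product D f · D g.
set_option maxRecDepth 10000 in
theorem hyp_mul (φ ψ f g : ℂ[X]) :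
    Λ.hyp φ ψ f * g = X * Λ.pearson φ ψ (Λ.D f * Λ.D g) +
      Λ.pearson φ ψ (Λ.D f * Λ.S g - C Λ.α * (X * (Λ.D f * Λ.D g)) - C Λ.β * (Λ.D f * Λ.D g)) := by
  simp only [hyp_apply, pearson_apply, map_sub, D_mul, S_mul, D_X, S_X, D_C, S_C, S_S, D_S]
  simp only [U₁, U₂, ell, map_sub, map_mul, map_add, map_pow, map_one, C_ofNat]
  ring

/-- With F± = F(αX + β ± ε), `pearson φ ψ F` is the divided difference of (φ + εψ)F₊ and (φ - εψ)F₋,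
and φ S F + U₂ψ D F is their average; multiplying F by X mixes the two. -/
theorem pearson_X_mul (φ ψ F : ℂ[X]) :
    Λ.pearson φ ψ (X * F) =
      Λ.ell * Λ.pearson φ ψ F + (φ * Λ.S F + Λ.U₂ * ψ * Λ.D F) := by
  simp only [pearson_apply, D_X_mul, S_X_mul]; ring

/-- On a lattice ε(s ± 1/2) = αε(s) ± U₁(x(s)). Hence the lifted expression is the divided
difference of (φ + εψ)F taken at s + 1/2 and (φ - εψ)F taken at s - 1/2: the shift now acts on the
coefficients too. -/
theorem pearson_lift (φ ψ F : ℂ[X]) :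
    Λ.pearson (Λ.liftφ φ ψ) (Λ.liftψ φ ψ) F =
      Λ.D (φ * F) + C Λ.α * Λ.S (ψ * F) + Λ.U₁ * Λ.D (ψ * F) := by
  simp only [pearson_apply, liftφ, liftψ, D_mul, S_mul]; ring

-- Going half a step up and back down meets both φ + εψ and φ - εψ at the same point; their product
-- is φ² - U₂ψ². The remaining terms form total Pearson expressions, with a common H.
set_option maxRecDepth 10000 in
theorem exists_X_mul_pearson (φ ψ F : ℂ[X]) : ∃ H : ℂ[X],
    X * Λ.pearson φ ψ (Λ.pearson (Λ.liftφ φ ψ) (Λ.liftψ φ ψ) F) = Λ.pearson φ ψ H ∧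
    X * Λ.pearson φ ψ (X * Λ.pearson (Λ.liftφ φ ψ) (Λ.liftψ φ ψ) F) =
      (φ ^ 2 - Λ.U₂ * ψ ^ 2) * F + Λ.pearson φ ψ (X * H) := by
  rw [pearson_lift]
  obtain ⟨a, ha⟩ : ∃ a, a = φ * F := ⟨_, rfl⟩
  obtain ⟨b, hb⟩ : ∃ b, b = ψ * F := ⟨_, rfl⟩
  rw [← ha, ← hb]
  refine ⟨Λ.ell * (Λ.D a + C Λ.α * Λ.S b + Λ.U₁ * Λ.D b)
    - (Λ.S a + Λ.U₁ * Λ.S b + C Λ.α * Λ.U₂ * Λ.D b), ?_, ?_⟩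
  all_goals
    simp only [pearson_apply, map_add, map_sub, D_mul, S_mul, D_X, S_X, D_C, S_C, D_ell, S_ell,
      S_S, D_S, S_U₁, D_U₁, S_U₂, D_U₂]
    simp only [U₁, U₂, ell, map_sub, map_mul, map_add, map_pow, map_one, C_ofNat]
    rw [ha, hb]
    ring

/-- Since α ≠ 0 on the lattices in question, this recovers S D from D² and multiplication by X. -/
theorem D_D_X_mul (f : ℂ[X]) :
    Λ.D (Λ.D (X * f)) = C (2 * Λ.α) * Λ.S (Λ.D f) + Λ.midpoint * Λ.D (Λ.D f) := by
  simp only [map_add, D_mul, D_X, S_X, D_one, S_one, D_S, D_ell, S_ell]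
  simp only [midpoint, ell, U₁, map_sub, map_mul, map_add, map_pow, map_one, C_ofNat]
  ring

-- The quadratic Y² - 2AY + (A² - 4α²U₂), with A = `midpoint`, has roots x(s+1) and x(s-1). So this
-- combination removes the two shifted values from T, and only a multiple of f itself remains.
set_option maxRecDepth 10000 in
theorem hyp_X_X_mul (φ ψ f : ℂ[X]) :
    Λ.hyp φ ψ (X * (X * f)) - 2 * Λ.midpoint * Λ.hyp φ ψ (X * f)
      + (Λ.midpoint ^ 2 - C (4 * Λ.α ^ 2) * Λ.U₂) * Λ.hyp φ ψ f =
      (C (2 * Λ.α) * φ + ψ * (X - Λ.midpoint)) * f := by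
  simp only [hyp_apply, map_add, D_mul, S_mul, D_X, S_X, D_one, S_one, D_ell, S_ell, D_S, S_S,
    S_U₂, D_U₂]
  simp only [midpoint, U₁, U₂, ell, map_sub, map_mul, map_add, map_pow, map_one, C_ofNat]
  ring

end LatticeParams
end

/-! ### Leading coefficients, degrees, and inversion of the lift. -/

noncomputable section

namespace LatticeParams

variable (Λ : LatticeParams)

/-- The leading coefficients of `S Xⁿ` and `D Xⁿ`. -/
def lead : ℕ → ℂ × ℂ
  | 0 => (1, 0)
  | n + 1 => (Λ.α * (lead n).1 + (Λ.α ^ 2 - 1) * (lead n).2, (lead n).1 + Λ.α * (lead n).2)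

/-- The leading coefficient of `S Xⁿ`. -/
def leadS (n : ℕ) : ℂ := (Λ.lead n).1

/-- The leading coefficient of `D Xⁿ`. -/
def leadD (n : ℕ) : ℂ := (Λ.lead n).2

@[simp] theorem leadS_zero : Λ.leadS 0 = 1 := rfl
@[simp] theorem leadD_zero : Λ.leadD 0 = 0 := rfl
theorem leadS_succ (n : ℕ) :
    Λ.leadS (n + 1) = Λ.α * Λ.leadS n + (Λ.α ^ 2 - 1) * Λ.leadD n := rfl
theorem leadD_succ (n : ℕ) : Λ.leadD (n + 1) = Λ.leadS n + Λ.α * Λ.leadD n := rfl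
@[simp] theorem leadS_one : Λ.leadS 1 = Λ.α := by simp [leadS_succ]
@[simp] theorem leadD_one : Λ.leadD 1 = 1 := by simp [leadD_succ]

/-- Addition formulas: for α = cosh t these are cosh(nt) and sinh(nt)/sinh t. -/
theorem lead_add (m n : ℕ) :
    Λ.leadS (m + n) = Λ.leadS m * Λ.leadS n + (Λ.α ^ 2 - 1) * (Λ.leadD m * Λ.leadD n) ∧
    Λ.leadD (m + n) = Λ.leadD m * Λ.leadS n + Λ.leadS m * Λ.leadD n := by
  induction n with
  | zero => simp
  | succ n ih =>
    simp only [← add_assoc, leadS_succ, leadD_succ, ih.1, ih.2]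
    constructor <;> ring

theorem lead_sq (n : ℕ) : Λ.leadS n ^ 2 - (Λ.α ^ 2 - 1) * Λ.leadD n ^ 2 = 1 := by
  induction n with
  | zero => simp
  | succ n ih => rw [leadS_succ, leadD_succ]; linear_combination ih

/-- The leading coefficient of `φ D Xⁿ + ψ S Xⁿ`, where `φ = aX² + ⋯` and `ψ = bX + ⋯`. -/
def adm (a b : ℂ) (n : ℕ) : ℂ := a * Λ.leadD n + b * Λ.leadS n

/-- The leading coefficient of `φ D² Xⁿ + ψ S D Xⁿ`, where `φ = aX² + ⋯` and `ψ = bX + ⋯`. -/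
def eig (a b : ℂ) : ℕ → ℂ
  | 0 => 0
  | n + 1 => Λ.leadD (n + 1) * Λ.adm a b n

theorem eig_succ (a b : ℂ) (n : ℕ) : Λ.eig a b (n + 1) = Λ.leadD (n + 1) * Λ.adm a b n := rfl
@[simp] theorem eig_zero (a b : ℂ) : Λ.eig a b 0 = 0 := rfl

theorem eig_eq (a b : ℂ) (n : ℕ) : Λ.eig a b n = Λ.leadD n *
    (a * (Λ.α * Λ.leadD n - Λ.leadS n) + b * (Λ.α * Λ.leadS n - (Λ.α ^ 2 - 1) * Λ.leadD n)) := by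
  cases n with
  | zero => simp
  | succ n => rw [eig_succ, adm, leadS_succ, leadD_succ]; ring

/-- A product-to-sum formula. When no positive-index `leadD` vanishes, the eigenvalues are pairwise
distinct exactly when no `adm` vanishes. -/
theorem eig_sub_eig (a b : ℂ) (m k : ℕ) :
    Λ.eig a b (m + k + 1) - Λ.eig a b m = Λ.leadD (k + 1) * Λ.adm a b (m + m + k) := by
  rw [eig_succ, eig_eq, adm, adm, (Λ.lead_add (m + m) k).1, (Λ.lead_add (m + m) k).2,
    (Λ.lead_add m m).1, (Λ.lead_add m m).2, leadD_succ, leadD_succ, (Λ.lead_add m k).1,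
    (Λ.lead_add m k).2]
  have hm := Λ.lead_sq m
  have hk := Λ.lead_sq k
  generalize Λ.leadS m = c at *
  generalize Λ.leadS k = C at *
  generalize Λ.leadD m = s at *
  generalize Λ.leadD k = S at *
  generalize Λ.α = t at *
  grind

variable {Λ}

theorem natDegree_ell_le : Λ.ell.natDegree ≤ 1 := by rw [ell]; compute_degree
theorem natDegree_U₂_le : Λ.U₂.natDegree ≤ 2 := by rw [U₂]; compute_degree
theorem natDegree_U₁_le : Λ.U₁.natDegree ≤ 1 := by rw [U₁]; compute_degree
theorem natDegree_midpoint_le : Λ.midpoint.natDegree ≤ 1 := by rw [midpoint]; compute_degree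
theorem coeff_ell : Λ.ell.coeff 1 = Λ.α := by rw [ell]; compute_degree!
theorem coeff_U₂ : Λ.U₂.coeff 2 = Λ.α ^ 2 - 1 := by rw [U₂]; compute_degree!
theorem coeff_U₁ : Λ.U₁.coeff 1 = Λ.α ^ 2 - 1 := by rw [U₁]; compute_degree!

/-- S and D feed into each other under multiplication by X, so one induction along f = X · `divX` f
+ f(0) carries all four claims. -/
theorem S_D_degree_succ (n : ℕ) (f : ℂ[X]) (hf : f.natDegree ≤ n + 1) :
    ((Λ.S f).natDegree ≤ n + 1 ∧ (Λ.S f).coeff (n + 1) = Λ.leadS (n + 1) * f.coeff (n + 1)) ∧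
    ((Λ.D f).natDegree ≤ n ∧ (Λ.D f).coeff n = Λ.leadD (n + 1) * f.coeff (n + 1)) := by
  induction n generalizing f with
  | zero =>
    obtain ⟨a, b, rfl⟩ := exists_eq_X_add_C_of_natDegree_le_one hf
    simp only [map_add, S_C_mul, D_C_mul, S_X, D_X, S_C, D_C, ell]
    refine ⟨⟨by compute_degree, ?_⟩, by compute_degree, ?_⟩
    · simp; ring
    · simp
  | succ n ih =>
    have hg : f.divX.natDegree ≤ n + 1 := by
      rw [natDegree_divX_eq_natDegree_tsub_one]; omega
    obtain ⟨⟨h1, h2⟩, h3, h4⟩ := ih _ hg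
    rw [coeff_divX] at h2 h4
    have e : f = X * f.divX + C (f.coeff 0) := (X_mul_divX_add f).symm
    have eS : Λ.S f = Λ.ell * Λ.S f.divX + Λ.U₂ * Λ.D f.divX + C (f.coeff 0) := by
      conv_lhs => rw [e]
      rw [map_add, S_X_mul, S_C]
    have eD : Λ.D f = Λ.S f.divX + Λ.ell * Λ.D f.divX := by
      conv_lhs => rw [e]
      rw [map_add, D_X_mul, D_C, add_zero]
    have d1 : (Λ.ell * Λ.S f.divX).natDegree ≤ 1 + (n + 1) :=
      natDegree_mul_le_of_le natDegree_ell_le h1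
    have d2 : (Λ.U₂ * Λ.D f.divX).natDegree ≤ 2 + n :=
      natDegree_mul_le_of_le natDegree_U₂_le h3
    have d3 : (Λ.ell * Λ.D f.divX).natDegree ≤ 1 + n :=
      natDegree_mul_le_of_le natDegree_ell_le h3
    have c1 := coeff_mul_add_eq_of_natDegree_le (natDegree_ell_le (Λ := Λ)) h1
    have c2 := coeff_mul_add_eq_of_natDegree_le (natDegree_U₂_le (Λ := Λ)) h3
    have c3 := coeff_mul_add_eq_of_natDegree_le (natDegree_ell_le (Λ := Λ)) h3
    rw [show 1 + (n + 1) = n + 1 + 1 by ring] at d1 c1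
    rw [show 2 + n = n + 1 + 1 by ring] at d2 c2
    rw [add_comm 1 n] at d3 c3
    rw [eS, eD]
    refine ⟨⟨?_, ?_⟩, ?_, ?_⟩
    · exact natDegree_add_le_of_degree_le (natDegree_add_le_of_degree_le d1 d2) (by simp)
    · rw [coeff_add, coeff_add, c1, c2, coeff_C_succ, h2, h4, coeff_ell, coeff_U₂, leadS_succ (n := n + 1)]
      ring
    · exact natDegree_add_le_of_degree_le h1 d3
    · rw [coeff_add, c3, h2, h4, coeff_ell, leadD_succ (n := n + 1)]; ring

theorem natDegree_S_le {n : ℕ} {f : ℂ[X]} (hf : f.natDegree ≤ n) : (Λ.S f).natDegree ≤ n := by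
  cases n with
  | zero => obtain ⟨c, rfl⟩ : ∃ c, f = C c := ⟨_, eq_C_of_natDegree_le_zero hf⟩; simp
  | succ n => exact (S_D_degree_succ n f hf).1.1

theorem coeff_S {n : ℕ} {f : ℂ[X]} (hf : f.natDegree ≤ n) :
    (Λ.S f).coeff n = Λ.leadS n * f.coeff n := by
  cases n with
  | zero => obtain ⟨c, rfl⟩ : ∃ c, f = C c := ⟨_, eq_C_of_natDegree_le_zero hf⟩; simp
  | succ n => exact (S_D_degree_succ n f hf).1.2

theorem natDegree_D_le {n : ℕ} {f : ℂ[X]} (hf : f.natDegree ≤ n) :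
    (Λ.D f).natDegree ≤ n - 1 := by
  cases n with
  | zero => obtain ⟨c, rfl⟩ : ∃ c, f = C c := ⟨_, eq_C_of_natDegree_le_zero hf⟩; simp
  | succ n => exact (S_D_degree_succ n f hf).2.1

theorem coeff_D {n : ℕ} {f : ℂ[X]} (hf : f.natDegree ≤ n + 1) :
    (Λ.D f).coeff n = Λ.leadD (n + 1) * f.coeff (n + 1) := (S_D_degree_succ n f hf).2.2

theorem natDegree_pearson_le {φ ψ F : ℂ[X]} {n : ℕ} (hφ : φ.natDegree ≤ 2) (hψ : ψ.natDegree ≤ 1)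
    (hF : F.natDegree ≤ n) : (Λ.pearson φ ψ F).natDegree ≤ n + 1 := by
  rw [pearson_apply]
  cases n with
  | zero =>
    obtain ⟨c, rfl⟩ : ∃ c, F = C c := ⟨_, eq_C_of_natDegree_le_zero hF⟩
    simpa using (natDegree_mul_C_le _ _).trans hψ
  | succ n =>
    refine natDegree_add_le_of_degree_le ?_ ?_
    · exact (natDegree_mul_le_of_le hφ (natDegree_D_le hF)).trans (by omega)
    · exact (natDegree_mul_le_of_le hψ (natDegree_S_le hF)).trans (by omega)

theorem coeff_pearson {φ ψ F : ℂ[X]} {n : ℕ} (hφ : φ.natDegree ≤ 2) (hψ : ψ.natDegree ≤ 1)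
    (hF : F.natDegree ≤ n) :
    (Λ.pearson φ ψ F).coeff (n + 1) = Λ.adm (φ.coeff 2) (ψ.coeff 1) n * F.coeff n := by
  rw [pearson_apply, adm]
  cases n with
  | zero =>
    obtain ⟨c, rfl⟩ : ∃ c, F = C c := ⟨_, eq_C_of_natDegree_le_zero hF⟩
    simp
  | succ n =>
    have h1 := coeff_mul_add_eq_of_natDegree_le hφ (natDegree_D_le (Λ := Λ) hF)
    have h2 := coeff_mul_add_eq_of_natDegree_le hψ (natDegree_S_le (Λ := Λ) hF)
    rw [show 2 + (n + 1 - 1) = n + 1 + 1 by omega, Nat.add_sub_cancel] at h1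
    rw [add_comm 1] at h2
    rw [coeff_add, h1, h2, coeff_D hF, coeff_S hF]; ring

theorem natDegree_hyp_le {φ ψ f : ℂ[X]} {n : ℕ} (hφ : φ.natDegree ≤ 2) (hψ : ψ.natDegree ≤ 1)
    (hf : f.natDegree ≤ n) : (Λ.hyp φ ψ f).natDegree ≤ n := by
  cases n with
  | zero =>
    obtain ⟨c, rfl⟩ : ∃ c, f = C c := ⟨_, eq_C_of_natDegree_le_zero hf⟩
    simp [hyp_apply]
  | succ n =>
    rw [hyp_eq_pearson]
    exact natDegree_pearson_le hφ hψ (natDegree_D_le (n := n + 1) hf)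

theorem coeff_hyp {φ ψ f : ℂ[X]} {n : ℕ} (hφ : φ.natDegree ≤ 2) (hψ : ψ.natDegree ≤ 1)
    (hf : f.natDegree ≤ n) :
    (Λ.hyp φ ψ f).coeff n = Λ.eig (φ.coeff 2) (ψ.coeff 1) n * f.coeff n := by
  cases n with
  | zero =>
    obtain ⟨c, rfl⟩ : ∃ c, f = C c := ⟨_, eq_C_of_natDegree_le_zero hf⟩
    simp [hyp_apply]
  | succ n =>
    rw [hyp_eq_pearson, coeff_pearson (n := n) hφ hψ (natDegree_D_le hf), coeff_D hf, eig_succ]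
    ring

/-- The second order operator attached to `(φ, ψ)` arises by lifting from another one. -/
theorem exists_lift_eq {φ ψ : ℂ[X]} (hφ : φ.natDegree ≤ 2) (hψ : ψ.natDegree ≤ 1) :
    ∃ φ' ψ' : ℂ[X], φ'.natDegree ≤ 2 ∧ ψ'.natDegree ≤ 1 ∧
      Λ.liftφ φ' ψ' = φ ∧ Λ.liftψ φ' ψ' = ψ := by
  set t := Λ.α with ht
  set β := Λ.β with hβ
  -- Lifting is block triangular in the coefficients. The blocks for (f₂, g₁) and (f₁, g₀) both have
  -- determinant 1, and f₀ enters with coefficient 1, so inversion needs no condition on the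
  -- lattice.
  set f₂ := (2 * t ^ 2 - 1) * φ.coeff 2 - 2 * t * (t ^ 2 - 1) * ψ.coeff 1 with hf₂
  set g₁ := -2 * t * φ.coeff 2 + (2 * t ^ 2 - 1) * ψ.coeff 1 with hg₁
  set p := φ.coeff 1 - f₂ * (4 * t * β + 2 * β) - g₁ * (4 * t ^ 2 * β + 3 * t * β - β) with hp
  set r := ψ.coeff 0 - 2 * β * f₂ - g₁ * (2 * t * β + β) with hr
  set f₁ := t * p - (t ^ 2 - 1) * r with hf₁
  set g₀ := t * r - p with hg₀
  set f₀ := φ.coeff 0 - f₂ * (β ^ 2 + Λ.δ) - f₁ * β - t * Λ.δ * g₁ - β * (t + 1) * (g₁ * β + g₀)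
    with hf₀
  have e₁ : φ = C (φ.coeff 2) * X ^ 2 + C (φ.coeff 1) * X + C (φ.coeff 0) := by
    conv_lhs => rw [φ.as_sum_range_C_mul_X_pow' (show φ.natDegree < 3 by omega)]
    simp [Finset.sum_range_succ]; ring
  have e₂ : ψ = C (ψ.coeff 1) * X + C (ψ.coeff 0) := by
    conv_lhs => rw [ψ.as_sum_range_C_mul_X_pow' (show ψ.natDegree < 2 by omega)]
    simp [Finset.sum_range_succ]; ring
  refine ⟨C f₂ * X ^ 2 + C f₁ * X + C f₀, C g₁ * X + C g₀, by compute_degree, by compute_degree,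
    ?_, ?_⟩
  · conv_rhs => rw [e₁]
    rw [show φ.coeff 0 = f₀ + f₂ * (β ^ 2 + Λ.δ) + f₁ * β + t * Λ.δ * g₁
        + β * (t + 1) * (g₁ * β + g₀) by rw [hf₀]; ring,
      show φ.coeff 1 = t * f₁ + (t ^ 2 - 1) * g₀ + f₂ * (4 * t * β + 2 * β)
        + g₁ * (4 * t ^ 2 * β + 3 * t * β - β) by rw [hf₁, hg₀, hp]; ring,
      show φ.coeff 2 = (2 * t ^ 2 - 1) * f₂ + 2 * t * (t ^ 2 - 1) * g₁ by rw [hf₂, hg₁]; ring]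
    simp only [liftφ, pow_two (X : ℂ[X]), map_add, S_mul, D_mul, S_C, D_C, S_X, D_X, U₁, U₂, ell,
      ← ht, ← hβ]
    clear_value f₂ g₁ f₁ g₀ f₀ t β
    simp only [map_sub, map_mul, map_add, map_pow, map_one, C_ofNat]
    ring
  · conv_rhs => rw [e₂]
    rw [show ψ.coeff 0 = f₁ + t * g₀ + 2 * β * f₂ + g₁ * (2 * t * β + β) by
        rw [hf₁, hg₀, hr]; ring,
      show ψ.coeff 1 = 2 * t * f₂ + (2 * t ^ 2 - 1) * g₁ by rw [hf₂, hg₁]; ring]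
    simp only [liftψ, pow_two (X : ℂ[X]), map_add, S_mul, D_mul, S_C, D_C, S_X, D_X, U₁, U₂, ell,
      ← ht, ← hβ]
    clear_value f₂ g₁ f₁ g₀ f₀ t β
    simp only [map_sub, map_mul, map_add, map_pow, map_one, C_ofNat]
    ring

end LatticeParams
end

/-! ### Lattice functions of s and the passage to polynomial identities. -/

noncomputable section

namespace LatticeParams

variable {Λ : LatticeParams}

/-- The conditions under which `D` lowers degrees by exactly one, `2αSD` can be recovered from
`D²`, and the lattice has enough points. -/
structure Nondegenerate (Λ : LatticeParams) : Prop where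
  leadD_ne (n : ℕ) : Λ.leadD (n + 1) ≠ 0
  α_ne : Λ.α ≠ 0
  U₂_ne : Λ.U₂ ≠ 0
  disc_ne : Λ.U₁ ^ 2 - C (Λ.α ^ 2) * Λ.U₂ ≠ 0

/-- `x` is a lattice with constants `Λ`. -/
structure IsLattice (Λ : LatticeParams) (x : ℂ → ℂ) : Prop where
  sum_eq (s : ℂ) : x (s + 1 / 2) + x (s - 1 / 2) = 2 * Λ.α * x s + 2 * Λ.β
  sq_eq (s : ℂ) : (x (s + 1 / 2) - x (s - 1 / 2)) ^ 2 = 4 * Λ.U₂.eval (x s)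
  surj : Function.Surjective x

/-- The formal ε may be specialised to either square root of U₂(y); the two signs give the shifts s
± 1/2. -/
theorem eval_ell_add (y e : ℂ) (he : e ^ 2 = Λ.U₂.eval y) (f : ℂ[X]) :
    f.eval (Λ.ell.eval y + e) = (Λ.S f).eval y + e * (Λ.D f).eval y := by
  induction f using Polynomial.induction_on with
  | C a => simp
  | add f g hf hg => simp only [eval_add, map_add, hf, hg]; ring
  | monomial n a ih =>
    have h : C a * X ^ (n + 1) = X * (C a * X ^ n) := by ring
    rw [h, S_X_mul, D_X_mul]
    simp only [eval_mul (p := X), eval_mul (p := Λ.ell), eval_mul (p := Λ.U₂), eval_add, ih, eval_X]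
    linear_combination (Λ.D (C a * X ^ n)).eval y * he

namespace IsLattice

variable {x : ℂ → ℂ}

theorem eval_add_half (hx : Λ.IsLattice x) (s : ℂ) :
    x (s + 1 / 2) = Λ.ell.eval (x s) + (x (s + 1 / 2) - x (s - 1 / 2)) / 2 := by
  have := hx.sum_eq s
  simp only [ell, eval_add, eval_mul, eval_C, eval_X]
  linear_combination this / 2

theorem eval_sub_half (hx : Λ.IsLattice x) (s : ℂ) :
    x (s - 1 / 2) = Λ.ell.eval (x s) + -((x (s + 1 / 2) - x (s - 1 / 2)) / 2) := by
  have := hx.sum_eq s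
  simp only [ell, eval_add, eval_mul, eval_C, eval_X]
  linear_combination this / 2

theorem eval_shift_add (hx : Λ.IsLattice x) (f : ℂ[X]) (s : ℂ) :
    f.eval (x (s + 1 / 2)) = (Λ.S f).eval (x s)
      + (x (s + 1 / 2) - x (s - 1 / 2)) / 2 * (Λ.D f).eval (x s) := by
  conv_lhs => rw [hx.eval_add_half s]
  exact eval_ell_add _ _ (by linear_combination hx.sq_eq s / 4) _

theorem eval_shift_sub (hx : Λ.IsLattice x) (f : ℂ[X]) (s : ℂ) :
    f.eval (x (s - 1 / 2)) = (Λ.S f).eval (x s)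
      - (x (s + 1 / 2) - x (s - 1 / 2)) / 2 * (Λ.D f).eval (x s) := by
  conv_lhs => rw [hx.eval_sub_half s]
  rw [eval_ell_add _ _ (by linear_combination hx.sq_eq s / 4) f]; ring

theorem eval_S (hx : Λ.IsLattice x) (f : ℂ[X]) (s : ℂ) :
    (Λ.S f).eval (x s) = (f.eval (x (s + 1 / 2)) + f.eval (x (s - 1 / 2))) / 2 := by
  rw [hx.eval_shift_add, hx.eval_shift_sub]; ring

theorem eval_D (hx : Λ.IsLattice x) (f : ℂ[X]) {s : ℂ} (hs : x (s + 1 / 2) ≠ x (s - 1 / 2)) :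
    (Λ.D f).eval (x s) =
      (f.eval (x (s + 1 / 2)) - f.eval (x (s - 1 / 2))) / (x (s + 1 / 2) - x (s - 1 / 2)) := by
  rw [eq_div_iff (sub_ne_zero.2 hs), hx.eval_shift_add f, hx.eval_shift_sub f]; ring

theorem eval_D_add_half (hx : Λ.IsLattice x) (f : ℂ[X]) {s : ℂ} (hs : x (s + 1) ≠ x s) :
    (Λ.D f).eval (x (s + 1 / 2)) = (f.eval (x (s + 1)) - f.eval (x s)) / (x (s + 1) - x s) := by
  have h1 : s + 1 / 2 + 1 / 2 = s + 1 := by ring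
  have h2 : s + 1 / 2 - 1 / 2 = s := by ring
  rw [hx.eval_D f (by rwa [h1, h2]), h1, h2]

theorem eval_D_sub_half (hx : Λ.IsLattice x) (f : ℂ[X]) {s : ℂ} (hs : x s ≠ x (s - 1)) :
    (Λ.D f).eval (x (s - 1 / 2)) = (f.eval (x s) - f.eval (x (s - 1))) / (x s - x (s - 1)) := by
  have h1 : s - 1 / 2 + 1 / 2 = s := by ring
  have h2 : s - 1 / 2 - 1 / 2 = s - 1 := by ring
  rw [hx.eval_D f (by rwa [h1, h2]), h1, h2]

theorem dividedDiff_dividedDiff_eval (hx : Λ.IsLattice x) (f : ℂ[X]) {s : ℂ}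
    (h1 : x (s + 1 / 2) ≠ x (s - 1 / 2)) (h2 : x (s + 1) ≠ x s) (h3 : x s ≠ x (s - 1)) :
    dividedDiff x (dividedDiff x (fun t => f.eval (x t))) s =
      (Λ.D (Λ.D f)).eval (x s) := by
  rw [hx.eval_D _ h1, hx.eval_D_add_half _ h2, hx.eval_D_sub_half _ h3, dividedDiff, dividedDiff,
    dividedDiff, show s + 1 / 2 + 1 / 2 = s + 1 by ring, show s + 1 / 2 - 1 / 2 = s by ring,
    show s - 1 / 2 + 1 / 2 = s by ring, show s - 1 / 2 - 1 / 2 = s - 1 by ring]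

/-- The second order operator in terms of shifts. -/
theorem eval_hyp (hx : Λ.IsLattice x) (φ ψ f : ℂ[X]) {s : ℂ}
    (h1 : x (s + 1 / 2) ≠ x (s - 1 / 2)) (h2 : x (s + 1) ≠ x s) (h3 : x s ≠ x (s - 1)) :
    (Λ.hyp φ ψ f).eval (x s) =
      ((φ.eval (x s) + (x (s + 1 / 2) - x (s - 1 / 2)) / 2 * ψ.eval (x s)) *
          ((f.eval (x (s + 1)) - f.eval (x s)) / (x (s + 1) - x s)) -
        (φ.eval (x s) - (x (s + 1 / 2) - x (s - 1 / 2)) / 2 * ψ.eval (x s)) *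
          ((f.eval (x s) - f.eval (x (s - 1))) / (x s - x (s - 1)))) /
      (x (s + 1 / 2) - x (s - 1 / 2)) := by
  have hs' := sub_ne_zero.2 h1
  rw [hyp_apply, eval_add, eval_mul, eval_mul, hx.eval_D _ h1, hx.eval_S,
    hx.eval_D_add_half _ h2, hx.eval_D_sub_half _ h3]
  generalize (f.eval (x (s + 1)) - f.eval (x s)) / (x (s + 1) - x s) = u
  generalize (f.eval (x s) - f.eval (x (s - 1))) / (x s - x (s - 1)) = v
  generalize x (s + 1 / 2) - x (s - 1 / 2) = d at *
  field_simp
  ring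

/-- Polynomials which agree at all lattice points at which `𝔻ₓ²` is defined are equal. -/
theorem eq_of_eval_eq (hx : Λ.IsLattice x) (hΛ : Λ.Nondegenerate) {f g : ℂ[X]}
    (h : ∀ s, x (s + 1 / 2) ≠ x (s - 1 / 2) → x (s + 1) ≠ x s → x s ≠ x (s - 1) →
      f.eval (x s) = g.eval (x s)) : f = g := by
  -- The extra factor vanishes at x(s) exactly when one of the three denominators does: U₂ is the
  -- square of the central one up to 4, the other factor the product of the outer two up to -4.
  have key : (f - g) * (Λ.U₂ * (Λ.U₁ ^ 2 - C (Λ.α ^ 2) * Λ.U₂)) = 0 := by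
    refine Polynomial.funext fun y => ?_
    obtain ⟨s, rfl⟩ := hx.surj y
    have hsq := hx.sq_eq s
    have e1 := hx.sum_eq s
    have e2 := hx.sum_eq (s + 1 / 2)
    have e3 := hx.sum_eq (s - 1 / 2)
    rw [show s + 1 / 2 + 1 / 2 = s + 1 by ring, show s + 1 / 2 - 1 / 2 = s by ring] at e2
    rw [show s - 1 / 2 + 1 / 2 = s by ring, show s - 1 / 2 - 1 / 2 = s - 1 by ring] at e3
    have hprod : 4 * (Λ.U₁ ^ 2 - C (Λ.α ^ 2) * Λ.U₂).eval (x s) =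
        -((x (s + 1) - x s) * (x s - x (s - 1))) := by
      have hU : Λ.U₁.eval (x s) = (Λ.α ^ 2 - 1) * x s + Λ.β * (Λ.α + 1) := by
        simp [U₁, -map_sub, -map_mul, -map_add]
      simp only [eval_sub, eval_pow, eval_mul, eval_C, hU]
      rw [show x (s + 1) = 2 * Λ.α * x (s + 1 / 2) + 2 * Λ.β - x s by linear_combination e2,
        show x (s - 1) = 2 * Λ.α * x (s - 1 / 2) + 2 * Λ.β - x s by linear_combination e3]
      have e4 : x (s + 1 / 2) = 2 * Λ.α * x s + 2 * Λ.β - x (s - 1 / 2) := by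
        linear_combination e1
      rw [e4] at hsq ⊢
      linear_combination Λ.α ^ 2 * hsq
    rw [eval_mul, eval_mul, eval_zero, eval_sub]
    by_contra hne
    have hn1 : Λ.U₂.eval (x s) ≠ 0 := fun h0 => hne (by rw [h0]; ring)
    have hn2 : (Λ.U₁ ^ 2 - C (Λ.α ^ 2) * Λ.U₂).eval (x s) ≠ 0 := fun h0 => hne (by rw [h0]; ring)
    apply hne
    rw [h s, sub_self, zero_mul]
    · intro h0; rw [h0] at hsq; apply hn1; linear_combination -hsq / 4
    · intro h0; rw [sub_eq_zero.2 h0] at hprod; apply hn2; linear_combination hprod / 4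
    · intro h0; rw [sub_eq_zero.2 h0] at hprod; apply hn2; linear_combination hprod / 4
  have hb := mul_ne_zero hΛ.U₂_ne hΛ.disc_ne
  exact sub_eq_zero.1 ((mul_eq_zero.1 key).resolve_right hb)

/-- The excluded points map to the zeros of one nonzero polynomial, so the pointwise relation is an
identity of polynomials. -/
theorem firstStructureRelation_iff (hx : Λ.IsLattice x) (hΛ : Λ.Nondegenerate) (P : ℕ → ℝ[X]) :
    FirstStructureRelation x P ↔
      ∃ (π : ℂ[X]) (a : ℕ → ℕ → ℂ), π.natDegree ≤ 4 ∧ ∀ n : ℕ, 2 ≤ n → a n (n - 2) ≠ 0 ∧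
        π * Λ.D (Λ.D ((P n).map (algebraMap ℝ ℂ))) =
          ∑ m ∈ Finset.Icc (n - 2) (n + 2), C (a n m) * (P m).map (algebraMap ℝ ℂ) := by
  refine exists_congr fun π => exists_congr fun a => and_congr Iff.rfl (forall_congr' fun n =>
    forall_congr' fun hn => and_congr Iff.rfl ?_)
  have hev : ∀ m (y : ℂ), aeval y (P m) = ((P m).map (algebraMap ℝ ℂ)).eval y := fun m y => by
    rw [eval_map_algebraMap]
  simp only [hev]
  constructor
  · intro h
    refine hx.eq_of_eval_eq hΛ fun s h1 h2 h3 => ?_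
    rw [eval_mul, ← hx.dividedDiff_dividedDiff_eval _ h1 h2 h3, h s h1 h2 h3, eval_finsetSum]
    simp
  · intro h s h1 h2 h3
    rw [hx.dividedDiff_dividedDiff_eval _ h1 h2 h3, ← eval_mul, h, eval_finsetSum]
    simp

end IsLattice

/-- The top coefficient is removed by a monomial because `leadD` does not vanish. Surjectivity turns
statements about all `hyp φ ψ f` into statements about all `pearson φ ψ F`. -/
theorem Nondegenerate.exists_D_eq (hΛ : Λ.Nondegenerate) (f : ℂ[X]) : ∃ g, Λ.D g = f := by
  obtain ⟨n, hn⟩ : ∃ n, f.natDegree < n := ⟨_, Nat.lt_succ_self _⟩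
  induction n generalizing f with
  | zero => omega
  | succ n ih =>
    set c := f.coeff n / Λ.leadD (n + 1) with hc
    have hX : (C c * X ^ (n + 1)).natDegree ≤ n + 1 := natDegree_C_mul_X_pow_le _ _
    have h1 : (f - Λ.D (C c * X ^ (n + 1))).natDegree ≤ n :=
      (natDegree_sub_le _ _).trans
        (max_le (by omega) (by simpa using natDegree_D_le (Λ := Λ) hX))
    have h2 : (f - Λ.D (C c * X ^ (n + 1))).coeff n = 0 := by
      rw [coeff_sub, coeff_D hX, coeff_C_mul_X_pow, if_pos rfl, hc,
        mul_div_cancel₀ _ (hΛ.leadD_ne n), sub_self]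
    rcases Nat.eq_zero_or_pos n with rfl | hpos
    · refine ⟨C c * X ^ (0 + 1), ?_⟩
      have := eq_C_of_natDegree_le_zero h1
      rw [h2, C_0] at this
      exact (sub_eq_zero.1 this).symm
    · obtain ⟨g, hg⟩ := ih _ (lt_of_le_of_ne h1 fun h => by
        have h3 : f - Λ.D (C c * X ^ (n + 1)) = 0 := by
          rw [← leadingCoeff_eq_zero, leadingCoeff, h, h2]
        rw [h3] at h; simp at h; omega)
      exact ⟨g + C c * X ^ (n + 1), by rw [map_add, hg]; ring⟩

theorem Nondegenerate.natDegree_le_of_D (hΛ : Λ.Nondegenerate) {f : ℂ[X]} {n : ℕ}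
    (h : (Λ.D f).natDegree ≤ n) : f.natDegree ≤ n + 1 := by
  by_contra! hc
  obtain ⟨m, hm⟩ : ∃ m, f.natDegree = m + 1 := ⟨f.natDegree - 1, by omega⟩
  have h1 := coeff_D (Λ := Λ) hm.le
  rw [coeff_eq_zero_of_natDegree_lt (by omega), eq_comm, mul_eq_zero] at h1
  rcases h1 with h1 | h1
  · exact hΛ.leadD_ne m h1
  · rw [← hm] at h1
    rw [coeff_natDegree, leadingCoeff_eq_zero] at h1
    rw [h1] at hm; simp at hm

end LatticeParams
end

/-! ### Regular functionals, Pearson equations, and the structure relation for eigenfunctions. -/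

noncomputable section

/-- `P` is a sequence of polynomials, `deg (P n) = n`, orthogonal with respect to the regular
linear functional `L`. -/
structure IsOPS (L : ℂ[X] →ₗ[ℂ] ℂ) (P : ℕ → ℂ[X]) : Prop where
  natDegree_le (n : ℕ) : (P n).natDegree ≤ n
  coeff_ne (n : ℕ) : (P n).coeff n ≠ 0
  orth {m n : ℕ} (h : m ≠ n) : L (P m * P n) = 0
  norm_ne (n : ℕ) : L (P n * P n) ≠ 0

theorem map_C_mul (L : ℂ[X] →ₗ[ℂ] ℂ) (c : ℂ) (f : ℂ[X]) : L (C c * f) = c * L f := by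
  rw [← smul_eq_C_mul, map_smul, smul_eq_mul]

/-- Orthogonality with respect to a positive measure gives orthogonality with respect to a
regular functional on `ℂ[X]`. -/
theorem IsMonicOPS.exists_isOPS {P : ℕ → ℝ[X]} (hP : IsMonicOPS P) :
    ∃ L, IsOPS L fun n => (P n).map (algebraMap ℝ ℂ) := by
  obtain ⟨hdeg, μ, hint, horth, hnorm⟩ := hP
  let L : ℂ[X] →ₗ[ℂ] ℂ := Polynomial.lsum fun k => LinearMap.mulRight ℂ ((∫ t, t ^ k ∂μ : ℝ) : ℂ)
  have hL : ∀ g : ℝ[X], L (g.map (algebraMap ℝ ℂ)) = ((∫ t, g.eval t ∂μ : ℝ) : ℂ) := by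
    intro g
    have hi : ∀ g : ℝ[X], Integrable (fun t => g.eval t) μ := by
      intro g
      simp only [eval_eq_sum_range]
      exact integrable_finsetSum _ fun k _ => (hint k).const_mul _
    induction g using Polynomial.induction_on' with
    | add p q hp hq =>
      simp only [Polynomial.map_add, map_add, hp, hq, eval_add]
      rw [integral_add (hi p) (hi q), Complex.ofReal_add]
    | monomial n a =>
      simp only [Polynomial.map_monomial, eval_monomial]
      rw [integral_const_mul]
      simp [L, Polynomial.lsum_apply, Polynomial.sum_monomial_index]
  refine ⟨L, ⟨fun n => ?_, fun n => ?_, fun {m n} h => ?_, fun n => ?_⟩⟩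
  · rw [natDegree_map, (hdeg n).2]
  · rw [coeff_map, ← (hdeg n).2]
    have : (P n).coeff (P n).natDegree = 1 := (hdeg n).1
    rw [(hdeg n).2] at this ⊢
    simp [this]
  · rw [← Polynomial.map_mul, hL]
    simp only [eval_mul, horth m n h, Complex.ofReal_zero]
  · rw [← Polynomial.map_mul, hL]
    simp only [eval_mul]
    exact_mod_cast (hnorm n).ne'

namespace IsOPS

variable {L : ℂ[X] →ₗ[ℂ] ℂ} {P : ℕ → ℂ[X]}

theorem exists_sum (hP : IsOPS L P) {n : ℕ} {f : ℂ[X]} (hf : f.natDegree ≤ n) :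
    ∃ c : ℕ → ℂ, f = ∑ k ∈ Finset.range (n + 1), C (c k) * P k := by
  induction n generalizing f with
  | zero =>
    refine ⟨fun _ => f.coeff 0 / (P 0).coeff 0, ?_⟩
    rw [Finset.sum_range_one, eq_C_of_natDegree_le_zero (hP.natDegree_le 0), coeff_C_zero, ← C_mul,
      div_mul_cancel₀ _ (hP.coeff_ne 0)]
    exact eq_C_of_natDegree_le_zero hf
  | succ n ih =>
    set a := f.coeff (n + 1) / (P (n + 1)).coeff (n + 1) with ha
    have h1 : (f - C a * P (n + 1)).natDegree ≤ n := by
      have h2 : (f - C a * P (n + 1)).natDegree ≤ n + 1 :=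
        (natDegree_sub_le _ _).trans
          (max_le hf ((natDegree_C_mul_le _ _).trans (hP.natDegree_le _)))
      refine natDegree_le_pred h2 ?_
      rw [coeff_sub, coeff_C_mul, ha, div_mul_cancel₀ _ (hP.coeff_ne _), sub_self]
    obtain ⟨c, hc⟩ := ih h1
    refine ⟨fun k => if k = n + 1 then a else c k, ?_⟩
    rw [Finset.sum_range_succ]
    simp only [if_true]
    rw [sub_eq_iff_eq_add] at hc
    conv_lhs => rw [hc]
    congr 1
    refine Finset.sum_congr rfl fun k hk => ?_
    rw [if_neg (Finset.mem_range.1 hk).ne]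

theorem map_sum_mul (hP : IsOPS L P) (c : ℕ → ℂ) (s : Finset ℕ) (k : ℕ) :
    L ((∑ m ∈ s, C (c m) * P m) * P k) = if k ∈ s then c k * L (P k * P k) else 0 := by
  rw [Finset.sum_mul, map_sum]
  simp only [mul_assoc, map_C_mul]
  split_ifs with h
  · rw [Finset.sum_eq_single k (fun m _ hm => by rw [hP.orth hm, mul_zero]) fun h' => (h' h).elim]
  · exact Finset.sum_eq_zero fun m hm => by
      rw [hP.orth (by rintro rfl; exact h hm), mul_zero]

theorem map_mul_eq (hP : IsOPS L P) {n : ℕ} {f : ℂ[X]} (hf : f.natDegree ≤ n) :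
    L (f * P n) = f.coeff n / (P n).coeff n * L (P n * P n) := by
  obtain ⟨c, hc⟩ := hP.exists_sum hf
  have h1 : f.coeff n = c n * (P n).coeff n := by
    conv_lhs => rw [hc]
    rw [finsetSum_coeff, Finset.sum_range_succ, Finset.sum_eq_zero, zero_add, coeff_C_mul]
    intro k hk
    rw [coeff_C_mul, coeff_eq_zero_of_natDegree_lt, mul_zero]
    exact (hP.natDegree_le k).trans_lt (Finset.mem_range.1 hk)
  rw [h1, mul_div_cancel_right₀ _ (hP.coeff_ne n)]
  conv_lhs => rw [hc]
  rw [hP.map_sum_mul, if_pos (by simp)]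

theorem map_mul_eq_zero (hP : IsOPS L P) {n : ℕ} {f : ℂ[X]} (hf : f.natDegree < n) :
    L (f * P n) = 0 := by
  rw [hP.map_mul_eq hf.le, coeff_eq_zero_of_natDegree_lt hf, zero_div, zero_mul]

theorem eq_zero_of_forall (hP : IsOPS L P) {n : ℕ} {f : ℂ[X]} (hf : f.natDegree ≤ n)
    (h : ∀ k ≤ n, L (f * P k) = 0) : f = 0 := by
  obtain ⟨c, hc⟩ := hP.exists_sum hf
  rw [hc]
  refine Finset.sum_eq_zero fun k hk => ?_
  have h1 := h k (Nat.lt_succ_iff.1 (Finset.mem_range.1 hk))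
  rw [hc, hP.map_sum_mul, if_pos hk] at h1
  rw [(mul_eq_zero.1 h1).resolve_right (hP.norm_ne k), C_0, zero_mul]

/-- The three-term recurrence relation. -/
theorem exists_recurrence (hP : IsOPS L P) (n : ℕ) : ∃ a b c : ℂ, c ≠ 0 ∧
    X * P (n + 1) = C a * P (n + 2) + C b * P (n + 1) + C c * P n := by
  have hd : (X * P (n + 1)).natDegree ≤ n + 2 :=
    natDegree_mul_le.trans (by rw [natDegree_X]; linarith [hP.natDegree_le (n + 1)])
  obtain ⟨c, hc⟩ := hP.exists_sum hd
  have hX : ∀ k, (X * P k).natDegree ≤ k + 1 := fun k =>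
    natDegree_mul_le.trans (by rw [natDegree_X]; linarith [hP.natDegree_le k])
  have h1 : ∀ k ≤ n, c k * L (P k * P k) = L (X * P k * P (n + 1)) := by
    intro k hk
    have := hP.map_sum_mul c (Finset.range (n + 2 + 1)) k
    rw [← hc, if_pos (by simp; omega)] at this
    rw [← this]; congr 1; ring
  have h2 : ∀ k < n, c k = 0 := by
    intro k hk
    have := h1 k hk.le
    rw [hP.map_mul_eq_zero ((hX k).trans_lt (by omega))] at this
    exact (mul_eq_zero.1 this).resolve_right (hP.norm_ne k)
  refine ⟨c (n + 2), c (n + 1), c n, ?_, ?_⟩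
  · intro h0
    have := h1 n le_rfl
    rw [h0, zero_mul, hP.map_mul_eq (hX n), coeff_X_mul, eq_comm] at this
    exact mul_ne_zero (div_ne_zero (hP.coeff_ne n) (hP.coeff_ne (n + 1))) (hP.norm_ne _) this
  · rw [hc, Finset.sum_range_succ, Finset.sum_range_succ, Finset.sum_range_succ,
      Finset.sum_eq_zero]
    · ring
    · intro k hk
      rw [h2 k (Finset.mem_range.1 hk), C_0, zero_mul]

end IsOPS

namespace LatticeParams

variable {Λ : LatticeParams} {L : ℂ[X] →ₗ[ℂ] ℂ} {P : ℕ → ℂ[X]}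

/-- Orthogonal polynomials for a functional satisfying a Pearson equation are eigenfunctions. -/
theorem hyp_eq_of_pearson (hP : IsOPS L P) {φ ψ : ℂ[X]} (hφ : φ.natDegree ≤ 2)
    (hψ : ψ.natDegree ≤ 1) (h : ∀ F, L (Λ.pearson φ ψ F) = 0) (n : ℕ) :
    Λ.hyp φ ψ (P n) = C (Λ.eig (φ.coeff 2) (ψ.coeff 1) n) * P n := by
  rw [← sub_eq_zero]
  have hd : (Λ.hyp φ ψ (P n) - C (Λ.eig (φ.coeff 2) (ψ.coeff 1) n) * P n).natDegree ≤ n :=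
    (natDegree_sub_le _ _).trans (max_le (natDegree_hyp_le hφ hψ (hP.natDegree_le n))
      ((natDegree_C_mul_le _ _).trans (hP.natDegree_le n)))
  -- At k = n the leading terms cancel. For k < n symmetry moves the operator onto P_k, whose image
  -- still has degree below n.
  refine hP.eq_zero_of_forall hd fun k hk => ?_
  rcases hk.eq_or_lt with rfl | hk
  · rw [hP.map_mul_eq hd, coeff_sub, coeff_hyp hφ hψ (hP.natDegree_le k), coeff_C_mul, sub_self,
      zero_div, zero_mul]
  · have hs := congrArg L (Λ.hyp_mul_sub_mul_hyp φ ψ (P n) (P k))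
    rw [h, map_sub, sub_eq_zero] at hs
    rw [sub_mul, map_sub, hs, mul_assoc, map_C_mul, hP.orth hk.ne', mul_zero, sub_zero, mul_comm]
    exact hP.map_mul_eq_zero
      ((natDegree_hyp_le hφ hψ (hP.natDegree_le k)).trans_lt hk)

/-- The D P_n span ℂ[X], as D is surjective. The functional M need not be the one for which P is
orthogonal. -/
theorem map_pearson_eq_zero (hΛ : Λ.Nondegenerate) (hP : IsOPS L P) (M : ℂ[X] →ₗ[ℂ] ℂ)
    {φ ψ : ℂ[X]} (h : ∀ n, M (Λ.hyp φ ψ (P n)) = 0) (F : ℂ[X]) : M (Λ.pearson φ ψ F) = 0 := by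
  obtain ⟨g, rfl⟩ := hΛ.exists_D_eq F
  obtain ⟨c, hc⟩ := hP.exists_sum (le_refl g.natDegree)
  rw [← hyp_eq_pearson, hc, map_sum, map_sum]
  refine Finset.sum_eq_zero fun k _ => ?_
  rw [← smul_eq_C_mul, map_smul, map_smul, h, smul_zero]

theorem hyp_zero_index (hP : IsOPS L P) (φ ψ : ℂ[X]) : Λ.hyp φ ψ (P 0) = 0 := by
  rw [eq_C_of_natDegree_le_zero (hP.natDegree_le 0)]; simp [hyp_apply]

theorem pearson_of_hyp_eq (hΛ : Λ.Nondegenerate) (hP : IsOPS L P) {φ ψ : ℂ[X]} {l : ℕ → ℂ}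
    (h : ∀ n, Λ.hyp φ ψ (P n) = C (l n) * P n) (F : ℂ[X]) :
    L (Λ.pearson φ ψ F) = 0 := by
  refine map_pearson_eq_zero hΛ hP L (fun k => ?_) F
  rcases Nat.eq_zero_or_pos k with rfl | hk
  · rw [hyp_zero_index hP, map_zero]
  · have := hP.map_mul_eq_zero (f := 1) (n := k) (by simpa using hk)
    rw [one_mul] at this
    rw [h, map_C_mul, this, mul_zero]

theorem eig_eq_of_hyp_eq (hP : IsOPS L P) {φ ψ : ℂ[X]} (hφ : φ.natDegree ≤ 2)
    (hψ : ψ.natDegree ≤ 1) {l : ℕ → ℂ}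
    (h : ∀ n, Λ.hyp φ ψ (P n) = C (l n) * P n) (n : ℕ) :
    l n = Λ.eig (φ.coeff 2) (ψ.coeff 1) n := by
  have := coeff_hyp (Λ := Λ) hφ hψ (hP.natDegree_le n)
  rw [h, coeff_C_mul] at this
  exact mul_right_cancel₀ (hP.coeff_ne n) this

/-- If the value at N vanishes then T P_{N+1} = 0. With Q = D P_{N+1}, summation by parts and
induction on j show that L annihilates every X^j · `pearson φ ψ (Q f)`, so regularity makes this
polynomial zero for all f. Then the value at N + 1 vanishes as well; two consecutive zeros kill both
leading coefficients, all eigenvalues, and finally φ and ψ. -/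
theorem adm_ne_zero (hΛ : Λ.Nondegenerate) (hP : IsOPS L P) {φ ψ : ℂ[X]} (hφ : φ.natDegree ≤ 2)
    (hψ : ψ.natDegree ≤ 1) (hne : φ ≠ 0 ∨ ψ ≠ 0) {l : ℕ → ℂ}
    (h : ∀ n, Λ.hyp φ ψ (P n) = C (l n) * P n) (N : ℕ) :
    Λ.adm (φ.coeff 2) (ψ.coeff 1) N ≠ 0 := by
  intro h0
  have hl := eig_eq_of_hyp_eq hP hφ hψ h
  have hp := pearson_of_hyp_eq hΛ hP h
  set Q := Λ.D (P (N + 1)) with hQ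
  have hT : Λ.hyp φ ψ (P (N + 1)) = 0 := by
    rw [h, hl, eig_succ, h0, mul_zero, C_0, zero_mul]
  have hX : ∀ F, φ * Λ.S F + Λ.U₂ * ψ * Λ.D F =
      Λ.pearson φ ψ (X * F) - Λ.ell * Λ.pearson φ ψ F := fun F => by rw [pearson_X_mul]; ring
  have key : ∀ j : ℕ, ∀ f, L (X ^ j * Λ.pearson φ ψ (Q * f)) = 0 ∧
      L (X ^ (j + 1) * Λ.pearson φ ψ (Q * f)) = 0 ∧
      L (X ^ j * (φ * Λ.S (Q * f) + Λ.U₂ * ψ * Λ.D (Q * f))) = 0 := by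
    intro j
    induction j with
    | zero =>
      intro f
      have e1 : L (X * Λ.pearson φ ψ (Q * f)) = 0 := by
        obtain ⟨g, rfl⟩ := hΛ.exists_D_eq f
        have := congrArg L (Λ.hyp_mul φ ψ (P (N + 1)) g)
        rw [hT, zero_mul, map_add, hp, add_zero, map_zero] at this
        exact this.symm
      refine ⟨by simp [hp], by simpa using e1, ?_⟩
      have e2 := hp (Q * f)
      rw [hX, pow_zero, one_mul, map_sub, hp, ell, add_mul, map_add, mul_assoc, map_C_mul, e1,
        map_C_mul, e2]
      simp
    | succ j ih =>
      intro f
      have i1 := ih f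
      have i2 := ih (X * f)
      rw [show Q * (X * f) = X * (Q * f) by ring] at i2
      obtain ⟨a1, a2, a3⟩ := i1
      obtain ⟨-, b2, b3⟩ := i2
      rw [pearson_X_mul] at b2
      have e3 : φ * Λ.S (X * (Q * f)) + Λ.U₂ * ψ * Λ.D (X * (Q * f)) =
          Λ.ell * (φ * Λ.S (Q * f) + Λ.U₂ * ψ * Λ.D (Q * f))
            + Λ.U₂ * Λ.pearson φ ψ (Q * f) := by
        rw [S_X_mul, D_X_mul, pearson_apply]; ring
      rw [e3] at b3
      generalize φ * Λ.S (Q * f) + Λ.U₂ * ψ * Λ.D (Q * f) = K at *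
      generalize Λ.pearson φ ψ (Q * f) = N at *
      -- Together with `c3`, a homogeneous linear system for two unknown moments, of determinant α²
      -- - (α² - 1) = 1. From here on N denotes a polynomial, the Pearson expression.
      have c2 : Λ.α * L (X ^ (j + 1 + 1) * N) + L (X ^ (j + 1) * K) = 0 := by
        rw [show X ^ (j + 1) * (Λ.ell * N + K) = C Λ.α * (X ^ (j + 1 + 1) * N)
          + C Λ.β * (X ^ (j + 1) * N) + X ^ (j + 1) * K by rw [ell]; ring] at b2
        rw [map_add, map_add, map_C_mul, map_C_mul, a2] at b2
        linear_combination b2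
      have c3 : Λ.α * L (X ^ (j + 1) * K) + (Λ.α ^ 2 - 1) * L (X ^ (j + 1 + 1) * N) = 0 := by
        rw [show X ^ j * (Λ.ell * K + Λ.U₂ * N) = C Λ.α * (X ^ (j + 1) * K)
          + C Λ.β * (X ^ j * K) + C (Λ.α ^ 2 - 1) * (X ^ (j + 1 + 1) * N)
          + C (2 * Λ.β * (Λ.α + 1)) * (X ^ (j + 1) * N) + C Λ.δ * (X ^ j * N) by
            rw [ell, U₂]; ring] at b3
        simp only [map_add L, map_C_mul, a1, a2, a3] at b3
        linear_combination b3
      have d1 : L (X ^ (j + 1 + 1) * N) = 0 := by linear_combination Λ.α * c2 - c3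
      refine ⟨a2, d1, ?_⟩
      rw [d1] at c2
      linear_combination c2
  have hN : ∀ f, Λ.pearson φ ψ (Q * f) = 0 := by
    intro f
    have hall : ∀ g, L (g * Λ.pearson φ ψ (Q * f)) = 0 := by
      intro g
      rw [g.as_sum_range_C_mul_X_pow, Finset.sum_mul, map_sum]
      refine Finset.sum_eq_zero fun j _ => ?_
      rw [mul_assoc, map_C_mul, (key j f).1, mul_zero]
    exact hP.eq_zero_of_forall le_rfl fun k _ => by rw [mul_comm]; exact hall _
  have hQd : Q.natDegree ≤ N := natDegree_D_le (n := N + 1) (hP.natDegree_le _)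
  have hQc : Q.coeff N ≠ 0 := by
    rw [hQ, coeff_D (hP.natDegree_le _)]
    exact mul_ne_zero (hΛ.leadD_ne N) (hP.coeff_ne _)
  have h1 : Λ.adm (φ.coeff 2) (ψ.coeff 1) (N + 1) = 0 := by
    have hd : (Q * X).natDegree ≤ N + 1 :=
      natDegree_mul_le.trans (by rw [natDegree_X]; omega)
    have := coeff_pearson (Λ := Λ) hφ hψ hd
    rw [hN, coeff_zero, coeff_mul_X, eq_comm] at this
    exact (mul_eq_zero.1 this).resolve_right hQc
  have hsq := Λ.lead_sq N
  rw [adm] at h0 h1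
  rw [leadS_succ, leadD_succ] at h1
  -- The conditions at N and N + 1 form a 2 × 2 system in the two leading coefficients whose
  -- determinant is ±1 by `lead_sq`.
  have ha : φ.coeff 2 = 0 := by
    linear_combination -φ.coeff 2 * hsq -
      (Λ.α * Λ.leadS N + (Λ.α ^ 2 - 1) * Λ.leadD N) * h0 + Λ.leadS N * h1
  have hb : ψ.coeff 1 = 0 := by
    linear_combination -ψ.coeff 1 * hsq +
      (Λ.leadS N + Λ.α * Λ.leadD N) * h0 - Λ.leadD N * h1
  have heig : ∀ n, l n = 0 := by
    intro n; rw [hl, ha, hb, eig_eq]; ring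
  have hψ0 : ψ = 0 := by
    have h1 := h 1
    rw [heig, C_0, zero_mul, hyp_apply, eq_C_of_natDegree_le_zero (natDegree_D_le (n := 1)
      (hP.natDegree_le 1)), D_C, S_C, mul_zero, zero_add] at h1
    refine (mul_eq_zero.1 h1).resolve_right ?_
    rw [C_eq_zero, coeff_D (n := 0) (hP.natDegree_le 1)]
    exact mul_ne_zero (hΛ.leadD_ne 0) (hP.coeff_ne _)
  have hφ0 : φ = 0 := by
    have h1 := h 2
    have d2 : (Λ.D (P 2)).natDegree ≤ 1 := natDegree_D_le (n := 2) (hP.natDegree_le 2)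
    rw [heig, C_0, zero_mul, hyp_apply, hψ0, zero_mul, add_zero] at h1
    refine (mul_eq_zero.1 h1).resolve_right fun h2 => ?_
    have := congrArg (fun p => coeff p 0) h2
    simp only [coeff_zero] at this
    rw [coeff_D (n := 0) d2, coeff_D (n := 1) (hP.natDegree_le 2)] at this
    exact mul_ne_zero (hΛ.leadD_ne 0) (mul_ne_zero (hΛ.leadD_ne 1) (hP.coeff_ne _)) this
  rcases hne with h | h
  · exact h hφ0
  · exact h hψ0

/-- Two summations by parts. Subtracting `ψ.coeff 1` times f removes the zeroth order term of
`D_hyp`, so that D of the inner function is a pure lifted operator applied to D f, which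
`exists_X_mul_pearson` can handle. -/
theorem map_hyp_mul_eq (φ ψ : ℂ[X]) (hψ : ψ.natDegree ≤ 1)
    (hp : ∀ F, L (Λ.pearson φ ψ F) = 0) (f g : ℂ[X]) :
    L (Λ.hyp φ ψ (Λ.hyp φ ψ f - C (ψ.coeff 1) * f) * g) =
      L ((φ ^ 2 - Λ.U₂ * ψ ^ 2) * (Λ.D (Λ.D f) * Λ.D (Λ.D g))) := by
  have hD : Λ.D ψ = C (ψ.coeff 1) := by
    have := coeff_D (Λ := Λ) (n := 0) hψ
    rw [eq_C_of_natDegree_le_zero (natDegree_D_le (n := 1) hψ), this]; simp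
  rw [hyp_mul, map_add, hp, add_zero, map_sub, D_C_mul, D_hyp, hD, add_sub_cancel_right, hyp_mul]
  obtain ⟨H, -, h2⟩ := Λ.exists_X_mul_pearson φ ψ (Λ.D (Λ.D f) * Λ.D (Λ.D g))
  obtain ⟨H', h1, -⟩ := Λ.exists_X_mul_pearson φ ψ
    (Λ.D (Λ.D f) * Λ.S (Λ.D g) - C Λ.α * (X * (Λ.D (Λ.D f) * Λ.D (Λ.D g)))
      - C Λ.β * (Λ.D (Λ.D f) * Λ.D (Λ.D g)))
  rw [map_add, mul_add, map_add, h2, h1, map_add, hp, hp, add_zero, add_zero]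

/-- Eigenfunctions of the second order operator satisfy the first structure relation. -/
theorem exists_structure_of_hyp_eq (hΛ : Λ.Nondegenerate) (hP : IsOPS L P) {φ ψ : ℂ[X]}
    (hφ : φ.natDegree ≤ 2) (hψ : ψ.natDegree ≤ 1) (hne : φ ≠ 0 ∨ ψ ≠ 0) {l : ℕ → ℂ}
    (h : ∀ n, Λ.hyp φ ψ (P n) = C (l n) * P n) :
    ∃ (π : ℂ[X]) (a : ℕ → ℕ → ℂ), π.natDegree ≤ 4 ∧ ∀ n : ℕ, 2 ≤ n → a n (n - 2) ≠ 0 ∧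
        π * Λ.D (Λ.D (P n)) = ∑ m ∈ Finset.Icc (n - 2) (n + 2), C (a n m) * P m := by
  have hadm := adm_ne_zero hΛ hP hφ hψ hne h
  have hl := eig_eq_of_hyp_eq hP hφ hψ h
  have hp := pearson_of_hyp_eq hΛ hP h
  set π := φ ^ 2 - Λ.U₂ * ψ ^ 2 with hπ
  have hπd : π.natDegree ≤ 4 := by
    refine (natDegree_sub_le _ _).trans (max_le ?_ ?_)
    · exact (natDegree_pow_le).trans (by omega)
    · refine (natDegree_mul_le_of_le natDegree_U₂_le natDegree_pow_le).trans (by omega)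
  have hd : ∀ n, 2 ≤ n → (π * Λ.D (Λ.D (P n))).natDegree ≤ n + 2 := by
    intro n hn
    refine (natDegree_mul_le_of_le hπd
      (natDegree_D_le (natDegree_D_le (hP.natDegree_le n)))).trans (by omega)
  have hc : ∀ n, ∃ c : ℕ → ℂ, 2 ≤ n →
      π * Λ.D (Λ.D (P n)) = ∑ k ∈ Finset.range (n + 2 + 1), C (c k) * P k := by
    intro n
    by_cases hn : 2 ≤ n
    · obtain ⟨c, hc⟩ := hP.exists_sum (hd n hn)
      exact ⟨c, fun _ => hc⟩
    · exact ⟨0, fun h => (hn h).elim⟩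
  choose a ha using hc
  refine ⟨π, a, hπd, fun n hn => ?_⟩
  have hG : ∀ m, ∃ G : ℂ[X], Λ.D (Λ.D G) = P m ∧ G.natDegree ≤ m + 2 ∧ G.coeff (m + 2) ≠ 0 := by
    intro m
    obtain ⟨g, hg⟩ := hΛ.exists_D_eq (P m)
    obtain ⟨G, hG⟩ := hΛ.exists_D_eq g
    have d1 : g.natDegree ≤ m + 1 := hΛ.natDegree_le_of_D (by rw [hg]; exact hP.natDegree_le m)
    have d2 : G.natDegree ≤ m + 2 := hΛ.natDegree_le_of_D (by rw [hG]; exact d1)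
    refine ⟨G, by rw [hG, hg], d2, fun h0 => hP.coeff_ne m ?_⟩
    rw [← hg, coeff_D d1, ← hG, coeff_D d2, h0]; simp
  -- Both sides compute L(π D²P_n · D²G). Since G can be taken of degree m + 2, the right side
  -- vanishes for m + 2 < n.
  have hcoef : ∀ m ≤ n, ∀ G, Λ.D (Λ.D G) = P m →
      a n m * L (P m * P m) = l n * (l n - ψ.coeff 1) * L (G * P n) := by
    intro m hm G hG
    have h1 := hP.map_sum_mul (a n) (Finset.range (n + 2 + 1)) m
    rw [if_pos (by simp; omega), ← ha n hn, mul_assoc, ← hG,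
      ← map_hyp_mul_eq φ ψ hψ hp, h, hG] at h1
    rw [← h1, show C (l n) * P n - C (ψ.coeff 1) * P n = C (l n - ψ.coeff 1) * P n by
      rw [C_sub]; ring]
    rw [← smul_eq_C_mul, map_smul, h, smul_mul_assoc, map_smul, mul_assoc, map_C_mul,
      smul_eq_mul, mul_comm (P n)]
    ring
  constructor
  · obtain ⟨G, hG, hG1, hG2⟩ := hG (n - 2)
    rw [Nat.sub_add_cancel hn] at hG1 hG2
    intro h0
    have := hcoef (n - 2) (by omega) G hG
    rw [h0, zero_mul, hP.map_mul_eq hG1, eq_comm] at this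
    refine mul_ne_zero (mul_ne_zero ?_ ?_)
      (mul_ne_zero (div_ne_zero hG2 (hP.coeff_ne n)) (hP.norm_ne n)) this
    · obtain ⟨k, rfl⟩ : ∃ k, n = k + 1 := ⟨n - 1, by omega⟩
      rw [hl, eig_succ]
      exact mul_ne_zero (hΛ.leadD_ne _) (hadm _)
    -- The number `ψ.coeff 1` is the eigenvalue at index 1, so this factor is a difference of two
    -- distinct eigenvalues.
    · obtain ⟨k, rfl⟩ : ∃ k, n = 1 + k + 1 := ⟨n - 2, by omega⟩
      have := Λ.eig_sub_eig (φ.coeff 2) (ψ.coeff 1) 1 k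
      have e1 : Λ.eig (φ.coeff 2) (ψ.coeff 1) 1 = ψ.coeff 1 := by
        rw [show 1 = 0 + 1 from rfl, eig_succ, adm]; simp
      rw [e1] at this
      rw [hl, this]
      exact mul_ne_zero (hΛ.leadD_ne _) (hadm _)
  · rw [ha n hn]
    symm
    refine Finset.sum_subset (fun k hk => ?_) fun k hk hk' => ?_
    · simp only [Finset.mem_Icc] at hk; simp; omega
    · simp only [Finset.mem_Icc, Finset.mem_range] at hk hk'
      obtain ⟨G, hG, hG1, -⟩ := hG k
      have := hcoef k (by omega) G hG
      rw [hP.map_mul_eq_zero (f := G) (n := n) (by omega), mul_zero] at this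
      rw [(mul_eq_zero.1 this).resolve_right (hP.norm_ne k), C_0, zero_mul]

end LatticeParams
end

/-! ### From the structure relation to a second order operator for the second differences. -/

noncomputable section

namespace LatticeParams

variable {Λ : LatticeParams} {L : ℂ[X] →ₗ[ℂ] ℂ} {P : ℕ → ℂ[X]}

/-- If `M` annihilates enough of the `S D P_n` and `D² P_n`, it satisfies a Pearson equation. -/
theorem exists_pearson (hΛ : Λ.Nondegenerate) (hP : IsOPS L P) (M : ℂ[X] →ₗ[ℂ] ℂ)
    (hM : ∀ n g, g.natDegree < n → M (g * Λ.D (Λ.D (P (n + 2)))) = 0) :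
    ∃ φ ψ : ℂ[X], φ.natDegree ≤ 2 ∧ ψ.natDegree ≤ 1 ∧ (φ ≠ 0 ∨ ψ ≠ 0) ∧
      ∀ F, M (Λ.pearson φ ψ F) = 0 := by
  let φ : (Fin 5 → ℂ) → ℂ[X] := fun v => C (v 0) * X ^ 2 + C (v 1) * X + C (v 2)
  let ψ : (Fin 5 → ℂ) → ℂ[X] := fun v => C (v 3) * X + C (v 4)
  -- Five unknown coefficients against the conditions for P_1, …, P_4; all other conditions hold
  -- automatically.
  let E : (Fin 5 → ℂ) →ₗ[ℂ] (Fin 4 → ℂ) :=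
    { toFun := fun v n => M (Λ.hyp (φ v) (ψ v) (P (n + 1)))
      map_add' := fun v w => by
        funext n
        rw [Pi.add_apply, ← map_add]
        congr 1
        simp only [φ, ψ, hyp_apply, Pi.add_apply, C_add]
        ring
      map_smul' := fun c v => by
        funext n
        rw [RingHom.id_apply, Pi.smul_apply, smul_eq_mul, ← map_C_mul]
        congr 1
        simp only [φ, ψ, hyp_apply, Pi.smul_apply, smul_eq_mul, C_mul]
        ring }
  obtain ⟨v, hv, hv0⟩ := (Submodule.ne_bot_iff _).1
    (LinearMap.ker_ne_bot_of_finrank_lt (f := E) (by simp))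
  have hφ : (φ v).natDegree ≤ 2 := by simp only [φ]; compute_degree
  have hψ : (ψ v).natDegree ≤ 1 := by simp only [ψ]; compute_degree
  refine ⟨φ v, ψ v, hφ, hψ, ?_, map_pearson_eq_zero hΛ hP M fun n => ?_⟩
  · by_contra! hc
    apply hv0
    have h1 : ∀ k, (φ v).coeff k = 0 := fun k => by rw [hc.1, coeff_zero]
    have h2 : ∀ k, (ψ v).coeff k = 0 := fun k => by rw [hc.2, coeff_zero]
    have a0 := h1 2
    have a1 := h1 1
    have a2 := h1 0
    have b0 := h2 1
    have b1 := h2 0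
    simp [φ, ψ, coeff_X, coeff_C] at a0 a1 a2 b0 b1
    funext i
    fin_cases i <;> simp [a0, a1, a2, b0, b1]
  · rcases Nat.eq_zero_or_pos n with rfl | hpos
    · rw [hyp_zero_index hP, map_zero]
    by_cases hn : n < 5
    · have := congrFun hv ⟨n - 1, by omega⟩
      simpa [E, Nat.sub_add_cancel hpos] using this
    -- From index 5 on orthogonality suffices. Index 4 has to be imposed: M annihilates D²P_4 only
    -- against degrees below 2, and φ may have degree 2.
    · obtain ⟨k, rfl⟩ : ∃ k, n = k + 4 + 1 := ⟨n - 5, by omega⟩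
      have h1 : M (φ v * Λ.D (Λ.D (P (k + 4 + 1)))) = 0 := hM (k + 3) _ (by omega)
      have h2 : M (ψ v * Λ.S (Λ.D (P (k + 4 + 1)))) = 0 := by
        obtain ⟨a, b, c, -, hr⟩ := hP.exists_recurrence (k + 4)
        have h3 := Λ.D_D_X_mul (P (k + 4 + 1))
        rw [hr] at h3
        simp only [map_add, D_C_mul] at h3
        -- The recurrence inside `D_D_X_mul` replaces S D by second differences of three consecutive
        -- polynomials.
        have h4 : C (2 * Λ.α) * (ψ v * Λ.S (Λ.D (P (k + 4 + 1)))) =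
            C a * (ψ v * Λ.D (Λ.D (P (k + 4 + 2)))) +
            C b * (ψ v * Λ.D (Λ.D (P (k + 4 + 1)))) + C c * (ψ v * Λ.D (Λ.D (P (k + 4))))
            - (ψ v * Λ.midpoint) * Λ.D (Λ.D (P (k + 4 + 1))) := by
          linear_combination -ψ v * h3
        have h5 := congrArg M h4
        rw [map_sub, map_add, map_add, map_C_mul, map_C_mul, map_C_mul, map_C_mul,
          hM (k + 4) _ (by omega), hM (k + 3) _ (by omega), hM (k + 2) _ (by omega),
          hM (k + 3) _ ((natDegree_mul_le_of_le hψ natDegree_midpoint_le).trans_lt (by omega))] at h5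
        refine (mul_eq_zero.1 (h5.trans (by ring))).resolve_left ?_
        exact mul_ne_zero two_ne_zero hΛ.α_ne
      rw [hyp_apply, map_add, h1, h2, add_zero]

/-- The second differences of an orthogonal sequence satisfying the first structure relation are
eigenfunctions of a second order operator. -/
theorem exists_hyp_D_D_eq (hΛ : Λ.Nondegenerate) (hP : IsOPS L P) {π : ℂ[X]} {a : ℕ → ℕ → ℂ}
    (h : ∀ n : ℕ, 2 ≤ n → a n (n - 2) ≠ 0 ∧
        π * Λ.D (Λ.D (P n)) = ∑ m ∈ Finset.Icc (n - 2) (n + 2), C (a n m) * P m) :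
    ∃ φ ψ : ℂ[X], φ.natDegree ≤ 2 ∧ ψ.natDegree ≤ 1 ∧ (φ ≠ 0 ∨ ψ ≠ 0) ∧
      ∀ n, ∃ l : ℂ, Λ.hyp φ ψ (Λ.D (Λ.D (P n))) = C l * Λ.D (Λ.D (P n)) := by
  -- The lower end n - 2 of the sum gives orthogonality of the second differences under πL; `a n (n
  -- - 2) ≠ 0` gives its regularity.
  let M : ℂ[X] →ₗ[ℂ] ℂ := L ∘ₗ LinearMap.mulLeft ℂ π
  have hM' : ∀ f, M f = L (π * f) := fun f => rfl
  have hM1 : ∀ n g, g.natDegree ≤ n → M (g * Λ.D (Λ.D (P (n + 2)))) =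
      a (n + 2) n * (g.coeff n / (P n).coeff n * L (P n * P n)) := by
    intro n g hg
    have h1 := (h (n + 2) (by omega)).2
    rw [Nat.add_sub_cancel] at h1
    rw [hM', show π * (g * Λ.D (Λ.D (P (n + 2)))) = g * (π * Λ.D (Λ.D (P (n + 2)))) by ring, h1,
      Finset.mul_sum, map_sum]
    rw [Finset.sum_eq_single n]
    · rw [mul_left_comm, map_C_mul, hP.map_mul_eq hg]
    · intro b hb hne
      rw [mul_left_comm, map_C_mul, hP.map_mul_eq_zero, mul_zero]
      have := (Finset.mem_Icc.1 hb).1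
      omega
    · intro h'; exact (h' (by simp; omega)).elim
  have hM : ∀ n g, g.natDegree < n → M (g * Λ.D (Λ.D (P (n + 2)))) = 0 := fun n g hg => by
    rw [hM1 n g hg.le, coeff_eq_zero_of_natDegree_lt hg]; simp
  obtain ⟨φ, ψ, hφ, hψ, hne, hp⟩ := exists_pearson hΛ hP M hM
  have hRd : ∀ n, (Λ.D (Λ.D (P (n + 2)))).natDegree ≤ n := fun n =>
    natDegree_D_le (n := n + 1) (natDegree_D_le (n := n + 2) (hP.natDegree_le _))
  have hRc : ∀ n, (Λ.D (Λ.D (P (n + 2)))).coeff n ≠ 0 := fun n => by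
    rw [coeff_D (natDegree_D_le (n := n + 2) (hP.natDegree_le _)), coeff_D (hP.natDegree_le _)]
    exact mul_ne_zero (hΛ.leadD_ne _) (mul_ne_zero (hΛ.leadD_ne _) (hP.coeff_ne _))
  have hR : IsOPS M fun n => Λ.D (Λ.D (P (n + 2))) := by
    refine ⟨hRd, hRc, fun {m n} hmn => ?_, fun n => ?_⟩
    · rcases lt_or_gt_of_ne hmn with hlt | hlt
      · exact hM n _ ((hRd m).trans_lt hlt)
      · rw [mul_comm]; exact hM m _ ((hRd n).trans_lt hlt)
    · rw [hM1 n _ (hRd n)]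
      have := (h (n + 2) (by omega)).1
      rw [Nat.add_sub_cancel] at this
      exact mul_ne_zero this (mul_ne_zero (div_ne_zero (hRc n) (hP.coeff_ne n)) (hP.norm_ne n))
  refine ⟨φ, ψ, hφ, hψ, hne, fun n => ?_⟩
  by_cases hn : 2 ≤ n
  · obtain ⟨k, rfl⟩ : ∃ k, n = k + 2 := ⟨n - 2, by omega⟩
    exact ⟨_, hyp_eq_of_pearson hR hφ hψ hp k⟩
  · have h0 : Λ.D (Λ.D (P n)) = 0 := by
      rw [eq_C_of_natDegree_le_zero (natDegree_D_le (n := 1) ((hP.natDegree_le n).trans (by omega)))]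
      simp
    exact ⟨0, by rw [h0]; simp⟩

end LatticeParams
end

/-! ### From the second differences back to the sequence. -/

noncomputable section

namespace LatticeParams

variable {Λ : LatticeParams} {L : ℂ[X] →ₗ[ℂ] ℂ} {P : ℕ → ℂ[X]}

theorem coeff_midpoint : Λ.midpoint.coeff 1 = 2 * Λ.α ^ 2 - 1 := by
  rw [midpoint]; compute_degree!

theorem natDegree_midpoint_sq_sub_le :
    (Λ.midpoint ^ 2 - C (4 * Λ.α ^ 2) * Λ.U₂).natDegree ≤ 2 :=
  (natDegree_sub_le _ _).trans (max_le (natDegree_pow_le_of_le 2 natDegree_midpoint_le)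
    ((natDegree_C_mul_le _ _).trans natDegree_U₂_le))

theorem coeff_midpoint_sq_sub :
    (Λ.midpoint ^ 2 - C (4 * Λ.α ^ 2) * Λ.U₂).coeff 2 = 1 := by
  have := coeff_mul_add_eq_of_natDegree_le (natDegree_midpoint_le (Λ := Λ))
    (natDegree_midpoint_le (Λ := Λ))
  rw [coeff_sub, coeff_C_mul, coeff_U₂, pow_two, this, coeff_midpoint]; ring

/-- If the `P_n` are eigenfunctions up to polynomials of degree at most one, they are
eigenfunctions. -/
theorem hyp_eq_of_natDegree_sub_le (hP : IsOPS L P) {φ ψ : ℂ[X]} (hφ : φ.natDegree ≤ 2)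
    (hψ : ψ.natDegree ≤ 1) (l : ℕ → ℂ)
    (h : ∀ n, (Λ.hyp φ ψ (P n) - C (l n) * P n).natDegree ≤ 1)
    (h1 : (Λ.hyp φ ψ (P 1) - C (l 1) * P 1).natDegree ≤ 0)
    (h0 : Λ.hyp φ ψ (P 0) - C (l 0) * P 0 = 0) (n : ℕ) :
    Λ.hyp φ ψ (P n) = C (l n) * P n := by
  obtain ⟨r, hr⟩ : ∃ r : ℕ → ℂ[X], ∀ n, r n = Λ.hyp φ ψ (P n) - C (l n) * P n :=
    ⟨_, fun _ => rfl⟩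
  simp only [← hr] at h h1 h0
  set A := Λ.midpoint with hA
  set B := Λ.midpoint ^ 2 - C (4 * Λ.α ^ 2) * Λ.U₂ with hB
  have hAd : A.natDegree ≤ 1 := natDegree_midpoint_le
  have hBd : B.natDegree ≤ 2 := natDegree_midpoint_sq_sub_le
  have hBc : B.coeff 2 = 1 := coeff_midpoint_sq_sub
  -- The combination is the remainder part of `hyp_X_X_mul` at P_{m+2}, with X P_{m+2} and X²P_{m+2}
  -- expanded by the recurrence. It is orthogonal to all P_j with j < m, hence zero once its degree
  -- is below m.
  have key : ∀ m, ∃ e₁ e₂ e₃ e₄ e₅ e₆ e₇ e₈ : ℂ, e₅ ≠ 0 ∧ ∀ k < m,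
      (C e₁ * r (m + 4) + C e₂ * r (m + 3) + C e₃ * r (m + 2) + C e₄ * r (m + 1) + C e₅ * r m
        - C 2 * A * (C e₆ * r (m + 3) + C e₇ * r (m + 2) + C e₈ * r (m + 1))
        + B * r (m + 2)).natDegree ≤ k →
      C e₁ * r (m + 4) + C e₂ * r (m + 3) + C e₃ * r (m + 2) + C e₄ * r (m + 1) + C e₅ * r m
        - C 2 * A * (C e₆ * r (m + 3) + C e₇ * r (m + 2) + C e₈ * r (m + 1))
        + B * r (m + 2) = 0 := by
    intro m
    obtain ⟨a₀, b₀, c₀, hc₀, q₀⟩ := hP.exists_recurrence m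
    obtain ⟨a₁, b₁, c₁, hc₁, q₁⟩ := hP.exists_recurrence (m + 1)
    obtain ⟨a₂, b₂, c₂, -, q₂⟩ := hP.exists_recurrence (m + 2)
    simp only [add_assoc, Nat.reduceAdd] at q₁ q₂
    have q : X * (X * P (m + 2)) = C (a₁ * a₂) * P (m + 4) + C (a₁ * b₂ + b₁ * a₁) * P (m + 3)
        + C (a₁ * c₂ + b₁ * b₁ + c₁ * a₀) * P (m + 2) + C (b₁ * c₁ + c₁ * b₀) * P (m + 1)
        + C (c₁ * c₀) * P m := by
      simp only [C_mul, C_add]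
      linear_combination X * q₁ + C a₁ * q₂ + C b₁ * q₁ + C c₁ * q₀
    obtain ⟨e₁, he₁⟩ : ∃ e, e = a₁ * a₂ := ⟨_, rfl⟩
    obtain ⟨e₂, he₂⟩ : ∃ e, e = a₁ * b₂ + b₁ * a₁ := ⟨_, rfl⟩
    obtain ⟨e₃, he₃⟩ : ∃ e, e = a₁ * c₂ + b₁ * b₁ + c₁ * a₀ := ⟨_, rfl⟩
    obtain ⟨e₄, he₄⟩ : ∃ e, e = b₁ * c₁ + c₁ * b₀ := ⟨_, rfl⟩
    obtain ⟨e₅, he₅⟩ : ∃ e, e = c₁ * c₀ := ⟨_, rfl⟩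
    rw [← he₁, ← he₂, ← he₃, ← he₄, ← he₅] at q
    refine ⟨e₁, e₂, e₃, e₄, e₅, a₁, b₁, c₁, he₅ ▸ mul_ne_zero hc₁ hc₀, fun k hk hd =>
      hP.eq_zero_of_forall hd fun j hj => ?_⟩
    have id := Λ.hyp_X_X_mul φ ψ (P (m + 2))
    rw [q, q₁, ← hA, ← hB] at id
    simp only [map_add, ← smul_eq_C_mul, map_smul] at id
    simp only [smul_eq_C_mul, show ∀ n, Λ.hyp φ ψ (P n) = r n + C (l n) * P n from
      fun n => by rw [hr]; ring] at id
    have hQd : (C (2 * Λ.α) * φ + ψ * (X - A)).natDegree ≤ 2 := by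
      refine natDegree_add_le_of_degree_le ((natDegree_C_mul_le _ _).trans hφ) ?_
      exact natDegree_mul_le_of_le hψ ((natDegree_sub_le _ _).trans (max_le natDegree_X_le hAd))
    generalize C (2 * Λ.α) * φ + ψ * (X - A) = Q at id hQd
    -- What remains is a sum of terms g P_i with m ≤ i ≤ m + 4 and deg g ≤ i - m, so L annihilates
    -- each of them against P_j when j < m.
    have expand : (C e₁ * r (m + 4) + C e₂ * r (m + 3) + C e₃ * r (m + 2) + C e₄ * r (m + 1)
          + C e₅ * r m
          - C 2 * A * (C a₁ * r (m + 3) + C b₁ * r (m + 2) + C c₁ * r (m + 1))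
          + B * r (m + 2)) * P j =
        C (-(e₁ * l (m + 4))) * P j * P (m + 4) +
        (C (-(e₂ * l (m + 3))) + C (2 * a₁ * l (m + 3)) * A) * P j * P (m + 3) +
        (Q + C (-(e₃ * l (m + 2))) + C (2 * b₁ * l (m + 2)) * A + C (-l (m + 2)) * B) * P j
          * P (m + 2) +
        (C (-(e₄ * l (m + 1))) + C (2 * c₁ * l (m + 1)) * A) * P j * P (m + 1) +
        C (-(e₅ * l m)) * P j * P m := by
      simp only [C_neg, C_mul, C_ofNat]
      linear_combination P j * id
    have hlin : ∀ x y : ℂ, (C x + C y * A).natDegree ≤ 1 := fun x y =>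
      natDegree_add_le_of_degree_le (by simp) ((natDegree_C_mul_le _ _).trans hAd)
    have hPj := hP.natDegree_le j
    have hz : ∀ (g : ℂ[X]) (d i : ℕ), g.natDegree ≤ d → d + j < i → L (g * P j * P i) = 0 :=
      fun g d i hg hi => hP.map_mul_eq_zero ((natDegree_mul_le_of_le hg hPj).trans_lt hi)
    rw [expand, map_add, map_add, map_add, map_add, hz _ 0 _ (natDegree_C _).le (by omega),
      hz _ 1 _ (hlin _ _) (by omega), hz _ 2 _ ?_ (by omega), hz _ 1 _ (hlin _ _) (by omega),
      hz _ 0 _ (natDegree_C _).le (by omega)]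
    · simp
    · refine natDegree_add_le_of_degree_le (natDegree_add_le_of_degree_le
        (natDegree_add_le_of_degree_le hQd ((natDegree_C _).le.trans (by omega))) ?_) ((natDegree_C_mul_le _ _).trans hBd)
      exact ((natDegree_C_mul_le _ _).trans hAd).trans (by omega)
  have hCr : ∀ (e : ℂ) (i d : ℕ), (r i).natDegree ≤ d → (C e * r i).natDegree ≤ d :=
    fun e i d hd => (natDegree_C_mul_le _ _).trans hd
  have hsum5 : ∀ (e₁ e₂ e₃ e₄ e₅ : ℂ) (m : ℕ), (C e₁ * r (m + 4) + C e₂ * r (m + 3)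
      + C e₃ * r (m + 2) + C e₄ * r (m + 1) + C e₅ * r m).natDegree ≤ 1 := fun e₁ e₂ e₃ e₄ e₅ m =>
    natDegree_add_le_of_degree_le (natDegree_add_le_of_degree_le (natDegree_add_le_of_degree_le
      (natDegree_add_le_of_degree_le (hCr _ _ _ (h _)) (hCr _ _ _ (h _))) (hCr _ _ _ (h _)))
      (hCr _ _ _ (h _))) (hCr _ _ _ (h _))
  have hsum3 : ∀ (e₆ e₇ e₈ : ℂ) (m d : ℕ), (∀ i, m < i → (r i).natDegree ≤ d) →
      (C 2 * A * (C e₆ * r (m + 3) + C e₇ * r (m + 2) + C e₈ * r (m + 1))).natDegree ≤ 1 + d :=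
    fun e₆ e₇ e₈ m d hd => natDegree_mul_le_of_le ((natDegree_C_mul_le _ _).trans hAd)
      (natDegree_add_le_of_degree_le (natDegree_add_le_of_degree_le (hCr _ _ _ (hd _ (by omega)))
      (hCr _ _ _ (hd _ (by omega)))) (hCr _ _ _ (hd _ (by omega))))
  -- The combination has degree at most 3 < m, hence is zero. Only B r_{m+2} reaches degree 2 + d,
  -- and B has leading coefficient 1.
  have hlead : ∀ m d : ℕ, 4 ≤ m → d ≤ 1 → (∀ i, m < i → (r i).natDegree ≤ d) →
      (r (m + 2)).natDegree ≤ d → (r (m + 2)).coeff d = 0 := by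
    intro m d hm hd1 hd hr2
    obtain ⟨e₁, e₂, e₃, e₄, e₅, e₆, e₇, e₈, -, hk⟩ := key m
    have w1 := hsum5 e₁ e₂ e₃ e₄ e₅ m
    have w2 := hsum3 e₆ e₇ e₈ m d hd
    have w3 := natDegree_mul_le_of_le hBd hr2
    have := hk 3 (by omega) (natDegree_add_le_of_degree_le
      ((natDegree_sub_le _ _).trans (max_le (w1.trans (by omega)) (w2.trans (by omega))))
      (w3.trans (by omega)))
    have h4 := congrArg (fun p => coeff p (2 + d)) this
    simp only [coeff_add _ (B * _), coeff_sub, coeff_zero] at h4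
    rw [coeff_eq_zero_of_natDegree_lt (w1.trans_lt (by omega)),
      coeff_eq_zero_of_natDegree_lt (w2.trans_lt (by omega)),
      coeff_mul_add_eq_of_natDegree_le hBd hr2, hBc] at h4
    linear_combination h4
  have s1 : ∀ n, 6 ≤ n → (r n).natDegree ≤ 0 := by
    intro n hn
    obtain ⟨m, rfl⟩ : ∃ m, n = m + 2 := ⟨n - 2, by omega⟩
    exact natDegree_le_pred (h _) (hlead m 1 (by omega) le_rfl (fun i _ => h i) (h _))
  have s2 : ∀ n, 7 ≤ n → r n = 0 := by
    intro n hn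
    obtain ⟨m, rfl⟩ : ∃ m, n = m + 2 := ⟨n - 2, by omega⟩
    have := hlead m 0 (by omega) (by omega) (fun i hi => s1 i (by omega)) (s1 _ (by omega))
    rw [eq_C_of_natDegree_le_zero (s1 (m + 2) (by omega)), this, C_0]
  -- Downward induction on m: once all later remainders vanish, the combination reduces to e₅ r_m.
  -- It needs deg r_m < m, which for m = 1 is the extra hypothesis `h1`.
  have s3 : ∀ j m, 7 ≤ m + j → 1 ≤ m → ∀ n, m ≤ n → r n = 0 := by
    intro j
    induction j with
    | zero => exact fun m hm _ n hn => s2 n (by omega)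
    | succ j ih =>
      intro m hm hm1 n hn
      rcases hn.eq_or_lt with rfl | hn
      · have hz := ih (m + 1) (by omega) (by omega)
        obtain ⟨e₁, e₂, e₃, e₄, e₅, e₆, e₇, e₈, he, hk⟩ := key m
        rw [hz (m + 4) (by omega), hz (m + 3) (by omega), hz (m + 2) (by omega),
          hz (m + 1) (by omega)] at hk
        simp only [mul_zero, add_zero, zero_add, sub_zero] at hk
        have : (r m).natDegree ≤ m - 1 := by
          rcases hm1.eq_or_lt with rfl | hm2
          · exact h1
          · exact (h m).trans (by omega)
        exact (mul_eq_zero.1 (hk (m - 1) (by omega) (hCr _ _ _ this))).resolve_left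
          (C_ne_zero.2 he)
      · exact ih (m + 1) (by omega) (by omega) n hn
  have : r n = 0 := by
    rcases Nat.eq_zero_or_pos n with rfl | hn
    · exact h0
    · exact s3 7 n (by omega) hn n le_rfl
  rw [hr] at this
  exact sub_eq_zero.1 this

/-- On a nondegenerate lattice, an orthogonal sequence satisfies the first structure relation if
and only if its members are eigenfunctions of a second order divided difference operator. -/
theorem structure_iff (hΛ : Λ.Nondegenerate) (hP : IsOPS L P) :
    (∃ (π : ℂ[X]) (a : ℕ → ℕ → ℂ), π.natDegree ≤ 4 ∧ ∀ n : ℕ, 2 ≤ n → a n (n - 2) ≠ 0 ∧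
        π * Λ.D (Λ.D (P n)) = ∑ m ∈ Finset.Icc (n - 2) (n + 2), C (a n m) * P m) ↔
      ∃ φ ψ : ℂ[X], φ.natDegree ≤ 2 ∧ ψ.natDegree ≤ 1 ∧ (φ ≠ 0 ∨ ψ ≠ 0) ∧
        ∀ n, ∃ l : ℂ, Λ.hyp φ ψ (P n) = C l * P n := by
  constructor
  · rintro ⟨π, a, -, h⟩
    obtain ⟨φ', ψ', hφ', hψ', hne, hT⟩ := exists_hyp_D_D_eq hΛ hP h
    -- Two differences separate D²P_n from P_n, so the operator is unlifted twice.
    obtain ⟨φ₁, ψ₁, hφ₁, hψ₁, rfl, rfl⟩ := exists_lift_eq (Λ := Λ) hφ' hψ'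
    obtain ⟨φ, ψ, hφ, hψ, rfl, rfl⟩ := exists_lift_eq (Λ := Λ) hφ₁ hψ₁
    have hD : ∀ p : ℂ[X], p.natDegree ≤ 1 → ∃ c, Λ.D p = C c := fun p hp =>
      ⟨_, eq_C_of_natDegree_le_zero (natDegree_D_le (n := 1) hp)⟩
    obtain ⟨c₁, hc₁⟩ := hD _ hψ₁
    obtain ⟨c₂, hc₂⟩ := hD _ hψ
    set l := Λ.eig (φ.coeff 2) (ψ.coeff 1) with hl
    have hcoef : ∀ n, (Λ.hyp φ ψ (P n) - C (l n) * P n).coeff n = 0 := fun n => by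
      rw [coeff_sub, coeff_hyp hφ hψ (hP.natDegree_le n), coeff_C_mul, sub_self]
    have hdeg : ∀ n, (Λ.hyp φ ψ (P n) - C (l n) * P n).natDegree ≤ n := fun n =>
      (natDegree_sub_le _ _).trans (max_le (natDegree_hyp_le hφ hψ (hP.natDegree_le n))
        ((natDegree_C_mul_le _ _).trans (hP.natDegree_le n)))
    refine ⟨φ, ψ, hφ, hψ, ?_, fun n => ⟨l n, hyp_eq_of_natDegree_sub_le hP hφ hψ l ?_ ?_ ?_ n⟩⟩
    · by_contra! hc
      rw [hc.1, hc.2] at hne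
      simp [liftφ, liftψ] at hne
    · intro n
      by_cases hn : n ≤ 1
      · exact (hdeg n).trans hn
      obtain ⟨μ, hμ⟩ := hT n
      have h2 : Λ.D (Λ.D (Λ.hyp φ ψ (P n))) = C (μ + c₁ + c₂) * Λ.D (Λ.D (P n)) := by
        rw [D_hyp, map_add, D_hyp, hμ, hc₁, hc₂, D_C_mul, C_add, C_add]; ring
      have h3 : (Λ.hyp φ ψ (P n) - C (μ + c₁ + c₂) * P n).natDegree ≤ 1 := by
        have h4 : Λ.D (Λ.D (Λ.hyp φ ψ (P n) - C (μ + c₁ + c₂) * P n)) = 0 := by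
          rw [map_sub, map_sub, h2, D_C_mul, D_C_mul, sub_self]
        have h5 : (Λ.D (Λ.hyp φ ψ (P n) - C (μ + c₁ + c₂) * P n)).natDegree ≤ 0 := by
          have h5 := hΛ.natDegree_le_of_D (n := 0) (by rw [h4]; simp)
          refine natDegree_le_pred h5 ?_
          have h6 := coeff_D (Λ := Λ) (n := 0) h5
          rw [h4, coeff_zero, eq_comm] at h6
          exact (mul_eq_zero.1 h6).resolve_left (hΛ.leadD_ne 0)
        exact hΛ.natDegree_le_of_D h5
      have h6 : l n = μ + c₁ + c₂ := by
        have := coeff_eq_zero_of_natDegree_lt (h3.trans_lt (by omega : 1 < n))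
        rw [coeff_sub, coeff_hyp hφ hψ (hP.natDegree_le n), coeff_C_mul, ← sub_mul] at this
        exact sub_eq_zero.1 ((mul_eq_zero.1 this).resolve_right (hP.coeff_ne n))
      rw [h6]; exact h3
    · exact natDegree_le_pred (hdeg 1) (hcoef 1)
    · rw [hyp_zero_index hP]; simp [hl]
  · rintro ⟨φ, ψ, hφ, hψ, hne, h⟩
    choose l hl using h
    exact exists_structure_of_hyp_eq hΛ hP hφ hψ hne hl

end LatticeParams
end

/-! ### Bidiagonal operators, and the Askey–Wilson operator of a q-quadratic lattice. -/

noncomputable section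

theorem map_C_mul_eq (T : ℂ[X] →ₗ[ℂ] ℂ[X]) (c : ℂ) (f : ℂ[X]) : T (C c * f) = C c * T f := by
  rw [← smul_eq_C_mul, map_smul, smul_eq_C_mul]

/-- Eigenfunctions of an operator that is bidiagonal on a sequence of functions. -/
theorem map_sum_eq_of_bidiagonal (T : ℂ[X] →ₗ[ℂ] ℂ[X]) (Φ : ℕ → ℂ[X]) (l μ c : ℕ → ℂ) (n : ℕ)
    (h0 : T (Φ 0) = C (l 0) * Φ 0)
    (hT : ∀ k, T (Φ (k + 1)) = C (l (k + 1)) * Φ (k + 1) + C (μ k) * Φ k)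
    (hc : ∀ k < n, c (k + 1) * μ k = (l n - l k) * c k) :
    T (∑ k ∈ Finset.range (n + 1), C (c k) * Φ k) =
      C (l n) * ∑ k ∈ Finset.range (n + 1), C (c k) * Φ k := by
  -- In a partial sum all terms but the last have received their contribution from the next index;
  -- the last carries its own eigenvalue until m = n.
  have key : ∀ m ≤ n, T (∑ k ∈ Finset.range (m + 1), C (c k) * Φ k) =
      C (l n) * ∑ k ∈ Finset.range m, C (c k) * Φ k + C (l m * c m) * Φ m := by
    intro m
    induction m with
    | zero =>
      intro _
      rw [Finset.sum_range_one, map_C_mul_eq, h0, C_mul]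
      simp; ring
    | succ m ih =>
      intro hm
      have h1 := congrArg C (hc m (by omega))
      rw [Finset.sum_range_succ, map_add, ih (by omega), map_C_mul_eq, hT,
        Finset.sum_range_succ]
      simp only [C_mul, C_sub] at h1 ⊢
      linear_combination Φ m * h1
  rw [key n le_rfl, Finset.sum_range_succ, C_mul]; ring

namespace LatticeParams

variable {Λ : LatticeParams} {L : ℂ[X] →ₗ[ℂ] ℂ} {P : ℕ → ℂ[X]}

/-- Eigenfunctions of a given degree are unique up to constants. -/
theorem eq_C_mul_of_hyp_eq (hΛ : Λ.Nondegenerate) {φ ψ : ℂ[X]} (hφ : φ.natDegree ≤ 2)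
    (hψ : ψ.natDegree ≤ 1) (hadm : ∀ n, Λ.adm (φ.coeff 2) (ψ.coeff 1) n ≠ 0) {n : ℕ}
    {f g : ℂ[X]} (hf : f.natDegree ≤ n) (hg : g.natDegree ≤ n) (hgn : g.coeff n ≠ 0) {l l' : ℂ}
    (hTf : Λ.hyp φ ψ f = C l * f) (hTg : Λ.hyp φ ψ g = C l' * g) (hfn : f.coeff n ≠ 0) :
    f = C (f.coeff n / g.coeff n) * g := by
  have e1 : l = Λ.eig (φ.coeff 2) (ψ.coeff 1) n := by
    have := coeff_hyp (Λ := Λ) hφ hψ hf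
    rw [hTf, coeff_C_mul] at this
    exact mul_right_cancel₀ hfn this
  have e2 : l' = Λ.eig (φ.coeff 2) (ψ.coeff 1) n := by
    have := coeff_hyp (Λ := Λ) hφ hψ hg
    rw [hTg, coeff_C_mul] at this
    exact mul_right_cancel₀ hgn this
  subst e1
  obtain ⟨r, hr⟩ : ∃ r, r = f - C (f.coeff n / g.coeff n) * g := ⟨_, rfl⟩
  rw [← sub_eq_zero, ← hr]
  have hTr : Λ.hyp φ ψ r = C (Λ.eig (φ.coeff 2) (ψ.coeff 1) n) * r := by
    rw [hr, map_sub, hTf, map_C_mul_eq, hTg, e2]; ring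
  have hrd : r.natDegree ≤ n := by
    rw [hr]
    exact (natDegree_sub_le _ _).trans (max_le hf ((natDegree_C_mul_le _ _).trans hg))
  have hrn : r.coeff n = 0 := by
    rw [hr, coeff_sub, coeff_C_mul, div_mul_cancel₀ _ hgn, sub_self]
  by_contra hne
  have hlt : r.natDegree < n := lt_of_le_of_ne hrd fun h => hne <| by
    rw [← leadingCoeff_eq_zero, leadingCoeff, h, hrn]
  have h1 := coeff_hyp (Λ := Λ) hφ hψ (le_refl r.natDegree)
  rw [hTr, coeff_C_mul] at h1
  have h2 := mul_right_cancel₀ (leadingCoeff_ne_zero.2 hne) h1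
  -- A nonzero difference would be an eigenfunction of lower degree with the eigenvalue of index n,
  -- against distinctness.
  obtain ⟨k, hk⟩ : ∃ k, n = r.natDegree + k + 1 := ⟨n - r.natDegree - 1, by omega⟩
  have h3 := Λ.eig_sub_eig (φ.coeff 2) (ψ.coeff 1) r.natDegree k
  rw [← hk, h2, sub_self, eq_comm] at h3
  exact mul_ne_zero (hΛ.leadD_ne k) (hadm _) h3

/-- The constants of the lattice `x = k (z + z⁻¹) + c`, `z(s + 1/2) = p z(s)`. -/
def qParams (p k c : ℂ) : LatticeParams where
  α := (p + p⁻¹) / 2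
  β := (1 - (p + p⁻¹) / 2) * c
  δ := (((p + p⁻¹) / 2) ^ 2 - 1) * (c ^ 2 - 4 * k ^ 2)

end LatticeParams

open LatticeParams

/-- `x = k (z + z⁻¹) + c`, where `z(s + 1/2) = p z(s)`. -/
structure IsQLattice (p k c : ℂ) (x z : ℂ → ℂ) : Prop where
  p_ne : p ≠ 0
  k_ne : k ≠ 0
  pow_ne (n : ℕ) (hn : 0 < n) : (p ^ 2) ^ n ≠ 1
  x_eq (s : ℂ) : x s = k * (z s + (z s)⁻¹) + c
  z_ne (s : ℂ) : z s ≠ 0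
  z_add (s : ℂ) : z (s + 1 / 2) = p * z s
  z_surj (w : ℂ) (hw : w ≠ 0) : ∃ s, z s = w

/-- The value at `z` of the polynomial with coefficients `h`. -/
def quartic (h : Fin 5 → ℂ) (z : ℂ) : ℂ :=
  h 0 + h 1 * z + h 2 * z ^ 2 + h 3 * z ^ 3 + h 4 * z ^ 4

/-- The polynomial which takes the value `z + z⁻¹` at `k (z + z⁻¹) + c`. -/
def qVar (k c : ℂ) : ℂ[X] := C k⁻¹ * (X - C c)

/-- The second order coefficient of the Askey--Wilson operator attached to the quartic `h`. -/
def qφ (p k c : ℂ) (h : Fin 5 → ℂ) : ℂ[X] :=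
  C (k ^ 2 * (p ^ 2 - 1) ^ 2 / p ^ 3) *
    (C (h 2 - h 0 - h 4) + C ((h 1 + h 3) / 2) * qVar k c + C ((h 0 + h 4) / 2) * qVar k c ^ 2)

/-- The first order coefficient of the Askey--Wilson operator attached to the quartic `h`. -/
def qψ (p k c : ℂ) (h : Fin 5 → ℂ) : ℂ[X] :=
  C (2 * k * (p ^ 2 - 1) / p ^ 2) *
    (C ((h 3 - h 1) / 2) + C ((h 4 - h 0) / 2) * qVar k c)

/-- The Askey--Wilson operator attached to the quartic `h`. -/
def qHyp (p k c : ℂ) (h : Fin 5 → ℂ) : ℂ[X] →ₗ[ℂ] ℂ[X] :=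
  (qParams p k c).hyp (qφ p k c h) (qψ p k c h)

theorem natDegree_qVar_le (k c : ℂ) : (qVar k c).natDegree ≤ 1 := by
  rw [qVar]; compute_degree

theorem natDegree_qφ_le (p k c : ℂ) (h : Fin 5 → ℂ) : (qφ p k c h).natDegree ≤ 2 := by
  rw [qφ, qVar]; compute_degree

theorem natDegree_qψ_le (p k c : ℂ) (h : Fin 5 → ℂ) : (qψ p k c h).natDegree ≤ 1 := by
  rw [qψ, qVar]; compute_degree

theorem coeff_qφ (p k c : ℂ) (h : Fin 5 → ℂ) : (qφ p k c h).coeff 2 =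
    k ^ 2 * (p ^ 2 - 1) ^ 2 / p ^ 3 * ((h 0 + h 4) / 2 * k⁻¹ ^ 2) := by
  rw [qφ, qVar]; compute_degree!

theorem coeff_qψ (p k c : ℂ) (h : Fin 5 → ℂ) : (qψ p k c h).coeff 1 =
    2 * k * (p ^ 2 - 1) / p ^ 2 * ((h 4 - h 0) / 2 * k⁻¹) := by
  rw [qψ, qVar]; compute_degree!

/-- Linearity in the quartic: scaling and limits of the operator reduce to five fixed operators. -/
theorem qHyp_eq_sum (p k c : ℂ) (h : Fin 5 → ℂ) (f : ℂ[X]) :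
    qHyp p k c h f = ∑ i, C (h i) * qHyp p k c (Pi.single i 1) f := by
  simp only [qHyp, hyp_apply, Fin.sum_univ_five]
  simp [qφ, qψ, div_eq_mul_inv]
  ring

namespace IsQLattice

variable {p k c : ℂ} {x z : ℂ → ℂ}

theorem sq_ne_one (hx : IsQLattice p k c x z) : p ^ 2 - 1 ≠ 0 := fun h =>
  hx.pow_ne 1 one_pos (by linear_combination h)

theorem z_sub (hx : IsQLattice p k c x z) (s : ℂ) : z (s - 1 / 2) = p⁻¹ * z s := by
  have := hx.z_add (s - 1 / 2)
  rw [sub_add_cancel] at this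
  rw [this, inv_mul_cancel_left₀ hx.p_ne]

theorem z_add_one (hx : IsQLattice p k c x z) (s : ℂ) : z (s + 1) = p ^ 2 * z s := by
  rw [show s + 1 = s + 1 / 2 + 1 / 2 by ring, hx.z_add, hx.z_add]; ring

theorem z_sub_one (hx : IsQLattice p k c x z) (s : ℂ) : z (s - 1) = (p ^ 2)⁻¹ * z s := by
  rw [show s - 1 = s - 1 / 2 - 1 / 2 by ring, hx.z_sub, hx.z_sub, pow_two, mul_inv, mul_assoc]

theorem surj (hx : IsQLattice p k c x z) : Function.Surjective x := by
  intro y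
  obtain ⟨d, hd⟩ := IsAlgClosed.exists_pow_nat_eq (((y - c) / k) ^ 2 - 4) (n := 2) (by norm_num)
  have hw : ((y - c) / k + d) / 2 * (((y - c) / k - d) / 2) = 1 := by
    linear_combination -hd / 4
  obtain ⟨s, hs⟩ := hx.z_surj (((y - c) / k + d) / 2) (left_ne_zero_of_mul_eq_one hw)
  refine ⟨s, ?_⟩
  rw [hx.x_eq, hs, inv_eq_of_mul_eq_one_right hw]
  have := hx.k_ne
  field_simp
  ring

theorem isLattice (hx : IsQLattice p k c x z) : (qParams p k c).IsLattice x := by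
  have hp := hx.p_ne
  refine ⟨fun s => ?_, fun s => ?_, hx.surj⟩
  · have := hx.z_ne s
    simp only [hx.x_eq, hx.z_add, hx.z_sub, qParams]
    field_simp
    ring
  · have := hx.z_ne s
    simp only [hx.x_eq, hx.z_add, hx.z_sub, qParams, U₂, eval_add, eval_mul, eval_C, eval_X,
      eval_pow]
    field_simp
    ring

theorem lead_eq (hx : IsQLattice p k c x z) (n : ℕ) :
    (qParams p k c).leadS n = (p ^ n + p⁻¹ ^ n) / 2 ∧
    (p - p⁻¹) * (qParams p k c).leadD n = p ^ n - p⁻¹ ^ n := by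
  have hp := mul_inv_cancel₀ hx.p_ne
  induction n with
  | zero => simp
  | succ n ih =>
    obtain ⟨h1, h2⟩ := ih
    rw [leadS_succ, leadD_succ, h1, pow_succ, pow_succ]
    have hα : (qParams p k c).α = (p + p⁻¹) / 2 := rfl
    rw [hα]
    generalize p⁻¹ = r at *
    constructor
    · linear_combination (p - r) / 4 * h2 + (qParams p k c).leadD n * hp
    · linear_combination (p + r) / 2 * h2

theorem nondegenerate (hx : IsQLattice p k c x z) : (qParams p k c).Nondegenerate := by
  have hp := hx.p_ne
  have hα : (qParams p k c).α = (p + p⁻¹) / 2 := rfl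
  have hα1 : (qParams p k c).α ^ 2 - 1 ≠ 0 := by
    have : (qParams p k c).α ^ 2 - 1 = ((p ^ 2 - 1) / (2 * p)) ^ 2 := by
      rw [hα]; field_simp; ring
    rw [this]
    exact pow_ne_zero 2 (div_ne_zero hx.sq_ne_one (by simpa using hp))
  refine ⟨fun n h => ?_, fun h => ?_, fun h => ?_, fun h => ?_⟩
  · have := (hx.lead_eq (n + 1)).2
    rw [h, mul_zero, inv_pow, eq_comm, sub_eq_zero] at this
    apply hx.pow_ne (n + 1) n.succ_pos
    rw [← pow_mul, mul_comm, pow_mul, pow_two]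
    nth_rewrite 2 [this]
    exact mul_inv_cancel₀ (pow_ne_zero _ hp)
  · apply hx.pow_ne 2 two_pos
    rw [hα] at h
    have : p ^ 2 = -1 := by field_simp at h; linear_combination h
    rw [this]; ring
  · exact hα1 (by rw [← coeff_U₂, h, coeff_zero])
  · have h1 := coeff_mul_add_eq_of_natDegree_le (natDegree_U₁_le (Λ := qParams p k c))
      (natDegree_U₁_le (Λ := qParams p k c))
    have h2 := congrArg (fun f => coeff f 2) h
    simp only [coeff_sub, coeff_C_mul, coeff_U₂, coeff_zero] at h2
    rw [pow_two, h1, coeff_U₁] at h2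
    exact hα1 (by linear_combination -h2)

/-- With q = p², admissibility reads h₄q^m ≠ h₀; in particular h₀ and h₄ cannot both vanish. -/
theorem adm_eq (hx : IsQLattice p k c x z) (h : Fin 5 → ℂ) (m : ℕ) :
    (qParams p k c).adm ((qφ p k c h).coeff 2) ((qψ p k c h).coeff 1) m =
      (p ^ 2 - 1) / p ^ (m + 2) * (h 4 * (p ^ 2) ^ m - h 0) := by
  have hp := hx.p_ne
  have hk := hx.k_ne
  obtain ⟨h1, h2⟩ := hx.lead_eq m
  have h3 : (qParams p k c).leadD m = (p ^ m - p⁻¹ ^ m) * p / (p ^ 2 - 1) := by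
    rw [← h2]; field_simp [hx.sq_ne_one]
  rw [adm, h1, h3, coeff_qφ, coeff_qψ, ← pow_mul, mul_comm 2 m, pow_mul, pow_add]
  simp only [inv_pow]
  have := hx.sq_ne_one
  have := pow_ne_zero m hp
  field_simp
  ring

/-- Up to constants, φ and (z - z⁻¹)ψ are the parts of z⁻²h(z) that are symmetric and antisymmetric
under z ↔ z⁻¹, and every admissible degree pattern arises. -/
theorem exists_quartic (hx : IsQLattice p k c x z) {φ ψ : ℂ[X]} (hφ : φ.natDegree ≤ 2)
    (hψ : ψ.natDegree ≤ 1) : ∃ h, qφ p k c h = φ ∧ qψ p k c h = ψ := by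
  have hp := hx.p_ne
  have hk := hx.k_ne
  have hp1 := hx.sq_ne_one
  set κ₀ := k ^ 2 * (p ^ 2 - 1) ^ 2 / p ^ 3 with hκ₀
  set κ₁ := 2 * k * (p ^ 2 - 1) / p ^ 2 with hκ₁
  have n0 : κ₀ ≠ 0 := div_ne_zero (mul_ne_zero (pow_ne_zero 2 hk) (pow_ne_zero 2 hp1))
    (pow_ne_zero 3 hp)
  have n1 : κ₁ ≠ 0 := div_ne_zero (mul_ne_zero (mul_ne_zero two_ne_zero hk) hp1) (pow_ne_zero 2 hp)
  have e₁ : φ = C (φ.coeff 2) * X ^ 2 + C (φ.coeff 1) * X + C (φ.coeff 0) := by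
    conv_lhs => rw [φ.as_sum_range_C_mul_X_pow' (show φ.natDegree < 3 by omega)]
    simp [Finset.sum_range_succ]; ring
  have e₂ : ψ = C (ψ.coeff 1) * X + C (ψ.coeff 0) := by
    conv_lhs => rw [ψ.as_sum_range_C_mul_X_pow' (show ψ.natDegree < 2 by omega)]
    simp [Finset.sum_range_succ]; ring
  have hX : (X : ℂ[X]) = C k * qVar k c + C c := by
    rw [qVar, ← mul_assoc, ← C_mul, mul_inv_cancel₀ hk]; simp
  obtain ⟨A₀, hA₀⟩ : ∃ A, A * κ₀ = φ.coeff 2 * c ^ 2 + φ.coeff 1 * c + φ.coeff 0 :=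
    ⟨_ / κ₀, div_mul_cancel₀ _ n0⟩
  obtain ⟨A₁, hA₁⟩ : ∃ A, A * κ₀ = 2 * φ.coeff 2 * k * c + φ.coeff 1 * k :=
    ⟨_ / κ₀, div_mul_cancel₀ _ n0⟩
  obtain ⟨A₂, hA₂⟩ : ∃ A, A * κ₀ = φ.coeff 2 * k ^ 2 := ⟨_ / κ₀, div_mul_cancel₀ _ n0⟩
  obtain ⟨B₀, hB₀⟩ : ∃ A, A * κ₁ = ψ.coeff 1 * c + ψ.coeff 0 := ⟨_ / κ₁, div_mul_cancel₀ _ n1⟩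
  obtain ⟨B₁, hB₁⟩ : ∃ A, A * κ₁ = ψ.coeff 1 * k := ⟨_ / κ₁, div_mul_cancel₀ _ n1⟩
  refine ⟨![A₂ - B₁, A₁ - B₀, A₀ + 2 * A₂, A₁ + B₀, A₂ + B₁], ?_, ?_⟩
  · conv_rhs => rw [e₁, hX]
    rw [qφ, ← hκ₀]
    replace hA₀ := congrArg C hA₀
    replace hA₁ := congrArg C hA₁
    replace hA₂ := congrArg C hA₂
    simp only [Matrix.cons_val]
    rw [show A₀ + 2 * A₂ - (A₂ - B₁) - (A₂ + B₁) = A₀ by ring,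
      show (A₁ - B₀ + (A₁ + B₀)) / 2 = A₁ by ring,
      show (A₂ - B₁ + (A₂ + B₁)) / 2 = A₂ by ring]
    simp only [C_mul, C_add, C_pow, C_ofNat] at hA₀ hA₁ hA₂
    linear_combination hA₀ + qVar k c * hA₁ + qVar k c ^ 2 * hA₂
  · conv_rhs => rw [e₂, hX]
    rw [qψ, ← hκ₁]
    replace hB₀ := congrArg C hB₀
    replace hB₁ := congrArg C hB₁
    simp only [Matrix.cons_val]
    rw [show (A₁ + B₀ - (A₁ - B₀)) / 2 = B₀ by ring,
      show (A₂ + B₁ - (A₂ - B₁)) / 2 = B₁ by ring]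
    simp only [C_mul, C_add] at hB₀ hB₁
    linear_combination hB₀ + qVar k c * hB₁

theorem eval_qVar (hx : IsQLattice p k c x z) (s : ℂ) :
    (qVar k c).eval (x s) = z s + (z s)⁻¹ := by
  have := hx.k_ne
  rw [qVar, eval_mul, eval_sub, eval_C, eval_C, eval_X, hx.x_eq]
  field_simp; ring

/-- The Askey--Wilson operator in terms of `q`-shifts. -/
theorem eval_qHyp (hx : IsQLattice p k c x z) (h : Fin 5 → ℂ) (f : ℂ[X]) {s : ℂ}
    (h1 : z s ^ 2 - 1 ≠ 0) (h2 : p ^ 2 * z s ^ 2 - 1 ≠ 0) (h3 : z s ^ 2 - p ^ 2 ≠ 0) :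
    (qHyp p k c h f).eval (x s) =
      quartic h (z s) / ((z s ^ 2 - 1) * (p ^ 2 * z s ^ 2 - 1)) *
          (f.eval (x (s + 1)) - f.eval (x s)) +
        quartic h (z s)⁻¹ * z s ^ 4 / ((z s ^ 2 - 1) * (z s ^ 2 - p ^ 2)) *
          (f.eval (x (s - 1)) - f.eval (x s)) := by
  have hp := hx.p_ne
  have hk := hx.k_ne
  have hz := hx.z_ne s
  have hp1 := hx.sq_ne_one
  have d0 : x (s + 1 / 2) - x (s - 1 / 2) = k * (p ^ 2 - 1) * (z s ^ 2 - 1) / (p * z s) := by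
    rw [hx.x_eq, hx.x_eq, hx.z_add, hx.z_sub]; field_simp; ring
  have d1 : x (s + 1) - x s = k * (p ^ 2 - 1) * (p ^ 2 * z s ^ 2 - 1) / (p ^ 2 * z s) := by
    rw [hx.x_eq, hx.x_eq, hx.z_add_one]; field_simp; ring
  have d2 : x s - x (s - 1) = k * (p ^ 2 - 1) * (z s ^ 2 - p ^ 2) / (p ^ 2 * z s) := by
    rw [hx.x_eq, hx.x_eq, hx.z_sub_one]; field_simp; ring
  have hs1 : x (s + 1 / 2) ≠ x (s - 1 / 2) := by
    rw [← sub_ne_zero, d0]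
    exact div_ne_zero (mul_ne_zero (mul_ne_zero hk hp1) h1) (mul_ne_zero hp hz)
  have hs2 : x (s + 1) ≠ x s := by
    rw [← sub_ne_zero, d1]
    exact div_ne_zero (mul_ne_zero (mul_ne_zero hk hp1) h2) (mul_ne_zero (pow_ne_zero 2 hp) hz)
  have hs3 : x s ≠ x (s - 1) := by
    rw [← sub_ne_zero, d2]
    exact div_ne_zero (mul_ne_zero (mul_ne_zero hk hp1) h3) (mul_ne_zero (pow_ne_zero 2 hp) hz)
  have e1 : (qφ p k c h).eval (x s) + (x (s + 1 / 2) - x (s - 1 / 2)) / 2 * (qψ p k c h).eval (x s)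
      = k ^ 2 * (p ^ 2 - 1) ^ 2 / p ^ 3 * (quartic h (z s) / z s ^ 2) := by
    rw [d0]
    simp only [qφ, qψ, eval_add, eval_mul, eval_C, eval_pow, hx.eval_qVar, quartic]
    field_simp
    ring
  have e2 : (qφ p k c h).eval (x s) - (x (s + 1 / 2) - x (s - 1 / 2)) / 2 * (qψ p k c h).eval (x s)
      = k ^ 2 * (p ^ 2 - 1) ^ 2 / p ^ 3 * (quartic h (z s)⁻¹ * z s ^ 2) := by
    rw [d0]
    simp only [qφ, qψ, eval_add, eval_mul, eval_C, eval_pow, hx.eval_qVar, quartic]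
    field_simp
    ring
  rw [qHyp, hx.isLattice.eval_hyp _ _ _ hs1 hs2 hs3, e1, e2, d0, d1, d2]
  generalize quartic h (z s) = H
  generalize quartic h (z s)⁻¹ = H'
  field_simp
  ring

theorem eq_of_eval_eq (hx : IsQLattice p k c x z) {f g : ℂ[X]}
    (h : ∀ s, z s ^ 2 - 1 ≠ 0 → p ^ 2 * z s ^ 2 - 1 ≠ 0 → z s ^ 2 - p ^ 2 ≠ 0 →
      f.eval (x s) = g.eval (x s)) : f = g := by
  have hp := hx.p_ne
  have hk := hx.k_ne
  refine hx.isLattice.eq_of_eval_eq hx.nondegenerate fun s h1 h2 h3 => h s ?_ ?_ ?_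
  · intro h0; apply h1
    have hz := hx.z_ne s
    rw [← sub_eq_zero, hx.x_eq, hx.x_eq, hx.z_add, hx.z_sub]; field_simp
    linear_combination k * (p ^ 2 - 1) * h0
  · intro h0; apply h2
    have hz := hx.z_ne s
    rw [← sub_eq_zero, hx.x_eq, hx.x_eq, hx.z_add_one]; field_simp
    linear_combination k * (p ^ 2 - 1) * h0
  · intro h0; apply h3
    have hz := hx.z_ne s
    rw [← sub_eq_zero, hx.x_eq, hx.x_eq, hx.z_sub_one]; field_simp
    linear_combination k * (p ^ 2 - 1) * h0

theorem qHyp_eq_of_eval (hx : IsQLattice p k c x z) (h : Fin 5 → ℂ) (f g : ℂ[X]) (F G : ℂ → ℂ)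
    (hf : ∀ s, f.eval (x s) = F (z s)) (hg : ∀ s, g.eval (x s) = G (z s))
    (hFG : ∀ w, w ≠ 0 → w ^ 2 - 1 ≠ 0 → p ^ 2 * w ^ 2 - 1 ≠ 0 → w ^ 2 - p ^ 2 ≠ 0 →
      quartic h w / ((w ^ 2 - 1) * (p ^ 2 * w ^ 2 - 1)) * (F (p ^ 2 * w) - F w) +
        quartic h w⁻¹ * w ^ 4 / ((w ^ 2 - 1) * (w ^ 2 - p ^ 2)) * (F ((p ^ 2)⁻¹ * w) - F w) =
      G w) : qHyp p k c h f = g := by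
  refine hx.eq_of_eval_eq fun s h1 h2 h3 => ?_
  rw [hx.eval_qHyp h f h1 h2 h3, hf, hf, hf, hg, hx.z_add_one, hx.z_sub_one]
  exact hFG _ (hx.z_ne s) h1 h2 h3

end IsQLattice
end

/-! ### Askey–Wilson polynomials as eigenfunctions. -/

noncomputable section

open LatticeParams

/-- The coefficients of the polynomial `∏ i, (u i - v i z)`. -/
def linProd (u v : Fin 4 → ℂ) : Fin 5 → ℂ :=
  ![u 0 * u 1 * u 2 * u 3,
    -(v 0 * u 1 * u 2 * u 3 + u 0 * v 1 * u 2 * u 3 + u 0 * u 1 * v 2 * u 3 + u 0 * u 1 * u 2 * v 3),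
    v 0 * v 1 * u 2 * u 3 + v 0 * u 1 * v 2 * u 3 + v 0 * u 1 * u 2 * v 3
      + u 0 * v 1 * v 2 * u 3 + u 0 * v 1 * u 2 * v 3 + u 0 * u 1 * v 2 * v 3,
    -(u 0 * v 1 * v 2 * v 3 + v 0 * u 1 * v 2 * v 3 + v 0 * v 1 * u 2 * v 3 + v 0 * v 1 * v 2 * u 3),
    v 0 * v 1 * v 2 * v 3]

theorem quartic_linProd (u v : Fin 4 → ℂ) (w : ℂ) : quartic (linProd u v) w =
    (u 0 - v 0 * w) * (u 1 - v 1 * w) * (u 2 - v 2 * w) * (u 3 - v 3 * w) := by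
  simp only [quartic, linProd, Matrix.cons_val]; ring

/-- The eigenvalues of the Askey--Wilson operator attached to the quartic `h`. -/
def qEig (q : ℂ) (h : Fin 5 → ℂ) (n : ℕ) : ℂ := ((q ^ n)⁻¹ - 1) * (h 0 - h 4 * (q ^ n * q⁻¹))

theorem qShiftedFactorial_succ (q a : ℂ) (j : ℕ) :
    qShiftedFactorial q a (j + 1) = qShiftedFactorial q a j * (1 - a * q ^ j) :=
  Finset.prod_range_succ _ _

theorem qShiftedFactorial_succ' (q a : ℂ) (j : ℕ) :
    qShiftedFactorial q a (j + 1) = (1 - a) * qShiftedFactorial q (a * q) j := by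
  rw [qShiftedFactorial, Finset.prod_range_succ', mul_comm, qShiftedFactorial]
  congr 1
  · simp
  · exact Finset.prod_congr rfl fun i _ => by ring

@[simp] theorem qShiftedFactorial_zero (q a : ℂ) : qShiftedFactorial q a 0 = 1 := rfl

theorem qShiftedFactorial_self_ne {q : ℂ} (hq : ∀ k : ℕ, 0 < k → q ^ k ≠ 1) (n : ℕ) :
    qShiftedFactorial q q n ≠ 0 :=
  Finset.prod_ne_zero_iff.2 fun i _ h => hq (i + 1) i.succ_pos (by rw [pow_succ]; linear_combination -h)

/-- The basis `(a z, a / z; q)_j` in which the Askey--Wilson polynomials are expanded. -/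
def awBasis (q k c a : ℂ) (j : ℕ) : ℂ[X] :=
  ∏ i ∈ Finset.range j, (C (1 + (a * q ^ i) ^ 2) - C (a * q ^ i) * qVar k c)

theorem natDegree_awBasis_le (q k c a : ℂ) (j : ℕ) : (awBasis q k c a j).natDegree ≤ j := by
  refine (natDegree_prod_le _ _).trans ((Finset.sum_le_card_nsmul _ _ 1 fun i _ => ?_).trans (by simp))
  exact (natDegree_sub_le _ _).trans (max_le ((natDegree_C _).le.trans (by omega))
    ((natDegree_C_mul_le _ _).trans (natDegree_qVar_le k c)))

theorem coeff_awBasis (q k c a : ℂ) (j : ℕ) :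
    (awBasis q k c a j).coeff j = ∏ i ∈ Finset.range j, -(a * q ^ i * k⁻¹) := by
  induction j with
  | zero => simp [awBasis]
  | succ j ih =>
    have hd : (C (1 + (a * q ^ j) ^ 2) - C (a * q ^ j) * qVar k c).natDegree ≤ 1 :=
      (natDegree_sub_le _ _).trans (max_le ((natDegree_C _).le.trans (by omega))
        ((natDegree_C_mul_le _ _).trans (natDegree_qVar_le k c)))
    have h := coeff_mul_add_eq_of_natDegree_le (natDegree_awBasis_le q k c a j) hd
    rw [awBasis, Finset.prod_range_succ, ← awBasis, h, ih, Finset.prod_range_succ]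
    congr 1
    rw [coeff_sub, coeff_C_mul, coeff_C_succ, qVar, coeff_C_mul]
    simp

/-- The coefficients of the Askey--Wilson polynomials in the basis `(a z, a / z; q)_j`. -/
def awCoeff (q : ℂ) (n : ℕ) (a b c d : ℂ) (j : ℕ) : ℂ :=
  qShiftedFactorial q (q ^ n)⁻¹ j * qShiftedFactorial q (a * b * c * d * (q ^ n * q⁻¹)) j *
    qShiftedFactorial q (a * b * q ^ j) (n - j) * qShiftedFactorial q (a * c * q ^ j) (n - j) *
    qShiftedFactorial q (a * d * q ^ j) (n - j) * q ^ j / qShiftedFactorial q q j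

/-- The Askey--Wilson polynomials as polynomials on the lattice `k (z + z⁻¹) + e`. -/
def awPoly (q k e : ℂ) (n : ℕ) (a b c d : ℂ) : ℂ[X] :=
  C (a ^ n)⁻¹ * ∑ j ∈ Finset.range (n + 1), C (awCoeff q n a b c d j) * awBasis q k e a j

/-- The recursion demanded by `map_sum_eq_of_bidiagonal`. In this undivided form it remains valid
when ab, ac or ad is a nonpositive power of q. -/
theorem awCoeff_succ_mul {q : ℂ} (hq0 : q ≠ 0) (hq : ∀ k : ℕ, 0 < k → q ^ k ≠ 1) (a b c d : ℂ)
    {n j : ℕ} (hj : j < n) :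
    awCoeff q n a b c d (j + 1) * (-((1 - q ^ (j + 1)) * (q ^ (j + 1))⁻¹ *
      ((1 - a * b * q ^ j) * (1 - a * c * q ^ j) * (1 - a * d * q ^ j)))) =
    (qEig q (linProd 1 ![a, b, c, d]) n - qEig q (linProd 1 ![a, b, c, d]) j) *
      awCoeff q n a b c d j := by
  obtain ⟨m, rfl⟩ : ∃ m, n = j + (m + 1) := ⟨n - j - 1, by omega⟩
  have h1 := qShiftedFactorial_self_ne hq j
  have h2 : 1 - q * q ^ j ≠ 0 := fun h => hq (j + 1) j.succ_pos (by rw [pow_succ]; linear_combination -h)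
  rw [awCoeff, awCoeff, show j + (m + 1) - (j + 1) = m by omega, Nat.add_sub_cancel_left]
  simp only [qShiftedFactorial_succ' q (_ * q ^ j) m, qShiftedFactorial_succ q _ j]
  simp only [qEig, linProd, Matrix.cons_val, Pi.one_apply]
  rw [show ∀ t : ℂ, t * q ^ j * q = t * q ^ (j + 1) from fun t => by ring]
  rw [show ∀ t : ℂ, t * q ^ j * q = t * q ^ (j + 1) from fun t => by ring]
  rw [show ∀ t : ℂ, t * q ^ j * q = t * q ^ (j + 1) from fun t => by ring]
  generalize qShiftedFactorial q q j = D at *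
  generalize qShiftedFactorial q (a * b * q ^ (j + 1)) m = B1
  generalize qShiftedFactorial q (a * c * q ^ (j + 1)) m = B2
  generalize qShiftedFactorial q (a * d * q ^ (j + 1)) m = B3
  generalize qShiftedFactorial q (q ^ (j + (m + 1)))⁻¹ j = B4
  generalize qShiftedFactorial q (a * b * c * d * (q ^ (j + (m + 1)) * q⁻¹)) j = B5
  have hN : q ^ (j + (m + 1)) ≠ 0 := pow_ne_zero _ hq0
  generalize q ^ (j + (m + 1)) = N at *
  rw [pow_succ' q j]
  have hQ : q ^ j ≠ 0 := pow_ne_zero _ hq0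
  generalize q ^ j = Q at *
  rw [div_mul_eq_mul_div, mul_div_assoc', div_eq_div_iff (mul_ne_zero h1 (by rwa [mul_comm] at h2 ⊢)) h1]
  field_simp
  ring

theorem natDegree_awPoly_le (q k e : ℂ) (n : ℕ) (a b c d : ℂ) :
    (awPoly q k e n a b c d).natDegree ≤ n := by
  refine (natDegree_C_mul_le _ _).trans (natDegree_sum_le_of_forall_le _ _ fun j hj => ?_)
  exact (natDegree_C_mul_le _ _).trans
    ((natDegree_awBasis_le _ _ _ _ _).trans (Nat.lt_succ_iff.1 (Finset.mem_range.1 hj)))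

theorem coeff_awPoly (q k e : ℂ) (n : ℕ) (a b c d : ℂ) : (awPoly q k e n a b c d).coeff n =
    (a ^ n)⁻¹ * (awCoeff q n a b c d n * ∏ i ∈ Finset.range n, -(a * q ^ i * k⁻¹)) := by
  rw [awPoly, coeff_C_mul, finsetSum_coeff, Finset.sum_range_succ, Finset.sum_eq_zero, zero_add,
    coeff_C_mul, coeff_awBasis]
  intro j hj
  rw [coeff_C_mul, coeff_eq_zero_of_natDegree_lt, mul_zero]
  exact (natDegree_awBasis_le _ _ _ _ _).trans_lt (Finset.mem_range.1 hj)

/-- The hypothesis is admissibility of the quartic ∏(1 - a_i z), for which h₀ = 1 and h₄ = abcd. -/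
theorem coeff_awPoly_ne_zero {q k : ℂ} (hq0 : q ≠ 0) (hq : ∀ k : ℕ, 0 < k → q ^ k ≠ 1) (hk : k ≠ 0)
    (e : ℂ) (n : ℕ) {a b c d : ℂ} (ha : a ≠ 0) (h : ∀ m < 2 * n, 1 - a * b * c * d * q ^ m ≠ 0) :
    (awPoly q k e n a b c d).coeff n ≠ 0 := by
  rw [coeff_awPoly, awCoeff, Nat.sub_self]
  simp only [qShiftedFactorial_zero, mul_one]
  refine mul_ne_zero (inv_ne_zero (pow_ne_zero _ ha)) (mul_ne_zero (div_ne_zero (mul_ne_zero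
    (mul_ne_zero ?_ ?_) (pow_ne_zero _ hq0)) (qShiftedFactorial_self_ne hq n)) ?_)
  · refine Finset.prod_ne_zero_iff.2 fun i hi h0 => ?_
    have hi := Finset.mem_range.1 hi
    apply hq (n - i) (by omega)
    have : q ^ n = q ^ (n - i) * q ^ i := by rw [← pow_add, Nat.sub_add_cancel hi.le]
    have hi0 : q ^ i ≠ 0 := pow_ne_zero _ hq0
    have hn0 : q ^ n ≠ 0 := pow_ne_zero _ hq0
    have h1 : q ^ n = q ^ i := by
      rw [sub_eq_zero] at h0
      field_simp at h0
      exact h0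
    rw [this] at h1
    exact mul_right_cancel₀ hi0 (by rw [h1, one_mul])
  · refine Finset.prod_ne_zero_iff.2 fun i hi => ?_
    have hi := Finset.mem_range.1 hi
    convert h (n - 1 + i) (by omega) using 2
    obtain ⟨m, rfl⟩ : ∃ m, n = m + 1 := ⟨n - 1, by omega⟩
    rw [pow_succ, mul_inv_cancel_right₀ hq0, Nat.add_sub_cancel, pow_add]; ring
  · exact Finset.prod_ne_zero_iff.2 fun i _ =>
      neg_ne_zero.2 (mul_ne_zero (mul_ne_zero ha (pow_ne_zero _ hq0)) (inv_ne_zero hk))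

namespace IsQLattice

variable {p k e : ℂ} {x z : ℂ → ℂ}

theorem eval_awBasis (hx : IsQLattice p k e x z) (a : ℂ) (j : ℕ) (s : ℂ) :
    (awBasis (p ^ 2) k e a j).eval (x s) =
      qShiftedFactorial (p ^ 2) (a * (z s)⁻¹) j * qShiftedFactorial (p ^ 2) (a * z s) j := by
  rw [awBasis, eval_prod, qShiftedFactorial, qShiftedFactorial, ← Finset.prod_mul_distrib]
  refine Finset.prod_congr rfl fun i _ => ?_
  rw [eval_sub, eval_C, eval_mul, eval_C, hx.eval_qVar]
  have := mul_inv_cancel₀ (hx.z_ne s)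
  linear_combination -(a * (p ^ 2) ^ i) ^ 2 * this

theorem eval_awPoly (hx : IsQLattice p k e x z) (n : ℕ) (a b c d : ℂ) (s : ℂ) :
    (awPoly (p ^ 2) k e n a b c d).eval (x s) = askeyWilson (p ^ 2) n a b c d (z s) := by
  rw [awPoly, askeyWilson, eval_mul, eval_C, eval_finsetSum]
  congr 1
  refine Finset.sum_congr rfl fun j _ => ?_
  rw [eval_mul, eval_C, hx.eval_awBasis, awCoeff,
    show ((n : ℤ) - 1) = (n : ℤ) + -1 by ring, zpow_add₀ (pow_ne_zero 2 hx.p_ne), zpow_natCast,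
    zpow_neg_one]
  ring

theorem qHyp_awBasis_zero (p k e : ℂ) (h : Fin 5 → ℂ) (a : ℂ) :
    qHyp p k e h (awBasis (p ^ 2) k e a 0) =
      C (qEig (p ^ 2) h 0) * awBasis (p ^ 2) k e a 0 := by
  simp [awBasis, qHyp, hyp_apply, qEig]

/-- A shift z → q^{±1}z moves only the end factors of (az, a/z; q)_{j+1}, and the quartic supplies
the missing factor 1 - az or 1 - a/z. So (az, a/z; q)_j divides everything, and what remains is an
explicit computation. -/
theorem qHyp_awBasis_succ (hx : IsQLattice p k e x z) (a b c d : ℂ) (j : ℕ) :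
    qHyp p k e (linProd 1 ![a, b, c, d]) (awBasis (p ^ 2) k e a (j + 1)) =
      C (qEig (p ^ 2) (linProd 1 ![a, b, c, d]) (j + 1)) * awBasis (p ^ 2) k e a (j + 1) +
      C (-((1 - (p ^ 2) ^ (j + 1)) * ((p ^ 2) ^ (j + 1))⁻¹ *
        ((1 - a * b * (p ^ 2) ^ j) * (1 - a * c * (p ^ 2) ^ j) * (1 - a * d * (p ^ 2) ^ j)))) *
        awBasis (p ^ 2) k e a j := by
  refine hx.qHyp_eq_of_eval _ _ _
    (fun w => qShiftedFactorial (p ^ 2) (a * w⁻¹) (j + 1) * qShiftedFactorial (p ^ 2) (a * w) (j + 1))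
    (fun w => qEig (p ^ 2) (linProd 1 ![a, b, c, d]) (j + 1) *
      (qShiftedFactorial (p ^ 2) (a * w⁻¹) (j + 1) * qShiftedFactorial (p ^ 2) (a * w) (j + 1)) +
      -((1 - (p ^ 2) ^ (j + 1)) * ((p ^ 2) ^ (j + 1))⁻¹ *
        ((1 - a * b * (p ^ 2) ^ j) * (1 - a * c * (p ^ 2) ^ j) * (1 - a * d * (p ^ 2) ^ j))) *
      (qShiftedFactorial (p ^ 2) (a * w⁻¹) j * qShiftedFactorial (p ^ 2) (a * w) j))
    (fun s => hx.eval_awBasis a _ s)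
    (fun s => by rw [eval_add, eval_mul, eval_mul, hx.eval_awBasis, hx.eval_awBasis, eval_C, eval_C])
    fun w hw h1 h2 h3 => ?_
  have hq : p ^ 2 ≠ 0 := pow_ne_zero 2 hx.p_ne
  generalize p ^ 2 = q at *
  set U := qShiftedFactorial q (a * w⁻¹) j with hU
  set V := qShiftedFactorial q (a * w * q) j with hV
  set U' := qShiftedFactorial q (a * w⁻¹ * q) j with hU'
  set V' := qShiftedFactorial q (a * w) j with hV'
  have r1 : V' * (1 - a * w * q ^ j) = (1 - a * w) * V := by
    rw [hV', ← qShiftedFactorial_succ, qShiftedFactorial_succ']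
  have r2 : U * (1 - a * w⁻¹ * q ^ j) = (1 - a * w⁻¹) * U' := by
    rw [hU, ← qShiftedFactorial_succ, qShiftedFactorial_succ']
  have f0 : qShiftedFactorial q (a * w⁻¹) (j + 1) * qShiftedFactorial q (a * w) (j + 1) =
      U * V' * ((1 - a * w⁻¹ * q ^ j) * (1 - a * w * q ^ j)) := by
    rw [qShiftedFactorial_succ, qShiftedFactorial_succ]; ring
  have f1 : qShiftedFactorial q (a * (q * w)⁻¹) (j + 1) * qShiftedFactorial q (a * (q * w)) (j + 1) =
      U * V * ((1 - a * (q * w)⁻¹) * (1 - a * w * q * q ^ j)) := by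
    rw [show a * (q * w) = a * w * q by ring, qShiftedFactorial_succ', qShiftedFactorial_succ,
      show a * (q * w)⁻¹ * q = a * w⁻¹ by field_simp]
    ring
  have f2 : qShiftedFactorial q (a * (q⁻¹ * w)⁻¹) (j + 1) *
      qShiftedFactorial q (a * (q⁻¹ * w)) (j + 1) =
      U' * V' * ((1 - a * (q⁻¹ * w)) * (1 - a * w⁻¹ * q * q ^ j)) := by
    rw [show a * (q⁻¹ * w)⁻¹ = a * w⁻¹ * q by field_simp, qShiftedFactorial_succ,
      qShiftedFactorial_succ' q (a * (q⁻¹ * w)), show a * (q⁻¹ * w) * q = a * w by field_simp]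
    ring
  have t1 : quartic (linProd 1 ![a, b, c, d]) w *
      (U * V * ((1 - a * (q * w)⁻¹) * (1 - a * w * q * q ^ j)) -
        U * V' * ((1 - a * w⁻¹ * q ^ j) * (1 - a * w * q ^ j))) =
      U * V' * ((1 - a * w * q ^ j) * ((1 - b * w) * (1 - c * w) * (1 - d * w)) *
        ((1 - a * (q * w)⁻¹) * (1 - a * w * q * q ^ j) - (1 - a * w⁻¹ * q ^ j) * (1 - a * w))) := by
    rw [quartic_linProd]
    simp only [Matrix.cons_val, Pi.one_apply]
    linear_combination -(1 - b * w) * (1 - c * w) * (1 - d * w) * U *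
      ((1 - a * (q * w)⁻¹) * (1 - a * w * q * q ^ j)) * r1
  have t2 : quartic (linProd 1 ![a, b, c, d]) w⁻¹ *
      (U' * V' * ((1 - a * (q⁻¹ * w)) * (1 - a * w⁻¹ * q * q ^ j)) -
        U * V' * ((1 - a * w⁻¹ * q ^ j) * (1 - a * w * q ^ j))) =
      U * V' * ((1 - a * w⁻¹ * q ^ j) * ((1 - b * w⁻¹) * (1 - c * w⁻¹) * (1 - d * w⁻¹)) *
        ((1 - a * (q⁻¹ * w)) * (1 - a * w⁻¹ * q * q ^ j) - (1 - a * w * q ^ j) * (1 - a * w⁻¹))) := by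
    rw [quartic_linProd]
    simp only [Matrix.cons_val, Pi.one_apply]
    linear_combination -(1 - b * w⁻¹) * (1 - c * w⁻¹) * (1 - d * w⁻¹) * V' *
      ((1 - a * (q⁻¹ * w)) * (1 - a * w⁻¹ * q * q ^ j)) * r2
  simp only [f0, f1, f2]
  -- The differences contain the factors q w² - 1 and w² - q, which cancel the denominators of the
  -- operator.
  have b1 : (1 - a * (q * w)⁻¹) * (1 - a * w * q * q ^ j) - (1 - a * w⁻¹ * q ^ j) * (1 - a * w) =
      (1 - q * q ^ j) * a / (q * w) * (q * w ^ 2 - 1) := by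
    field_simp; ring
  have b2 : (1 - a * (q⁻¹ * w)) * (1 - a * w⁻¹ * q * q ^ j) - (1 - a * w * q ^ j) * (1 - a * w⁻¹) =
      -((1 - q * q ^ j) * a / (q * w)) * (w ^ 2 - q) := by
    field_simp; ring
  rw [div_mul_eq_mul_div, t1, div_mul_eq_mul_div, mul_right_comm (quartic _ w⁻¹), t2, b1, b2]
  simp only [← mul_assoc]
  rw [mul_div_mul_right _ _ h2, mul_right_comm _ (w ^ 2 - q), mul_div_mul_right _ _ h3]
  simp only [qEig, linProd, Matrix.cons_val, Pi.one_apply]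
  rw [pow_succ' q j]
  have hQ : q ^ j ≠ 0 := pow_ne_zero _ hq
  generalize q ^ j = Q at *
  clear_value U V U' V'
  clear t1 t2 f0 f1 f2 r1 r2 hU hV hU' hV' b1 b2
  field_simp
  ring

/-- The Askey--Wilson polynomials are eigenfunctions of the Askey--Wilson operator. -/
theorem qHyp_awPoly (hx : IsQLattice p k e x z) (n : ℕ) (a b c d : ℂ) :
    qHyp p k e (linProd 1 ![a, b, c, d]) (awPoly (p ^ 2) k e n a b c d) =
      C (qEig (p ^ 2) (linProd 1 ![a, b, c, d]) n) * awPoly (p ^ 2) k e n a b c d := by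
  rw [awPoly, map_C_mul_eq, map_sum_eq_of_bidiagonal _ _ (qEig (p ^ 2) (linProd 1 ![a, b, c, d]))
    _ _ n (qHyp_awBasis_zero p k e _ a) (hx.qHyp_awBasis_succ a b c d)]
  · ring
  · intro j hj
    exact awCoeff_succ_mul (pow_ne_zero 2 hx.p_ne) (fun m hm => hx.pow_ne m hm) a b c d hj

end IsQLattice
end

/-! ### Continuous q-Hermite polynomials as eigenfunctions. -/

noncomputable section

open LatticeParams

/-- The `q`-exponential series `∑ (z X)^n / (q; q)_n`. -/
def qExpSeries (q z : ℂ) : PowerSeries ℂ := PowerSeries.mk fun n => z ^ n / qShiftedFactorial q q n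

/-- The functional equation of 1/(zX; q)_∞, as an identity of formal series; no condition |q| < 1 is
needed. -/
theorem qExpSeries_mul_left {q : ℂ} (hq : ∀ k : ℕ, 0 < k → q ^ k ≠ 1) (z : ℂ) :
    qExpSeries q (q * z) = (1 - PowerSeries.C z * PowerSeries.X) * qExpSeries q z := by
  rw [sub_mul, one_mul, mul_assoc]
  ext n
  rw [map_sub, PowerSeries.coeff_C_mul]
  cases n with
  | zero => simp [qExpSeries]
  | succ n =>
    rw [PowerSeries.coeff_succ_X_mul]
    simp only [qExpSeries, PowerSeries.coeff_mk]
    have h1 := qShiftedFactorial_self_ne hq n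
    have h2 := qShiftedFactorial_self_ne hq (n + 1)
    rw [qShiftedFactorial_succ] at h2 ⊢
    have h3 := right_ne_zero_of_mul h2
    rw [mul_pow]
    generalize qShiftedFactorial q q n = F at *
    rw [pow_succ' q n, pow_succ' z n]
    rw [show z * (z ^ n / F) = z * z ^ n * (1 - q * q ^ n) / (F * (1 - q * q ^ n)) by
      field_simp]
    rw [← sub_div]; congr 1; ring

theorem rescale_qExpSeries (q a z : ℂ) :
    PowerSeries.rescale a (qExpSeries q z) = qExpSeries q (a * z) := by
  ext n
  simp only [qExpSeries, PowerSeries.coeff_rescale, PowerSeries.coeff_mk, mul_pow, mul_div_assoc]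

/-- The generating function of the continuous `q`-Hermite polynomials. -/
def hermSeries (q z : ℂ) : PowerSeries ℂ := qExpSeries q z⁻¹ * qExpSeries q z

theorem coeff_hermSeries {q : ℂ} (hq : ∀ k : ℕ, 0 < k → q ^ k ≠ 1) (z : ℂ) (n : ℕ) :
    continuousQHermite q n z = qShiftedFactorial q q n * PowerSeries.coeff n (hermSeries q z) := by
  rw [hermSeries, PowerSeries.coeff_mul, Finset.Nat.sum_antidiagonal_eq_sum_range_succ_mk,
    continuousQHermite, Finset.mul_sum]
  refine Finset.sum_congr rfl fun k _ => ?_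
  simp only [qExpSeries, PowerSeries.coeff_mk]
  have h1 := qShiftedFactorial_self_ne hq k
  have h2 := qShiftedFactorial_self_ne hq (n - k)
  field_simp

theorem hermSeries_inv (q z : ℂ) : hermSeries q z⁻¹ = hermSeries q z := by
  rw [hermSeries, hermSeries, inv_inv, mul_comm]

/-- Replacing z by qz and X by qX fixes the factor in z⁻¹ and turns z into q²z in the other, so the
functional equation applies twice. -/
theorem coeff_hermSeries_mul_left {q : ℂ} (hq0 : q ≠ 0) (hq : ∀ k : ℕ, 0 < k → q ^ k ≠ 1) {z : ℂ}
    (n : ℕ) :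
    q ^ n * PowerSeries.coeff n (hermSeries q (q * z)) = PowerSeries.coeff n (hermSeries q z)
      - (1 + q) * z * PowerSeries.coeff n (PowerSeries.X * hermSeries q z)
      + q * z ^ 2 * PowerSeries.coeff n (PowerSeries.X ^ 2 * hermSeries q z) := by
  have h : PowerSeries.rescale q (hermSeries q (q * z)) = hermSeries q z
      - PowerSeries.C ((1 + q) * z) * (PowerSeries.X * hermSeries q z)
      + PowerSeries.C (q * z ^ 2) * (PowerSeries.X ^ 2 * hermSeries q z) := by
    simp only [hermSeries]
    rw [map_mul, rescale_qExpSeries, rescale_qExpSeries,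
      show q * (q * z)⁻¹ = z⁻¹ by field_simp, qExpSeries_mul_left hq, qExpSeries_mul_left hq]
    simp only [map_mul, map_add, map_one, map_pow]
    ring
  rw [← PowerSeries.coeff_rescale, h]
  simp only [map_add, map_sub, PowerSeries.coeff_C_mul]

theorem coeff_hermSeries_mul_inv {q : ℂ} (hq0 : q ≠ 0) (hq : ∀ k : ℕ, 0 < k → q ^ k ≠ 1) {z : ℂ}
    (n : ℕ) :
    q ^ n * PowerSeries.coeff n (hermSeries q (q⁻¹ * z)) = PowerSeries.coeff n (hermSeries q z)
      - (1 + q) * z⁻¹ * PowerSeries.coeff n (PowerSeries.X * hermSeries q z)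
      + q * z⁻¹ ^ 2 * PowerSeries.coeff n (PowerSeries.X ^ 2 * hermSeries q z) := by
  rw [← hermSeries_inv q z, ← coeff_hermSeries_mul_left hq0 hq, ← hermSeries_inv, mul_inv, inv_inv]

/-- Replacing X by qX alone moves each of the two factors by one step. -/
theorem coeff_hermSeries_recurrence {q : ℂ} (hq : ∀ k : ℕ, 0 < k → q ^ k ≠ 1) {z : ℂ}
    (hz : z ≠ 0) (n : ℕ) :
    q ^ n * PowerSeries.coeff n (hermSeries q z) = PowerSeries.coeff n (hermSeries q z)
      - (z + z⁻¹) * PowerSeries.coeff n (PowerSeries.X * hermSeries q z)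
      + PowerSeries.coeff n (PowerSeries.X ^ 2 * hermSeries q z) := by
  have h : PowerSeries.rescale q (hermSeries q z) = hermSeries q z
      - PowerSeries.C (z + z⁻¹) * (PowerSeries.X * hermSeries q z)
      + PowerSeries.C (z * z⁻¹) * (PowerSeries.X ^ 2 * hermSeries q z) := by
    simp only [hermSeries]
    rw [map_mul, rescale_qExpSeries, rescale_qExpSeries, qExpSeries_mul_left hq,
      qExpSeries_mul_left hq]
    simp only [map_mul, map_add]
    ring
  rw [← PowerSeries.coeff_rescale, h, mul_inv_cancel₀ hz, map_add, map_sub, PowerSeries.coeff_C_mul,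
    PowerSeries.coeff_C_mul, one_mul]

theorem continuousQHermite_recurrence {q : ℂ} (hq : ∀ k : ℕ, 0 < k → q ^ k ≠ 1) {z : ℂ}
    (hz : z ≠ 0) (n : ℕ) : continuousQHermite q (n + 2) z =
      (z + z⁻¹) * continuousQHermite q (n + 1) z - (1 - q ^ (n + 1)) * continuousQHermite q n z := by
  have h := coeff_hermSeries_recurrence hq hz (n + 2)
  rw [show n + 2 = n + 1 + 1 from rfl, PowerSeries.coeff_succ_X_mul, pow_two, mul_assoc,
    PowerSeries.coeff_succ_X_mul, PowerSeries.coeff_succ_X_mul] at h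
  rw [coeff_hermSeries hq, coeff_hermSeries hq, coeff_hermSeries hq, qShiftedFactorial_succ,
    qShiftedFactorial_succ]
  simp only [pow_succ] at h ⊢
  linear_combination -qShiftedFactorial q q n * (1 - q * q ^ n) * h

/-- The continuous `q`-Hermite polynomials as polynomials on the lattice `k (z + z⁻¹) + e`. -/
def hermPoly (q k e : ℂ) : ℕ → ℂ[X]
  | 0 => 1
  | 1 => qVar k e
  | n + 2 => qVar k e * hermPoly q k e (n + 1) - C (1 - q ^ (n + 1)) * hermPoly q k e n

theorem natDegree_hermPoly_le (q k e : ℂ) (n : ℕ) : (hermPoly q k e n).natDegree ≤ n ∧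
    (hermPoly q k e (n + 1)).natDegree ≤ n + 1 := by
  induction n with
  | zero => exact ⟨by simp [hermPoly], natDegree_qVar_le k e⟩
  | succ n ih =>
    refine ⟨ih.2, (natDegree_sub_le _ _).trans (max_le ?_ ?_)⟩
    · exact natDegree_mul_le.trans ((add_le_add (natDegree_qVar_le k e) ih.2).trans (by omega))
    · exact (natDegree_C_mul_le _ _).trans (ih.1.trans (by omega))

theorem coeff_hermPoly (q k e : ℂ) (n : ℕ) : (hermPoly q k e n).coeff n = k⁻¹ ^ n ∧
    (hermPoly q k e (n + 1)).coeff (n + 1) = k⁻¹ ^ (n + 1) := by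
  induction n with
  | zero => exact ⟨by simp [hermPoly], by simp [hermPoly, qVar]⟩
  | succ n ih =>
    refine ⟨ih.2, ?_⟩
    have h1 := natDegree_hermPoly_le q k e n
    rw [hermPoly, coeff_sub, coeff_C_mul, coeff_eq_zero_of_natDegree_lt (h1.1.trans_lt (by omega)),
      show n + 1 + 1 = 1 + (n + 1) by ring,
      coeff_mul_add_eq_of_natDegree_le (natDegree_qVar_le k e) h1.2, ih.2, qVar]
    simp
    ring

namespace IsQLattice

variable {p k e : ℂ} {x z : ℂ → ℂ}

theorem eval_hermPoly (hx : IsQLattice p k e x z) (n : ℕ) (s : ℂ) :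
    (hermPoly (p ^ 2) k e n).eval (x s) = continuousQHermite (p ^ 2) n (z s) := by
  have hq := hx.pow_ne
  suffices h : (hermPoly (p ^ 2) k e n).eval (x s) = continuousQHermite (p ^ 2) n (z s) ∧
    (hermPoly (p ^ 2) k e (n + 1)).eval (x s) = continuousQHermite (p ^ 2) (n + 1) (z s) from h.1
  induction n with
  | zero =>
    have h1 := qShiftedFactorial_self_ne hq 1
    refine ⟨by simp [hermPoly, continuousQHermite], ?_⟩
    simp [hermPoly, continuousQHermite, hx.eval_qVar, Finset.sum_range_succ, div_self h1]
  | succ n ih =>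
    refine ⟨ih.2, ?_⟩
    rw [hermPoly, continuousQHermite_recurrence hq (hx.z_ne s), eval_sub, eval_mul, eval_mul, ih.1,
      ih.2, eval_C, hx.eval_qVar]

/-- The continuous `q`-Hermite polynomials are eigenfunctions of the Askey--Wilson operator. -/
theorem qHyp_hermPoly (hx : IsQLattice p k e x z) (n : ℕ) :
    qHyp p k e ![1, 0, 0, 0, 0] (hermPoly (p ^ 2) k e n) =
      C (qEig (p ^ 2) ![1, 0, 0, 0, 0] n) * hermPoly (p ^ 2) k e n := by
  refine hx.qHyp_eq_of_eval _ _ _ (fun w => continuousQHermite (p ^ 2) n w)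
    (fun w => qEig (p ^ 2) ![1, 0, 0, 0, 0] n * continuousQHermite (p ^ 2) n w)
    (fun s => hx.eval_hermPoly n s)
    (fun s => by rw [eval_mul, eval_C, hx.eval_hermPoly]) fun w hw h1 h2 h3 => ?_
  have hq0 : p ^ 2 ≠ 0 := pow_ne_zero 2 hx.p_ne
  have hq := hx.pow_ne
  generalize p ^ 2 = q at *
  have e1 := coeff_hermSeries_mul_left hq0 hq (z := w) n
  have e2 := coeff_hermSeries_mul_inv hq0 hq (z := w) n
  have e3 := coeff_hermSeries_recurrence hq hw n
  simp only [coeff_hermSeries hq, qEig, quartic, Matrix.cons_val]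
  generalize PowerSeries.coeff n (hermSeries q (q * w)) = f1 at *
  generalize PowerSeries.coeff n (hermSeries q (q⁻¹ * w)) = f2 at *
  generalize PowerSeries.coeff n (hermSeries q w) = f at *
  generalize PowerSeries.coeff n (PowerSeries.X * hermSeries q w) = u at *
  generalize PowerSeries.coeff n (PowerSeries.X ^ 2 * hermSeries q w) = v at *
  have hN : q ^ n ≠ 0 := pow_ne_zero n hq0
  generalize q ^ n = N at *
  -- Subtracting the recurrence from the shift formula exposes the factor q w² - 1 of the
  -- denominator; `g2` does the same for the backward shift.
  have g1 : f1 - f = N⁻¹ * ((v - u / w) * (q * w ^ 2 - 1)) := by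
    rw [eq_inv_mul_iff_mul_eq₀ hN]
    field_simp
    field_simp at e3
    linear_combination w * e1 - e3
  have g2 : f2 - f = N⁻¹ * ((v - u * w) * (q - w ^ 2) / w ^ 2) := by
    rw [eq_inv_mul_iff_mul_eq₀ hN]
    field_simp
    field_simp at e2 e3
    linear_combination e2 - w * e3
  generalize qShiftedFactorial q q n = F
  have t1 : F * (N⁻¹ * ((v - u / w) * (q * w ^ 2 - 1))) / ((w ^ 2 - 1) * (q * w ^ 2 - 1)) =
      F * N⁻¹ * (v - u / w) / (w ^ 2 - 1) := by
    rw [← mul_assoc, ← mul_assoc, mul_div_mul_right _ _ h2]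
  have t2 : w ^ 4 * (F * (N⁻¹ * ((v - u * w) * (q - w ^ 2) / w ^ 2))) / ((w ^ 2 - 1) * (w ^ 2 - q)) =
      -(F * N⁻¹ * (v - u * w) * w ^ 2) / (w ^ 2 - 1) := by
    rw [← mul_div_mul_right (-(F * N⁻¹ * (v - u * w) * w ^ 2)) _ h3]
    congr 1; field_simp; ring
  simp only [zero_mul, add_zero, sub_zero, mul_one, one_mul]
  rw [← mul_sub, ← mul_sub, g1, g2, div_mul_eq_mul_div, div_mul_eq_mul_div, one_mul, t1, t2,
    ← add_div, div_eq_iff h1]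
  field_simp
  field_simp at e3
  linear_combination F * (w ^ 2 - 1) * e3

end IsQLattice
end

/-! ### Factorisation of quartics and continuity of eigenfunctions. -/

noncomputable section

open LatticeParams

/-- The polynomial with coefficients `h`. -/
def quarticPoly (h : Fin 5 → ℂ) : ℂ[X] :=
  C (h 0) + C (h 1) * X + C (h 2) * X ^ 2 + C (h 3) * X ^ 3 + C (h 4) * X ^ 4

theorem eval_quarticPoly (h : Fin 5 → ℂ) (w : ℂ) : (quarticPoly h).eval w = quartic h w := by
  simp [quarticPoly, quartic]

theorem natDegree_quarticPoly_le (h : Fin 5 → ℂ) : (quarticPoly h).natDegree ≤ 4 := by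
  rw [quarticPoly]; compute_degree

theorem coeff_quarticPoly (h : Fin 5 → ℂ) (i : Fin 5) : (quarticPoly h).coeff i = h i := by
  fin_cases i <;> simp [quarticPoly, coeff_X, coeff_C, coeff_X_pow]

theorem quartic_ext {h h' : Fin 5 → ℂ} (H : ∀ w, quartic h w = quartic h' w) : h = h' := by
  funext i
  have : quarticPoly h = quarticPoly h' :=
    Polynomial.funext fun w => by rw [eval_quarticPoly, eval_quarticPoly, H]
  rw [← coeff_quarticPoly h, this, coeff_quarticPoly]

theorem quartic_smul (c : ℂ) (h : Fin 5 → ℂ) (w : ℂ) : quartic (c • h) w = c * quartic h w := by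
  simp only [quartic, Pi.smul_apply, smul_eq_mul]; ring

/-- Here v is the inverse of a root, and v = 0 is used only when f is constant. Hence the first
parameter split off a nonconstant quartic is nonzero. -/
theorem exists_eq_one_sub_mul {f : ℂ[X]} {n : ℕ} (hf : f.natDegree ≤ n + 1) (h0 : f.eval 0 ≠ 0) :
    ∃ (v : ℂ) (g : ℂ[X]), f = (1 - C v * X) * g ∧ g.natDegree ≤ n ∧ g.eval 0 ≠ 0 ∧
      (v = 0 → f.natDegree = 0) := by
  by_cases hd : f.natDegree = 0
  · exact ⟨0, f, by simp, by omega, h0, fun _ => hd⟩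
  · have hf0 : f ≠ 0 := by rintro rfl; simp at hd
    obtain ⟨r, hr⟩ := IsAlgClosed.exists_root f fun h => hd (natDegree_eq_of_degree_eq_some h)
    have hr0 : r ≠ 0 := by rintro rfl; exact h0 hr
    obtain ⟨g, rfl⟩ := dvd_iff_isRoot.2 hr
    have hg : g ≠ 0 := right_ne_zero_of_mul hf0
    refine ⟨r⁻¹, C (-r) * g, ?_, (natDegree_C_mul_le _ _).trans ?_, ?_, fun h => ?_⟩
    · have : C r⁻¹ * C r = 1 := by rw [← C_mul, inv_mul_cancel₀ hr0, C_1]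
      rw [C_neg]; linear_combination (-X * g) * this
    · rw [natDegree_mul (X_sub_C_ne_zero r) hg, natDegree_X_sub_C] at hf; omega
    · rw [eval_mul, eval_C]
      exact mul_ne_zero (neg_ne_zero.2 hr0) fun h => h0 (by rw [eval_mul, h, mul_zero])
    · exact absurd h (inv_ne_zero hr0)

theorem eq_smul_linProd_of_ne_zero {h : Fin 5 → ℂ} (h0 : h 0 ≠ 0) :
    (∃ a b c d : ℂ, a ≠ 0 ∧ h = h 0 • linProd 1 ![a, b, c, d]) ∨
      h = h 0 • ![1, 0, 0, 0, 0] := by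
  have e0 : (quarticPoly h).eval 0 = h 0 := by simp [quarticPoly]
  obtain ⟨a, g, hg, hgd, hg0, ha⟩ := exists_eq_one_sub_mul (natDegree_quarticPoly_le h)
    (by rwa [e0])
  by_cases ha0 : a = 0
  · right
    have := eq_C_of_natDegree_eq_zero (ha ha0)
    refine quartic_ext fun w => ?_
    rw [quartic_smul, ← eval_quarticPoly, this, eval_C]
    have := coeff_quarticPoly h 0
    simp [quartic] at this ⊢
    exact this
  · left
    obtain ⟨b, g₁, rfl, hgd₁, hg0₁, -⟩ := exists_eq_one_sub_mul hgd hg0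
    obtain ⟨c, g₂, rfl, hgd₂, hg0₂, -⟩ := exists_eq_one_sub_mul hgd₁ hg0₁
    obtain ⟨d, g₃, rfl, hgd₃, hg0₃, -⟩ := exists_eq_one_sub_mul hgd₂ hg0₂
    obtain ⟨y, rfl⟩ : ∃ y, g₃ = C y := ⟨_, eq_C_of_natDegree_le_zero hgd₃⟩
    have hy : h 0 = y := by rw [← e0, hg]; simp
    refine ⟨a, b, c, d, ha0, quartic_ext fun w => ?_⟩
    rw [quartic_smul, ← eval_quarticPoly, hg, quartic_linProd, hy]
    simp only [eval_mul, eval_sub, eval_C, eval_X, eval_one, Matrix.cons_val, Pi.one_apply]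
    ring

theorem exists_eq_sub_mul {f : ℂ[X]} {n : ℕ} (hf : f.natDegree = n + 1) {r : ℂ} (hr : f.IsRoot r) :
    ∃ g : ℂ[X], f = (C r - X) * g ∧ g.natDegree = n := by
  have hf0 : f ≠ 0 := by rintro rfl; simp at hf
  obtain ⟨g, rfl⟩ := dvd_iff_isRoot.2 hr
  refine ⟨-g, by ring, ?_⟩
  rw [natDegree_mul (X_sub_C_ne_zero r) (right_ne_zero_of_mul hf0), natDegree_X_sub_C] at hf
  rw [natDegree_neg]; omega

theorem exists_isRoot_of_natDegree {f : ℂ[X]} {n : ℕ} (hf : f.natDegree = n + 1) :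
    ∃ r, f.IsRoot r :=
  IsAlgClosed.exists_root f fun h => by
    have := natDegree_eq_of_degree_eq_some (n := 0) h
    omega

theorem eq_smul_linProd_of_isRoot {h : Fin 5 → ℂ} (h4 : h 4 ≠ 0) {r : ℂ} (hr : quartic h r = 0) :
    ∃ b c d : ℂ, h = h 4 • linProd ![r, b, c, d] 1 := by
  have hd : (quarticPoly h).natDegree = 4 := (natDegree_quarticPoly_le h).antisymm
    (le_natDegree_of_ne_zero (by rwa [show (4 : ℕ) = (4 : Fin 5) from rfl, coeff_quarticPoly]))
  obtain ⟨g, hg, hgd⟩ := exists_eq_sub_mul hd (r := r) (by rw [IsRoot, eval_quarticPoly, hr])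
  obtain ⟨b, hb⟩ := exists_isRoot_of_natDegree hgd
  obtain ⟨g₁, rfl, hgd₁⟩ := exists_eq_sub_mul hgd hb
  obtain ⟨c, hc⟩ := exists_isRoot_of_natDegree hgd₁
  obtain ⟨g₂, rfl, hgd₂⟩ := exists_eq_sub_mul hgd₁ hc
  obtain ⟨d, hd⟩ := exists_isRoot_of_natDegree hgd₂
  obtain ⟨g₃, rfl, hgd₃⟩ := exists_eq_sub_mul hgd₂ hd
  obtain ⟨y, rfl⟩ : ∃ y, g₃ = C y := ⟨_, eq_C_of_natDegree_eq_zero hgd₃⟩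
  have key : h = y • linProd ![r, b, c, d] 1 := quartic_ext fun w => by
    rw [quartic_smul, ← eval_quarticPoly, hg, quartic_linProd]
    simp only [eval_mul, eval_sub, eval_C, eval_X, Matrix.cons_val, Pi.one_apply]
    ring
  have hy : h 4 = y := by rw [key]; simp [linProd]
  exact ⟨b, c, d, by rw [hy]; exact key⟩

theorem linProd_ne_zero {u v : Fin 4 → ℂ} (h : ∀ i, u i ≠ 0 ∨ v i ≠ 0) : linProd u v ≠ 0 := by
  intro h0
  have h1 : (C (u 0) - C (v 0) * X) * (C (u 1) - C (v 1) * X) * (C (u 2) - C (v 2) * X) *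
      (C (u 3) - C (v 3) * X) = 0 := Polynomial.funext fun w => by
    have := quartic_linProd u v w
    rw [h0] at this
    simp only [eval_mul, eval_sub, eval_C, eval_X, ← this]
    simp [quartic]
  have h2 : ∀ i, C (u i) - C (v i) * X ≠ 0 := fun i hi => by
    have e0 := congrArg (fun f => coeff f 0) hi
    have e1 := congrArg (fun f => coeff f 1) hi
    simp at e0 e1
    exact (h i).elim (fun h => h e0) fun h => h e1
  exact mul_ne_zero (mul_ne_zero (mul_ne_zero (h2 0) (h2 1)) (h2 2)) (h2 3) h1

theorem tendsto_linProd {α : Type*} {F : Filter α} {u v : α → Fin 4 → ℂ} {u₀ v₀ : Fin 4 → ℂ}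
    (hu : ∀ i, Tendsto (fun t => u t i) F (𝓝 (u₀ i))) (hv : ∀ i, Tendsto (fun t => v t i) F (𝓝 (v₀ i)))
    (i : Fin 5) : Tendsto (fun t => linProd (u t) (v t) i) F (𝓝 (linProd u₀ v₀ i)) := by
  have h0 := hu 0
  have h1 := hu 1
  have h2 := hu 2
  have h3 := hu 3
  have k0 := hv 0
  have k1 := hv 1
  have k2 := hv 2
  have k3 := hv 3
  simp only [linProd]
  generalize u₀ 0 = a0 at *
  generalize u₀ 1 = a1 at *
  generalize u₀ 2 = a2 at *
  generalize u₀ 3 = a3 at *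
  generalize v₀ 0 = b0 at *
  generalize v₀ 1 = b1 at *
  generalize v₀ 2 = b2 at *
  generalize v₀ 3 = b3 at *
  clear hu hv
  revert i
  simp only [Fin.forall_fin_succ, Matrix.cons_val_zero, Matrix.cons_val_succ, IsEmpty.forall_iff,
    and_true]
  refine ⟨((h0.mul h1).mul h2).mul h3, (((((k0.mul h1).mul h2).mul h3).add
    (((h0.mul k1).mul h2).mul h3)).add (((h0.mul h1).mul k2).mul h3) |>.add
      (((h0.mul h1).mul h2).mul k3)).neg, (((((k0.mul k1).mul h2).mul h3).add
    (((k0.mul h1).mul k2).mul h3)).add (((k0.mul h1).mul h2).mul k3) |>.add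
      (((h0.mul k1).mul k2).mul h3) |>.add (((h0.mul k1).mul h2).mul k3) |>.add
        (((h0.mul h1).mul k2).mul k3)), (((((h0.mul k1).mul k2).mul k3).add
    (((k0.mul h1).mul k2).mul k3)).add (((k0.mul k1).mul h2).mul k3) |>.add
      (((k0.mul k1).mul k2).mul h3)).neg, ((k0.mul k1).mul k2).mul k3⟩

theorem tendsto_quartic {α : Type*} {F : Filter α} {h : α → Fin 5 → ℂ} {h₀ : Fin 5 → ℂ}
    (hh : ∀ i, Tendsto (fun t => h t i) F (𝓝 (h₀ i))) (w : ℂ) :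
    Tendsto (fun t => quartic (h t) w) F (𝓝 (quartic h₀ w)) := by
  have hc : Continuous fun h : Fin 5 → ℂ => quartic h w := by
    simp only [quartic]; fun_prop
  exact (hc.tendsto h₀).comp (tendsto_pi_nhds.2 hh)

/-- Eigenfunctions of triangular operators depend continuously on the operator. -/
theorem tendsto_coeff_of_eigen {α : Type*} {F : Filter α} {T : α → ℂ[X] →ₗ[ℂ] ℂ[X]}
    {T₀ : ℂ[X] →ₗ[ℂ] ℂ[X]} (hT : ∀ t j k, k < j → (T t (X ^ k)).coeff j = 0)
    (hT₀ : ∀ j k, k < j → (T₀ (X ^ k)).coeff j = 0)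
    (hlim : ∀ j k, Tendsto (fun t => (T t (X ^ k)).coeff j) F (𝓝 ((T₀ (X ^ k)).coeff j)))
    {n : ℕ} (hne : ∀ j < n, (T₀ (X ^ n)).coeff n ≠ (T₀ (X ^ j)).coeff j)
    {f : α → ℂ[X]} {g : ℂ[X]} {l : α → ℂ} {l₀ : ℂ} (hf : ∀ t, (f t).natDegree ≤ n)
    (hg : g.natDegree ≤ n) (hgn : g.coeff n ≠ 0) (hfn : ∀ᶠ t in F, (f t).coeff n = g.coeff n)
    (hTf : ∀ᶠ t in F, T t (f t) = C (l t) * f t) (hTg : T₀ g = C l₀ * g) (j : ℕ) :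
    Tendsto (fun t => (f t).coeff j) F (𝓝 (g.coeff j)) := by
  -- Comparing coefficients of X^j determines f_j from the higher ones, up to division by a
  -- difference of diagonal entries that is nonzero in the limit.
  have key : ∀ (T : ℂ[X] →ₗ[ℂ] ℂ[X]) (f : ℂ[X]) (l : ℂ),
      (∀ j k, k < j → (T (X ^ k)).coeff j = 0) → f.natDegree ≤ n → f.coeff n ≠ 0 → T f = C l * f →
      ∀ j < n, f.coeff j * ((T (X ^ n)).coeff n - (T (X ^ j)).coeff j) =
        ∑ k ∈ Finset.Ico (j + 1) (n + 1), f.coeff k * (T (X ^ k)).coeff j := by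
    intro T f l hT hf hfn hTf
    have hex : ∀ j ≤ n, l * f.coeff j = f.coeff j * (T (X ^ j)).coeff j +
        ∑ k ∈ Finset.Ico (j + 1) (n + 1), f.coeff k * (T (X ^ k)).coeff j := by
      intro j hj
      have h1 := congrArg (fun g => coeff g j) hTf
      simp only [coeff_C_mul] at h1
      rw [← h1]
      conv_lhs => rw [f.as_sum_range_C_mul_X_pow' (Nat.lt_succ_iff.2 hf)]
      rw [map_sum, finsetSum_coeff, Finset.range_eq_Ico,
        ← Finset.sum_Ico_consecutive _ (Nat.zero_le j) (hj.trans n.le_succ), Finset.sum_eq_zero,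
        zero_add, Finset.sum_eq_sum_Ico_succ_bot (Nat.lt_succ_of_le hj), map_C_mul_eq, coeff_C_mul]
      · simp only [map_C_mul_eq, coeff_C_mul]
      · intro k hk
        rw [map_C_mul_eq, coeff_C_mul, hT _ _ (Finset.mem_Ico.1 hk).2, mul_zero]
    intro j hj
    have h1 := hex n le_rfl
    rw [Finset.Ico_self, Finset.sum_empty, add_zero, mul_comm] at h1
    rw [← mul_left_cancel₀ hfn h1, mul_sub]
    linear_combination hex j hj.le
  suffices H : ∀ i j, n ≤ j + i → Tendsto (fun t => (f t).coeff j) F (𝓝 (g.coeff j)) from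
    H n j (by omega)
  intro i
  induction i with
  | zero =>
    intro j hj
    rcases (show n ≤ j from hj).eq_or_lt with rfl | hj
    · exact tendsto_const_nhds.congr' (hfn.mono fun t ht => ht.symm)
    · rw [coeff_eq_zero_of_natDegree_lt (hg.trans_lt hj)]
      exact tendsto_const_nhds.congr fun t =>
        (coeff_eq_zero_of_natDegree_lt ((hf t).trans_lt hj)).symm
  | succ i ih =>
    intro j hj
    by_cases hjn : n ≤ j
    · exact ih j (by omega)
    push Not at hjn
    have hd : (T₀ (X ^ n)).coeff n - (T₀ (X ^ j)).coeff j ≠ 0 := sub_ne_zero.2 (hne j hjn)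
    have hdt := (hlim n n).sub (hlim j j)
    have e0 := key T₀ g l₀ hT₀ hg hgn hTg j hjn
    rw [← eq_div_iff hd] at e0
    rw [e0]
    refine ((tendsto_finsetSum _ fun k hk => (ih k ?_).mul (hlim j k)).div hdt hd).congr' ?_
    · have := Finset.mem_Ico.1 hk; omega
    · filter_upwards [hfn, hTf, hdt.eventually_ne hd] with t h1 h2 h3
      have := key (T t) (f t) (l t) (hT t) (hf t) (by rwa [h1]) h2 j hjn
      rw [Pi.div_apply, eq_comm, eq_div_iff h3]
      exact this
end

/-! ### The families on a q-quadratic lattice. -/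

noncomputable section

open LatticeParams

theorem paramFilter_neBot (A : OnePoint ℂ) : (paramFilter A).NeBot := by
  induction A using OnePoint.rec with
  | infty => exact inferInstanceAs (Bornology.cobounded ℂ).NeBot
  | coe a => exact inferInstanceAs (pure a : Filter ℂ).NeBot

/-- A root r of the quartic stands for the parameter 1/r, which is infinity when r = 0. -/
theorem exists_paramFilter_inv (r : ℂ) : ∃ A : OnePoint ℂ, A ≠ ((0 : ℂ) : OnePoint ℂ) ∧
    (r = 0 → A = OnePoint.infty) ∧ Tendsto (fun t : ℂ => t⁻¹) (paramFilter A) (𝓝 r) ∧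
    ∀ᶠ t in paramFilter A, t ≠ 0 := by
  by_cases hr : r = 0
  · subst hr
    exact ⟨OnePoint.infty, OnePoint.infty_ne_coe 0, fun _ => rfl, tendsto_inv₀_cobounded,
      Bornology.eventually_ne_cobounded 0⟩
  · refine ⟨((r⁻¹ : ℂ) : OnePoint ℂ), fun h => inv_ne_zero hr (OnePoint.coe_injective h),
      fun h => absurd h hr, ?_, ?_⟩
    · have := tendsto_pure_nhds (fun t : ℂ => t⁻¹) r⁻¹
      rwa [inv_inv] at this
    · exact eventually_pure.2 (inv_ne_zero hr)

/-- Each factor 1 - tz is rescaled to u - vz so that it keeps a nonzero limit even as t tends to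
infinity, where u = t⁻¹ and v = 1. -/
theorem exists_paramFilter_normalization (A : OnePoint ℂ) : ∃ (u v : ℂ → ℂ) (u₀ v₀ : ℂ),
    Tendsto u (paramFilter A) (𝓝 u₀) ∧ Tendsto v (paramFilter A) (𝓝 v₀) ∧ (u₀ ≠ 0 ∨ v₀ ≠ 0) ∧
    ∀ᶠ t in paramFilter A, v t = u t * t := by
  induction A using OnePoint.rec with
  | infty =>
    refine ⟨fun t => t⁻¹, fun _ => 1, 0, 1, tendsto_inv₀_cobounded, tendsto_const_nhds,
      Or.inr one_ne_zero, ?_⟩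
    filter_upwards [Bornology.eventually_ne_cobounded (0 : ℂ)] with t ht
    rw [inv_mul_cancel₀ ht]
  | coe a =>
    exact ⟨fun _ => 1, id, 1, a, tendsto_const_nhds, tendsto_pure_nhds id a, Or.inl one_ne_zero,
      Eventually.of_forall fun t => (one_mul t).symm⟩

theorem linProd_eq_smul {u v a : Fin 4 → ℂ} (h : ∀ i, v i = u i * a i) :
    linProd u v = (u 0 * u 1 * u 2 * u 3) • linProd 1 a :=
  quartic_ext fun w => by
    rw [quartic_smul, quartic_linProd, quartic_linProd, h, h, h, h]
    simp only [Pi.one_apply]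
    ring

theorem qEig_smul (q c : ℂ) (h : Fin 5 → ℂ) (n : ℕ) : qEig q (c • h) n = c * qEig q h n := by
  simp only [qEig, Pi.smul_apply, smul_eq_mul]; ring

theorem tendsto_qEig {α : Type*} {F : Filter α} {h : α → Fin 5 → ℂ} {h₀ : Fin 5 → ℂ}
    (hh : ∀ i, Tendsto (fun t => h t i) F (𝓝 (h₀ i))) (q : ℂ) (n : ℕ) :
    Tendsto (fun t => qEig q (h t) n) F (𝓝 (qEig q h₀ n)) :=
  ((hh 0).sub ((hh 4).mul_const _)).const_mul _

theorem qHyp_smul (p k e c : ℂ) (h : Fin 5 → ℂ) (f : ℂ[X]) :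
    qHyp p k e (c • h) f = C c * qHyp p k e h f := by
  rw [qHyp_eq_sum, qHyp_eq_sum p k e h, Finset.mul_sum]
  refine Finset.sum_congr rfl fun i _ => ?_
  rw [Pi.smul_apply, smul_eq_mul, C_mul, mul_assoc]

theorem tendsto_coeff_qHyp {α : Type*} {F : Filter α} {h : α → Fin 5 → ℂ} {h₀ : Fin 5 → ℂ}
    (hh : ∀ i, Tendsto (fun t => h t i) F (𝓝 (h₀ i))) (p k e : ℂ) (f : ℂ[X]) (j : ℕ) :
    Tendsto (fun t => (qHyp p k e (h t) f).coeff j) F (𝓝 ((qHyp p k e h₀ f).coeff j)) := by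
  have : ∀ h, (qHyp p k e h f).coeff j =
      ∑ i, h i * (qHyp p k e (Pi.single i 1) f).coeff j := fun h => by
    rw [qHyp_eq_sum, finsetSum_coeff]
    simp only [coeff_C_mul]
  rw [this h₀]
  exact (tendsto_finsetSum _ fun i _ => (hh i).mul_const _).congr fun t => (this (h t)).symm

namespace IsQLattice

variable {p k e : ℂ} {x z : ℂ → ℂ} {L : ℂ[X] →ₗ[ℂ] ℂ} {P : ℕ → ℂ[X]}

theorem eq_zero_of_qφ_eq_zero (hx : IsQLattice p k e x z) {h : Fin 5 → ℂ} (hφ : qφ p k e h = 0)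
    (hψ : qψ p k e h = 0) : h = 0 := by
  have hp := hx.p_ne
  have hk := hx.k_ne
  have hp1 := hx.sq_ne_one
  have hφ' := (mul_eq_zero.1 hφ).resolve_left (C_ne_zero.2 (div_ne_zero
    (mul_ne_zero (pow_ne_zero 2 hk) (pow_ne_zero 2 hp1)) (pow_ne_zero 3 hp)))
  have hψ' := (mul_eq_zero.1 hψ).resolve_left (C_ne_zero.2 (div_ne_zero
    (mul_ne_zero (mul_ne_zero two_ne_zero hk) hp1) (pow_ne_zero 2 hp)))
  have hv : ∀ y, (qVar k e).eval (k * y + e) = y := fun y => by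
    simp [qVar, hk]
  have e1 : ∀ y, (h 2 - h 0 - h 4) + (h 1 + h 3) / 2 * y + (h 0 + h 4) / 2 * y ^ 2 = 0 := fun y => by
    have := congrArg (fun f => f.eval (k * y + e)) hφ'
    simpa only [eval_add, eval_mul, eval_C, eval_pow, hv, eval_zero] using this
  have e2 : ∀ y, (h 3 - h 1) / 2 + (h 4 - h 0) / 2 * y = 0 := fun y => by
    have := congrArg (fun f => f.eval (k * y + e)) hψ'
    simpa only [eval_add, eval_mul, eval_C, eval_pow, hv, eval_zero] using this
  have a0 := e1 0
  have a1 := e1 1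
  have a2 := e1 (-1)
  have b0 := e2 0
  have b1 := e2 1
  funext i
  fin_cases i
  · show h 0 = 0
    linear_combination (a1 + a2) / 2 - a0 - b1 + b0
  · show h 1 = 0
    linear_combination (a1 - a2) / 2 - b0
  · show h 2 = 0
    linear_combination a1 + a2 - a0
  · show h 3 = 0
    linear_combination (a1 - a2) / 2 + b0
  · show h 4 = 0
    linear_combination (a1 + a2) / 2 - a0 + b1 - b0

theorem exists_hyp_iff (hx : IsQLattice p k e x z) :
    (∃ φ ψ : ℂ[X], φ.natDegree ≤ 2 ∧ ψ.natDegree ≤ 1 ∧ (φ ≠ 0 ∨ ψ ≠ 0) ∧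
        ∀ n, ∃ l : ℂ, (qParams p k e).hyp φ ψ (P n) = C l * P n) ↔
      ∃ h, h ≠ 0 ∧ ∀ n, ∃ l : ℂ, qHyp p k e h (P n) = C l * P n := by
  constructor
  · rintro ⟨φ, ψ, hφ, hψ, hne, h⟩
    obtain ⟨h', rfl, rfl⟩ := hx.exists_quartic hφ hψ
    refine ⟨h', ?_, h⟩
    rintro rfl
    simp [qφ, qψ] at hne
  · rintro ⟨h, hne, H⟩
    refine ⟨_, _, natDegree_qφ_le p k e h, natDegree_qψ_le p k e h, ?_, H⟩
    by_contra! h0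
    exact hne (hx.eq_zero_of_qφ_eq_zero h0.1 h0.2)

theorem adm_ne_zero (hx : IsQLattice p k e x z) (hP : IsOPS L P) {h : Fin 5 → ℂ} (hne : h ≠ 0)
    (H : ∀ n, ∃ l : ℂ, qHyp p k e h (P n) = C l * P n) (m : ℕ) :
    (qParams p k e).adm ((qφ p k e h).coeff 2) ((qψ p k e h).coeff 1) m ≠ 0 := by
  choose l hl using H
  refine LatticeParams.adm_ne_zero hx.nondegenerate hP (natDegree_qφ_le p k e h)
    (natDegree_qψ_le p k e h) ?_ hl m
  by_contra! h0
  exact hne (hx.eq_zero_of_qφ_eq_zero h0.1 h0.2)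

theorem mul_pow_sub_ne_zero (hx : IsQLattice p k e x z) (hP : IsOPS L P) {h : Fin 5 → ℂ}
    (hne : h ≠ 0) (H : ∀ n, ∃ l : ℂ, qHyp p k e h (P n) = C l * P n) (m : ℕ) :
    h 4 * (p ^ 2) ^ m - h 0 ≠ 0 := by
  have := hx.adm_ne_zero hP hne H m
  rw [hx.adm_eq] at this
  exact right_ne_zero_of_mul this

theorem eq_C_mul_of_qHyp_eq (hx : IsQLattice p k e x z) (hP : IsOPS L P) {h : Fin 5 → ℂ}
    (hne : h ≠ 0) (H : ∀ n, ∃ l : ℂ, qHyp p k e h (P n) = C l * P n) {n : ℕ} {g : ℂ[X]}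
    (hg : g.natDegree ≤ n) (hgn : g.coeff n ≠ 0) {l : ℂ} (hTg : qHyp p k e h g = C l * g) :
    ∃ κ, P n = C κ * g :=
  ⟨_, eq_C_mul_of_hyp_eq hx.nondegenerate (natDegree_qφ_le p k e h) (natDegree_qψ_le p k e h)
    (hx.adm_ne_zero hP hne H) (hP.natDegree_le n) hg hgn (H n).choose_spec hTg (hP.coeff_ne n)⟩

theorem qHyp_linProd_awPoly (hx : IsQLattice p k e x z) {u v : Fin 4 → ℂ} (a b c d : ℂ)
    (h : ∀ i, v i = u i * ![a, b, c, d] i) (κ : ℂ) (n : ℕ) :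
    qHyp p k e (linProd u v) (C κ * awPoly (p ^ 2) k e n a b c d) =
      C (qEig (p ^ 2) (linProd u v) n) * (C κ * awPoly (p ^ 2) k e n a b c d) := by
  rw [linProd_eq_smul h, qHyp_smul, qEig_smul, map_C_mul_eq, hx.qHyp_awPoly]
  simp only [C_mul]
  ring

/-- The rescaled quartics converge to a nonzero quartic. At each good lattice point the eigenvalue
equation involves three values of the polynomial, so it passes to the limit pointwise. -/
theorem exists_qHyp_of_tendsto (hx : IsQLattice p k e x z) {A B C' D : OnePoint ℂ}
    (H : ∀ n, ∃ κ : ℂ → ℂ → ℂ → ℂ → ℂ, ∀ s,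
      Tendsto (fun t : ℂ × ℂ × ℂ × ℂ => κ t.1 t.2.1 t.2.2.1 t.2.2.2 *
          askeyWilson (p ^ 2) n t.1 t.2.1 t.2.2.1 t.2.2.2 (z s))
        (paramFilter A ×ˢ paramFilter B ×ˢ paramFilter C' ×ˢ paramFilter D)
        (𝓝 ((P n).eval (x s)))) :
    ∃ h, h ≠ 0 ∧ ∀ n, ∃ l : ℂ, qHyp p k e h (P n) = C l * P n := by
  obtain ⟨uA, vA, uA₀, vA₀, huA, hvA, hA, eA⟩ := exists_paramFilter_normalization A
  obtain ⟨uB, vB, uB₀, vB₀, huB, hvB, hB, eB⟩ := exists_paramFilter_normalization B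
  obtain ⟨uC, vC, uC₀, vC₀, huC, hvC, hC, eC⟩ := exists_paramFilter_normalization C'
  obtain ⟨uD, vD, uD₀, vD₀, huD, hvD, hD, eD⟩ := exists_paramFilter_normalization D
  have := paramFilter_neBot A
  have := paramFilter_neBot B
  have := paramFilter_neBot C'
  have := paramFilter_neBot D
  refine ⟨linProd ![uA₀, uB₀, uC₀, uD₀] ![vA₀, vB₀, vC₀, vD₀], linProd_ne_zero ?_, fun n =>
    ⟨qEig (p ^ 2) (linProd ![uA₀, uB₀, uC₀, uD₀] ![vA₀, vB₀, vC₀, vD₀]) n, ?_⟩⟩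
  · simp only [Fin.forall_fin_succ]
    exact ⟨hA, hB, hC, hD, fun i => i.elim0⟩
  obtain ⟨κ, hκ⟩ := H n
  set F := paramFilter A ×ˢ paramFilter B ×ˢ paramFilter C' ×ˢ paramFilter D with hF
  have t1 : Tendsto (fun t : ℂ × ℂ × ℂ × ℂ => t.1) F (paramFilter A) := tendsto_fst
  have t2 : Tendsto (fun t : ℂ × ℂ × ℂ × ℂ => t.2.1) F (paramFilter B) :=
    tendsto_fst.comp tendsto_snd
  have t3 : Tendsto (fun t : ℂ × ℂ × ℂ × ℂ => t.2.2.1) F (paramFilter C') :=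
    tendsto_fst.comp (tendsto_snd.comp tendsto_snd)
  have t4 : Tendsto (fun t : ℂ × ℂ × ℂ × ℂ => t.2.2.2) F (paramFilter D) :=
    tendsto_snd.comp (tendsto_snd.comp tendsto_snd)
  set h : ℂ × ℂ × ℂ × ℂ → Fin 5 → ℂ := fun t =>
    linProd ![uA t.1, uB t.2.1, uC t.2.2.1, uD t.2.2.2] ![vA t.1, vB t.2.1, vC t.2.2.1, vD t.2.2.2]
    with hh
  have hlim : ∀ i, Tendsto (fun t => h t i) F
      (𝓝 (linProd ![uA₀, uB₀, uC₀, uD₀] ![vA₀, vB₀, vC₀, vD₀] i)) := by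
    refine tendsto_linProd ?_ ?_
    · simp only [Fin.forall_fin_succ]
      exact ⟨huA.comp t1, huB.comp t2, huC.comp t3, huD.comp t4, fun i => i.elim0⟩
    · simp only [Fin.forall_fin_succ]
      exact ⟨hvA.comp t1, hvB.comp t2, hvC.comp t3, hvD.comp t4, fun i => i.elim0⟩
  have hT : ∀ᶠ t in F, ∀ c : ℂ, qHyp p k e (h t) (C c * awPoly (p ^ 2) k e n t.1 t.2.1 t.2.2.1 t.2.2.2)
      = C (qEig (p ^ 2) (h t) n) * (C c * awPoly (p ^ 2) k e n t.1 t.2.1 t.2.2.1 t.2.2.2) := by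
    filter_upwards [t1.eventually eA, t2.eventually eB, t3.eventually eC, t4.eventually eD]
      with t h1 h2 h3 h4 c
    refine hx.qHyp_linProd_awPoly _ _ _ _ ?_ c n
    simp only [Fin.forall_fin_succ]
    exact ⟨h1, h2, h3, h4, fun i => i.elim0⟩
  refine hx.eq_of_eval_eq fun s h1 h2 h3 => ?_
  rw [hx.eval_qHyp _ _ h1 h2 h3, eval_mul, eval_C]
  refine tendsto_nhds_unique_of_eventuallyEq
    ((((tendsto_quartic hlim (z s)).div_const _).mul ((hκ (s + 1)).sub (hκ s))).add
    ((((tendsto_quartic hlim (z s)⁻¹).mul_const _).div_const _).mul ((hκ (s - 1)).sub (hκ s))))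
    ((tendsto_qEig hlim (p ^ 2) n).mul (hκ s)) ?_
  filter_upwards [hT] with t ht
  have := congrArg (fun f => f.eval (x s)) (ht (κ t.1 t.2.1 t.2.2.1 t.2.2.2))
  simp only [hx.eval_qHyp _ _ h1 h2 h3, eval_mul, eval_C, hx.eval_awPoly] at this
  exact this

theorem exists_tendsto_of_qHyp (hx : IsQLattice p k e x z) (hP : IsOPS L P) {h : Fin 5 → ℂ}
    (hne : h ≠ 0) (H : ∀ n, ∃ l : ℂ, qHyp p k e h (P n) = C l * P n) (h0 : h 0 = 0) :
    ∃ A B C' D : OnePoint ℂ, A ≠ ((0 : ℂ) : OnePoint ℂ) ∧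
    (A = OnePoint.infty ∨ B = OnePoint.infty ∨ C' = OnePoint.infty ∨ D = OnePoint.infty) ∧
    ∀ n, ∃ κ : ℂ → ℂ → ℂ → ℂ → ℂ, ∀ s,
      Tendsto (fun t : ℂ × ℂ × ℂ × ℂ => κ t.1 t.2.1 t.2.2.1 t.2.2.2 *
          askeyWilson (p ^ 2) n t.1 t.2.1 t.2.2.1 t.2.2.2 (z s))
        (paramFilter A ×ˢ paramFilter B ×ˢ paramFilter C' ×ˢ paramFilter D)
        (𝓝 ((P n).eval (x s))) := by
  have hq0 : p ^ 2 ≠ 0 := pow_ne_zero 2 hx.p_ne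
  have h4 : h 4 ≠ 0 := by
    have := hx.mul_pow_sub_ne_zero hP hne H 0
    rwa [pow_zero, mul_one, h0, sub_zero] at this
  -- As h(0) = 0, one root is 0, and the corresponding parameter tends to infinity.
  obtain ⟨b, c, d, hh⟩ := eq_smul_linProd_of_isRoot h4 (r := 0) (by simp [quartic, h0])
  obtain ⟨A, hA0, hA, tA, nA⟩ := exists_paramFilter_inv 0
  obtain ⟨B, -, -, tB, nB⟩ := exists_paramFilter_inv b
  obtain ⟨C', -, -, tC, nC⟩ := exists_paramFilter_inv c
  obtain ⟨D, -, -, tD, nD⟩ := exists_paramFilter_inv d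
  refine ⟨A, B, C', D, hA0, Or.inl (hA rfl), fun n => ?_⟩
  set F := paramFilter A ×ˢ paramFilter B ×ˢ paramFilter C' ×ˢ paramFilter D with hF
  have t1 : Tendsto (fun t : ℂ × ℂ × ℂ × ℂ => t.1) F (paramFilter A) := tendsto_fst
  have t2 : Tendsto (fun t : ℂ × ℂ × ℂ × ℂ => t.2.1) F (paramFilter B) :=
    tendsto_fst.comp tendsto_snd
  have t3 : Tendsto (fun t : ℂ × ℂ × ℂ × ℂ => t.2.2.1) F (paramFilter C') :=
    tendsto_fst.comp (tendsto_snd.comp tendsto_snd)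
  have t4 : Tendsto (fun t : ℂ × ℂ × ℂ × ℂ => t.2.2.2) F (paramFilter D) :=
    tendsto_snd.comp (tendsto_snd.comp tendsto_snd)
  set W : ℂ × ℂ × ℂ × ℂ → ℂ[X] := fun t => awPoly (p ^ 2) k e n t.1 t.2.1 t.2.2.1 t.2.2.2 with hW
  set h' : ℂ × ℂ × ℂ × ℂ → Fin 5 → ℂ := fun t =>
    linProd ![t.1⁻¹, t.2.1⁻¹, t.2.2.1⁻¹, t.2.2.2⁻¹] 1 with hh'
  have hlim : ∀ i, Tendsto (fun t => h' t i) F (𝓝 (linProd ![0, b, c, d] 1 i)) := by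
    refine tendsto_linProd ?_ fun i => tendsto_const_nhds
    simp only [Fin.forall_fin_succ]
    exact ⟨tA.comp t1, tB.comp t2, tC.comp t3, tD.comp t4, fun i => i.elim0⟩
  have hn0 := ((t1.eventually nA).and (t2.eventually nB)).and
    ((t3.eventually nC).and (t4.eventually nD))
  have hT : ∀ᶠ t in F, ∀ c : ℂ, qHyp p k e (h' t) (C c * W t)
      = C (qEig (p ^ 2) (h' t) n) * (C c * W t) := by
    filter_upwards [hn0] with t ht c
    refine hx.qHyp_linProd_awPoly _ _ _ _ ?_ c n
    simp only [Fin.forall_fin_succ]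
    exact ⟨(inv_mul_cancel₀ ht.1.1).symm, (inv_mul_cancel₀ ht.1.2).symm,
      (inv_mul_cancel₀ ht.2.1).symm, (inv_mul_cancel₀ ht.2.2).symm, fun i => i.elim0⟩
  -- The constant coefficient 1/(abcd) of the approximating quartic tends to 0, so it eventually
  -- avoids the finitely many q^m at which the leading coefficient could vanish.
  have hlead : ∀ᶠ t in F, (W t).coeff n ≠ 0 := by
    have hm : ∀ᶠ t in F, ∀ m ∈ Finset.range (2 * n), h' t 0 - (p ^ 2) ^ m ≠ 0 := by
      refine (Finset.eventually_all _).2 fun m _ => ?_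
      refine ((hlim 0).sub_const _).eventually_ne ?_
      simp [linProd, hx.p_ne]
    filter_upwards [hm, hn0] with t ht ht0
    refine coeff_awPoly_ne_zero hq0 hx.pow_ne hx.k_ne e n ht0.1.1 fun m hm h0 => ?_
    apply ht m (Finset.mem_range.2 hm)
    simp only [hh', linProd, Matrix.cons_val]
    obtain ⟨⟨n1, n2⟩, n3, n4⟩ := ht0
    field_simp
    linear_combination h0
  have hne' : linProd ![0, b, c, d] 1 ≠ 0 := fun h => hne (by rw [hh, h, smul_zero])
  have H' : ∀ n, ∃ l : ℂ, qHyp p k e (linProd ![0, b, c, d] 1) (P n) = C l * P n := fun n => by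
    obtain ⟨l, hl⟩ := H n
    rw [hh, qHyp_smul] at hl
    refine ⟨(h 4)⁻¹ * l, ?_⟩
    rw [C_mul, mul_assoc, ← hl, ← mul_assoc, ← C_mul, inv_mul_cancel₀ h4, C_1, one_mul]
  have hdeg : ∀ h j m, m < j → (qHyp p k e h (X ^ m)).coeff j = 0 := fun h j m hm =>
    coeff_eq_zero_of_natDegree_lt ((natDegree_hyp_le (natDegree_qφ_le p k e h)
      (natDegree_qψ_le p k e h) (natDegree_X_pow_le m)).trans_lt hm)
  obtain ⟨l, hl⟩ := H' n
  -- The constants match the leading coefficient of P_n.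
  set κ : ℂ → ℂ → ℂ → ℂ → ℂ := fun a b c d =>
    (P n).coeff n / (awPoly (p ^ 2) k e n a b c d).coeff n with hκ
  have hκW : ∀ t, (C (κ t.1 t.2.1 t.2.2.1 t.2.2.2) * W t).natDegree ≤ n := fun t =>
    (natDegree_C_mul_le _ _).trans (natDegree_awPoly_le _ _ _ _ _ _ _ _)
  have hcoeff := tendsto_coeff_of_eigen (F := F) (T := fun t => qHyp p k e (h' t))
    (T₀ := qHyp p k e (linProd ![0, b, c, d] 1)) (fun t => hdeg _) (hdeg _)
    (fun j m => tendsto_coeff_qHyp hlim p k e _ j) (n := n) (g := P n)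
    (f := fun t => C (κ t.1 t.2.1 t.2.2.1 t.2.2.2) * W t) (fun j hj => ?_) hκW (hP.natDegree_le n)
    (hP.coeff_ne n) (hlead.mono fun t ht => ?_) (hT.mono fun t ht => ht _) hl
  · refine ⟨κ, fun s => ?_⟩
    have hev : ∀ t : ℂ × ℂ × ℂ × ℂ, κ t.1 t.2.1 t.2.2.1 t.2.2.2 *
        askeyWilson (p ^ 2) n t.1 t.2.1 t.2.2.1 t.2.2.2 (z s) =
        ∑ i ∈ Finset.range (n + 1), (C (κ t.1 t.2.1 t.2.2.1 t.2.2.2) * W t).coeff i * x s ^ i :=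
      fun t => by
        rw [← eval_eq_sum_range' (Nat.lt_succ_of_le (hκW t)), eval_mul, eval_C, hW,
          hx.eval_awPoly]
    simp only [hev]
    rw [eval_eq_sum_range' (Nat.lt_succ_of_le (hP.natDegree_le n))]
    exact tendsto_finsetSum _ fun i _ => (hcoeff i).mul_const _
  · have hc : ∀ m, (qHyp p k e (linProd ![0, b, c, d] 1) (X ^ m)).coeff m =
        (qParams p k e).eig ((qφ p k e (linProd ![0, b, c, d] 1)).coeff 2)
          ((qψ p k e (linProd ![0, b, c, d] 1)).coeff 1) m := fun m => by
      rw [qHyp, coeff_hyp (natDegree_qφ_le p k e _) (natDegree_qψ_le p k e _)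
        (natDegree_X_pow_le m), coeff_X_pow_self, mul_one]
    rw [hc, hc, ← sub_ne_zero]
    obtain ⟨i, rfl⟩ : ∃ i, n = j + i + 1 := ⟨n - j - 1, by omega⟩
    rw [eig_sub_eig]
    exact mul_ne_zero (hx.nondegenerate.leadD_ne i) (hx.adm_ne_zero hP hne' H' _)
  · rw [coeff_C_mul, hκ]
    exact div_mul_cancel₀ _ ht

/-- The orthogonal polynomials which are eigenfunctions of an operator of Askey--Wilson type. -/
theorem exists_hyp_iff_families (hx : IsQLattice p k e x z) (hP : IsOPS L P) :
    (∃ φ ψ : ℂ[X], φ.natDegree ≤ 2 ∧ ψ.natDegree ≤ 1 ∧ (φ ≠ 0 ∨ ψ ≠ 0) ∧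
        ∀ n, ∃ l : ℂ, (qParams p k e).hyp φ ψ (P n) = C l * P n) ↔
      (∃ a b c d : ℂ, a ≠ 0 ∧ ∀ n, ∃ κ : ℂ, ∀ s,
        (P n).eval (x s) = κ * askeyWilson (p ^ 2) n a b c d (z s)) ∨
      (∀ n, ∃ κ : ℂ, ∀ s, (P n).eval (x s) = κ * continuousQHermite (p ^ 2) n (z s)) ∨
      ∃ A B C' D : OnePoint ℂ, A ≠ ((0 : ℂ) : OnePoint ℂ) ∧
        (A = OnePoint.infty ∨ B = OnePoint.infty ∨ C' = OnePoint.infty ∨ D = OnePoint.infty) ∧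
        ∀ n, ∃ κ : ℂ → ℂ → ℂ → ℂ → ℂ, ∀ s,
          Tendsto (fun t : ℂ × ℂ × ℂ × ℂ => κ t.1 t.2.1 t.2.2.1 t.2.2.2 *
              askeyWilson (p ^ 2) n t.1 t.2.1 t.2.2.1 t.2.2.2 (z s))
            (paramFilter A ×ˢ paramFilter B ×ˢ paramFilter C' ×ˢ paramFilter D)
            (𝓝 ((P n).eval (x s))) := by
  rw [hx.exists_hyp_iff]
  constructor
  · rintro ⟨h, hne, H⟩
    by_cases h0 : h 0 = 0
    · exact Or.inr (Or.inr (hx.exists_tendsto_of_qHyp hP hne H h0))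
    · rcases eq_smul_linProd_of_ne_zero h0 with ⟨a, b, c, d, ha, hh⟩ | hh
      · refine Or.inl ⟨a, b, c, d, ha, fun n => ?_⟩
        have hadm : ∀ m < 2 * n, 1 - a * b * c * d * (p ^ 2) ^ m ≠ 0 := fun m _ hm => by
          apply hx.mul_pow_sub_ne_zero hP hne H m
          have h4 := congrFun hh 4
          simp [linProd] at h4
          rw [h4]
          linear_combination -h 0 * hm
        obtain ⟨κ, hκ⟩ := hx.eq_C_mul_of_qHyp_eq hP hne H (natDegree_awPoly_le (p ^ 2) k e n a b c d)
          (coeff_awPoly_ne_zero (pow_ne_zero 2 hx.p_ne) hx.pow_ne hx.k_ne e n ha hadm)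
          (l := h 0 * qEig (p ^ 2) (linProd 1 ![a, b, c, d]) n)
          (by rw [hh, qHyp_smul, hx.qHyp_awPoly, C_mul, mul_assoc, ← hh])
        exact ⟨κ, fun s => by rw [hκ, eval_mul, eval_C, hx.eval_awPoly]⟩
      · refine Or.inr (Or.inl fun n => ?_)
        obtain ⟨κ, hκ⟩ := hx.eq_C_mul_of_qHyp_eq hP hne H (natDegree_hermPoly_le (p ^ 2) k e n).1
          (by rw [(coeff_hermPoly _ _ _ _).1]; exact pow_ne_zero _ (inv_ne_zero hx.k_ne))
          (l := h 0 * qEig (p ^ 2) ![1, 0, 0, 0, 0] n)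
          (by rw [hh, qHyp_smul, hx.qHyp_hermPoly, C_mul, mul_assoc, ← hh])
        exact ⟨κ, fun s => by rw [hκ, eval_mul, eval_C, hx.eval_hermPoly]⟩
  · have key : ∀ {n : ℕ} {κ l : ℂ} {h : Fin 5 → ℂ} {g : ℂ[X]}, qHyp p k e h g = C l * g →
        (∀ s, (P n).eval (x s) = κ * g.eval (x s)) → ∃ l : ℂ, qHyp p k e h (P n) = C l * P n := by
      intro n κ l h g hg hκ
      have : P n = C κ * g := hx.eq_of_eval_eq fun s _ _ _ => by rw [hκ, eval_mul, eval_C]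
      exact ⟨l, by rw [this, map_C_mul_eq, hg]; ring⟩
    rintro (⟨a, b, c, d, -, H⟩ | H | ⟨A, B, C', D, -, -, H⟩)
    · refine ⟨linProd 1 ![a, b, c, d], linProd_ne_zero fun i => Or.inl one_ne_zero, fun n => ?_⟩
      obtain ⟨κ, hκ⟩ := H n
      exact key (hx.qHyp_awPoly n a b c d) fun s => by rw [hκ, hx.eval_awPoly]
    · refine ⟨![1, 0, 0, 0, 0], fun h => one_ne_zero (congrFun h 0), fun n => ?_⟩
      obtain ⟨κ, hκ⟩ := H n
      exact key (hx.qHyp_hermPoly n) fun s => by rw [hκ, hx.eval_hermPoly]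
    · exact hx.exists_qHyp_of_tendsto H

end IsQLattice
end

/-! ### The Wilson operator of a quadratic lattice. -/

noncomputable section

namespace LatticeParams

/-- The constants of the lattice `x = k τ² + e`, `τ(s + 1/2) = τ(s) + 1/2`. -/
def quadParams (k e : ℂ) : LatticeParams where
  α := 1
  β := k / 4
  δ := -(k * e)

theorem lead_quadParams (k e : ℂ) (n : ℕ) :
    (quadParams k e).leadS n = 1 ∧ (quadParams k e).leadD n = n := by
  have hα : (quadParams k e).α = 1 := rfl
  induction n with
  | zero => simp
  | succ n ih =>
    rw [leadS_succ, leadD_succ, hα, ih.1, ih.2]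
    push_cast
    constructor <;> ring

theorem nondegenerate_quadParams {k : ℂ} (hk : k ≠ 0) (e : ℂ) : (quadParams k e).Nondegenerate := by
  have hα : (quadParams k e).α = 1 := rfl
  have hβ : (quadParams k e).β = k / 4 := rfl
  have hU : ((quadParams k e).U₂).coeff 1 = k := by
    rw [U₂, hα, hβ]
    simp [coeff_C]
    ring
  refine ⟨fun n => ?_, by rw [hα]; exact one_ne_zero, fun h => hk ?_, fun h => hk ?_⟩
  · rw [(lead_quadParams k e _).2]
    exact_mod_cast n.succ_ne_zero
  · rw [← hU, h, coeff_zero]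
  · have h1 := congrArg (fun f => coeff f 1) h
    have hU₁ : (quadParams k e).U₁ = C (k / 4 * (1 + 1)) := by rw [U₁, hα, hβ]; simp
    simp only [coeff_sub, coeff_C_mul, hα, hU, hU₁, ← C_pow, coeff_C_succ, coeff_zero] at h1
    linear_combination -h1

end LatticeParams

open LatticeParams

/-- `x = k τ² + e`, where `τ(s)` is `s` up to translation. -/
structure IsQuadLattice (k e : ℂ) (x τ : ℂ → ℂ) : Prop where
  k_ne : k ≠ 0
  x_eq (s : ℂ) : x s = k * τ s ^ 2 + e
  τ_add (s h : ℂ) : τ (s + h) = τ s + h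
  τ_surj (w : ℂ) : ∃ s, τ s = w

/-- The second order coefficient of the Wilson operator attached to the quartic `h`. -/
def wφ (k e : ℂ) (h : Fin 5 → ℂ) : ℂ[X] :=
  C (2 * k ^ 2) * (C (h 0) + C (h 2) * qVar k e + C (h 4) * qVar k e ^ 2)

/-- The first order coefficient of the Wilson operator attached to the quartic `h`. -/
def wψ (k e : ℂ) (h : Fin 5 → ℂ) : ℂ[X] :=
  C (2 * k) * (C (h 1) + C (h 3) * qVar k e)

/-- The Wilson operator attached to the quartic `h`. -/
def wHyp (k e : ℂ) (h : Fin 5 → ℂ) : ℂ[X] →ₗ[ℂ] ℂ[X] :=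
  (quadParams k e).hyp (wφ k e h) (wψ k e h)

theorem natDegree_wφ_le (k e : ℂ) (h : Fin 5 → ℂ) : (wφ k e h).natDegree ≤ 2 := by
  rw [wφ, qVar]; compute_degree

theorem natDegree_wψ_le (k e : ℂ) (h : Fin 5 → ℂ) : (wψ k e h).natDegree ≤ 1 := by
  rw [wψ, qVar]; compute_degree

theorem coeff_wφ {k : ℂ} (hk : k ≠ 0) (e : ℂ) (h : Fin 5 → ℂ) : (wφ k e h).coeff 2 = 2 * h 4 := by
  have : (wφ k e h).coeff 2 = 2 * k ^ 2 * (h 4 * k⁻¹ ^ 2) := by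
    rw [wφ, qVar]; compute_degree!
  rw [this]; field_simp

theorem coeff_wψ {k : ℂ} (hk : k ≠ 0) (e : ℂ) (h : Fin 5 → ℂ) : (wψ k e h).coeff 1 = 2 * h 3 := by
  have : (wψ k e h).coeff 1 = 2 * k * (h 3 * k⁻¹) := by
    rw [wψ, qVar]; compute_degree!
  rw [this]; field_simp

theorem wHyp_smul (k e c : ℂ) (h : Fin 5 → ℂ) (f : ℂ[X]) :
    wHyp k e (c • h) f = C c * wHyp k e h f := by
  simp only [wHyp, hyp_apply, wφ, wψ, Pi.smul_apply, smul_eq_mul, C_mul]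
  ring

namespace IsQuadLattice

variable {k e : ℂ} {x τ : ℂ → ℂ}

theorem τ_sub (hx : IsQuadLattice k e x τ) (s h : ℂ) : τ (s - h) = τ s - h := by
  rw [sub_eq_add_neg, hx.τ_add, ← sub_eq_add_neg]

theorem isLattice (hx : IsQuadLattice k e x τ) : (quadParams k e).IsLattice x := by
  have hk := hx.k_ne
  refine ⟨fun s => ?_, fun s => ?_, fun y => ?_⟩
  · simp only [hx.x_eq, hx.τ_add, hx.τ_sub, quadParams]
    ring
  · simp only [hx.x_eq, hx.τ_add, hx.τ_sub, quadParams, U₂, eval_add, eval_mul, eval_C, eval_X,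
      eval_pow]
    ring
  · obtain ⟨d, hd⟩ := IsAlgClosed.exists_pow_nat_eq ((y - e) / k) (n := 2) (by norm_num)
    obtain ⟨s, hs⟩ := hx.τ_surj d
    refine ⟨s, ?_⟩
    rw [hx.x_eq, hs, hd]
    field_simp
    ring

theorem nondegenerate (hx : IsQuadLattice k e x τ) : (quadParams k e).Nondegenerate :=
  nondegenerate_quadParams hx.k_ne e

/-- Admissibility at m = 0 gives h₃ ≠ 0, so quartics of degree below three are excluded. -/
theorem adm_eq (hx : IsQuadLattice k e x τ) (h : Fin 5 → ℂ) (m : ℕ) :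
    (quadParams k e).adm ((wφ k e h).coeff 2) ((wψ k e h).coeff 1) m = 2 * (h 4 * m + h 3) := by
  rw [adm, (lead_quadParams k e m).1, (lead_quadParams k e m).2, coeff_wφ hx.k_ne,
    coeff_wψ hx.k_ne]
  ring

/-- Up to constants, φ and τψ are the even and odd parts of h(τ). -/
theorem exists_quartic (hx : IsQuadLattice k e x τ) {φ ψ : ℂ[X]} (hφ : φ.natDegree ≤ 2)
    (hψ : ψ.natDegree ≤ 1) : ∃ h, wφ k e h = φ ∧ wψ k e h = ψ := by
  have hk := hx.k_ne
  have e₁ : φ = C (φ.coeff 2) * X ^ 2 + C (φ.coeff 1) * X + C (φ.coeff 0) := by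
    conv_lhs => rw [φ.as_sum_range_C_mul_X_pow' (show φ.natDegree < 3 by omega)]
    simp [Finset.sum_range_succ]; ring
  have e₂ : ψ = C (ψ.coeff 1) * X + C (ψ.coeff 0) := by
    conv_lhs => rw [ψ.as_sum_range_C_mul_X_pow' (show ψ.natDegree < 2 by omega)]
    simp [Finset.sum_range_succ]; ring
  have hX : (X : ℂ[X]) = C k * qVar k e + C e := by
    rw [qVar, ← mul_assoc, ← C_mul, mul_inv_cancel₀ hk]; simp
  obtain ⟨A₀, hA₀⟩ : ∃ A, 2 * k ^ 2 * A = φ.coeff 2 * e ^ 2 + φ.coeff 1 * e + φ.coeff 0 :=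
    ⟨_ / (2 * k ^ 2), mul_div_cancel₀ _ (by simpa using hk)⟩
  obtain ⟨A₁, hA₁⟩ : ∃ A, 2 * k ^ 2 * A = 2 * φ.coeff 2 * k * e + φ.coeff 1 * k :=
    ⟨_ / (2 * k ^ 2), mul_div_cancel₀ _ (by simpa using hk)⟩
  obtain ⟨A₂, hA₂⟩ : ∃ A, 2 * k ^ 2 * A = φ.coeff 2 * k ^ 2 :=
    ⟨_ / (2 * k ^ 2), mul_div_cancel₀ _ (by simpa using hk)⟩
  obtain ⟨B₀, hB₀⟩ : ∃ A, 2 * k * A = ψ.coeff 1 * e + ψ.coeff 0 :=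
    ⟨_ / (2 * k), mul_div_cancel₀ _ (by simpa using hk)⟩
  obtain ⟨B₁, hB₁⟩ : ∃ A, 2 * k * A = ψ.coeff 1 * k :=
    ⟨_ / (2 * k), mul_div_cancel₀ _ (by simpa using hk)⟩
  refine ⟨![A₀, B₀, A₁, B₁, A₂], ?_, ?_⟩
  · conv_rhs => rw [e₁, hX]
    replace hA₀ := congrArg C hA₀
    replace hA₁ := congrArg C hA₁
    replace hA₂ := congrArg C hA₂
    simp only [wφ, Matrix.cons_val]
    simp only [C_mul, C_add, C_pow, C_ofNat] at hA₀ hA₁ hA₂ ⊢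
    linear_combination hA₀ + qVar k e * hA₁ + qVar k e ^ 2 * hA₂
  · conv_rhs => rw [e₂, hX]
    replace hB₀ := congrArg C hB₀
    replace hB₁ := congrArg C hB₁
    simp only [wψ, Matrix.cons_val]
    simp only [C_mul, C_add, C_ofNat] at hB₀ hB₁ ⊢
    linear_combination hB₀ + qVar k e * hB₁

theorem eval_qVar (hx : IsQuadLattice k e x τ) (s : ℂ) : (qVar k e).eval (x s) = τ s ^ 2 := by
  have := hx.k_ne
  rw [qVar, eval_mul, eval_sub, eval_C, eval_C, eval_X, hx.x_eq]
  field_simp; ring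

theorem eq_zero_of_wφ_eq_zero (hx : IsQuadLattice k e x τ) {h : Fin 5 → ℂ} (hφ : wφ k e h = 0)
    (hψ : wψ k e h = 0) : h = 0 := by
  refine quartic_ext fun w => ?_
  obtain ⟨s, rfl⟩ := hx.τ_surj w
  have e1 := congrArg (fun f => f.eval (x s)) hφ
  have e2 := congrArg (fun f => f.eval (x s)) hψ
  simp only [wφ, wψ, eval_mul, eval_add, eval_C, eval_pow, hx.eval_qVar, eval_zero, mul_eq_zero,
    hx.k_ne, two_ne_zero, ne_eq, not_false_eq_true, pow_eq_zero_iff, or_self, false_or] at e1 e2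
  simp only [quartic, Pi.zero_apply]
  linear_combination e1 + τ s * e2

/-- The Wilson operator in terms of shifts. -/
theorem eval_wHyp (hx : IsQuadLattice k e x τ) (h : Fin 5 → ℂ) (f : ℂ[X]) {s : ℂ}
    (h1 : τ s ≠ 0) (h2 : 2 * τ s + 1 ≠ 0) (h3 : 2 * τ s - 1 ≠ 0) :
    (wHyp k e h f).eval (x s) =
      (quartic h (τ s) * (f.eval (x (s + 1)) - f.eval (x s)) / (2 * τ s + 1) +
        quartic h (-τ s) * (f.eval (x (s - 1)) - f.eval (x s)) / (2 * τ s - 1)) / τ s := by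
  have hk := hx.k_ne
  have d0 : x (s + 1 / 2) - x (s - 1 / 2) = 2 * k * τ s := by
    rw [hx.x_eq, hx.x_eq, hx.τ_add, hx.τ_sub]; ring
  have d1 : x (s + 1) - x s = k * (2 * τ s + 1) := by
    rw [hx.x_eq, hx.x_eq, hx.τ_add]; ring
  have d2 : x s - x (s - 1) = k * (2 * τ s - 1) := by
    rw [hx.x_eq, hx.x_eq, hx.τ_sub]; ring
  have hs1 : x (s + 1 / 2) ≠ x (s - 1 / 2) := by
    rw [← sub_ne_zero, d0]
    exact mul_ne_zero (mul_ne_zero two_ne_zero hk) h1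
  have hs2 : x (s + 1) ≠ x s := by
    rw [← sub_ne_zero, d1]
    exact mul_ne_zero hk h2
  have hs3 : x s ≠ x (s - 1) := by
    rw [← sub_ne_zero, d2]
    exact mul_ne_zero hk h3
  have e1 : (wφ k e h).eval (x s) + (x (s + 1 / 2) - x (s - 1 / 2)) / 2 * (wψ k e h).eval (x s)
      = 2 * k ^ 2 * quartic h (τ s) := by
    rw [d0]
    simp only [wφ, wψ, eval_add, eval_mul, eval_C, eval_pow, hx.eval_qVar, quartic]
    ring
  have e2 : (wφ k e h).eval (x s) - (x (s + 1 / 2) - x (s - 1 / 2)) / 2 * (wψ k e h).eval (x s)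
      = 2 * k ^ 2 * quartic h (-τ s) := by
    rw [d0]
    simp only [wφ, wψ, eval_add, eval_mul, eval_C, eval_pow, hx.eval_qVar, quartic]
    ring
  rw [wHyp, hx.isLattice.eval_hyp _ _ _ hs1 hs2 hs3, e1, e2, d0, d1, d2]
  generalize quartic h (τ s) = H
  generalize quartic h (-τ s) = H'
  field_simp
  ring

theorem eq_of_eval_eq (hx : IsQuadLattice k e x τ) {f g : ℂ[X]}
    (h : ∀ s, τ s ≠ 0 → 2 * τ s + 1 ≠ 0 → 2 * τ s - 1 ≠ 0 → f.eval (x s) = g.eval (x s)) :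
    f = g := by
  refine hx.isLattice.eq_of_eval_eq hx.nondegenerate fun s h1 h2 h3 => h s ?_ ?_ ?_
  · intro h0; apply h1
    rw [← sub_eq_zero, hx.x_eq, hx.x_eq, hx.τ_add, hx.τ_sub]
    linear_combination 2 * k * h0
  · intro h0; apply h2
    rw [← sub_eq_zero, hx.x_eq, hx.x_eq, hx.τ_add]
    linear_combination k * h0
  · intro h0; apply h3
    rw [← sub_eq_zero, hx.x_eq, hx.x_eq, hx.τ_sub]
    linear_combination k * h0

theorem wHyp_eq_of_eval (hx : IsQuadLattice k e x τ) (h : Fin 5 → ℂ) (f g : ℂ[X]) (F G : ℂ → ℂ)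
    (hf : ∀ s, f.eval (x s) = F (τ s)) (hg : ∀ s, g.eval (x s) = G (τ s))
    (hFG : ∀ w, w ≠ 0 → 2 * w + 1 ≠ 0 → 2 * w - 1 ≠ 0 →
      (quartic h w * (F (w + 1) - F w) / (2 * w + 1) +
        quartic h (-w) * (F (w - 1) - F w) / (2 * w - 1)) / w = G w) : wHyp k e h f = g := by
  refine hx.eq_of_eval_eq fun s h1 h2 h3 => ?_
  rw [hx.eval_wHyp h f h1 h2 h3, hf, hf, hf, hg, hx.τ_add, hx.τ_sub]
  exact hFG _ h1 h2 h3

end IsQuadLattice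

theorem risingFactorial_succ (a : ℂ) (j : ℕ) :
    risingFactorial a (j + 1) = risingFactorial a j * (a + j) :=
  Finset.prod_range_succ _ _

theorem risingFactorial_succ' (a : ℂ) (j : ℕ) :
    risingFactorial a (j + 1) = a * risingFactorial (a + 1) j := by
  rw [risingFactorial, Finset.prod_range_succ', mul_comm, risingFactorial]
  congr 1
  · simp
  · exact Finset.prod_congr rfl fun i _ => by push_cast; ring

@[simp] theorem risingFactorial_zero (a : ℂ) : risingFactorial a 0 = 1 := rfl

/-- The basis `(a + τ)_j (a - τ)_j` in which the Wilson polynomials are expanded. -/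
def wBasis (k e a : ℂ) (j : ℕ) : ℂ[X] :=
  ∏ i ∈ Finset.range j, (C ((a + i) ^ 2) - qVar k e)

theorem natDegree_wBasis_le (k e a : ℂ) (j : ℕ) : (wBasis k e a j).natDegree ≤ j := by
  refine (natDegree_prod_le _ _).trans ((Finset.sum_le_card_nsmul _ _ 1 fun i _ => ?_).trans (by simp))
  exact (natDegree_sub_le _ _).trans (max_le ((natDegree_C _).le.trans (by omega))
    (natDegree_qVar_le k e))

theorem coeff_wBasis (k e a : ℂ) (j : ℕ) : (wBasis k e a j).coeff j = (-k⁻¹) ^ j := by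
  induction j with
  | zero => simp [wBasis]
  | succ j ih =>
    have hd : (C ((a + j) ^ 2) - qVar k e).natDegree ≤ 1 :=
      (natDegree_sub_le _ _).trans (max_le ((natDegree_C _).le.trans (by omega))
        (natDegree_qVar_le k e))
    have h := coeff_mul_add_eq_of_natDegree_le (natDegree_wBasis_le k e a j) hd
    rw [wBasis, Finset.prod_range_succ, ← wBasis, h, ih, pow_succ]
    congr 1
    rw [coeff_sub, coeff_C_succ, qVar, coeff_C_mul]
    simp

/-- The eigenvalues of the Wilson operator attached to the quartic `h`. -/
def wEig (h : Fin 5 → ℂ) (n : ℕ) : ℂ := 2 * n * ((n - 1) * h 4 + h 3)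

theorem wHyp_wBasis_zero (k e : ℂ) (h : Fin 5 → ℂ) (a : ℂ) :
    wHyp k e h (wBasis k e a 0) = C (wEig h 0) * wBasis k e a 0 := by
  simp [wBasis, wHyp, hyp_apply, wEig]

namespace IsQuadLattice

variable {k e : ℂ} {x τ : ℂ → ℂ}

theorem eval_wBasis (hx : IsQuadLattice k e x τ) (a : ℂ) (j : ℕ) (s : ℂ) :
    (wBasis k e a j).eval (x s) = risingFactorial (a + τ s) j * risingFactorial (a - τ s) j := by
  rw [wBasis, eval_prod, risingFactorial, risingFactorial, ← Finset.prod_mul_distrib]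
  refine Finset.prod_congr rfl fun i _ => ?_
  rw [eval_sub, eval_C, hx.eval_qVar]
  ring

/-- The last factor u + vτ covers two cases at once: v = 1, u = d for Wilson and v = 0, u = 1 for
continuous dual Hahn. As in the q-case, the factor a ± τ of the quartic restores the end factor lost
in the shift. -/
theorem wHyp_wBasis_succ (hx : IsQuadLattice k e x τ) (a b c u v : ℂ) (j : ℕ) :
    wHyp k e (linProd ![a, b, c, u] ![-1, -1, -1, -v]) (wBasis k e a (j + 1)) =
      C (wEig (linProd ![a, b, c, u] ![-1, -1, -1, -v]) (j + 1)) * wBasis k e a (j + 1) +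
      C (-(2 * (j + 1) * ((a + b + j) * (a + c + j) * (v * (a + j) + u)))) * wBasis k e a j := by
  refine hx.wHyp_eq_of_eval _ _ _
    (fun w => risingFactorial (a + w) (j + 1) * risingFactorial (a - w) (j + 1))
    (fun w => wEig (linProd ![a, b, c, u] ![-1, -1, -1, -v]) (j + 1) *
      (risingFactorial (a + w) (j + 1) * risingFactorial (a - w) (j + 1)) +
      -(2 * (j + 1) * ((a + b + j) * (a + c + j) * (v * (a + j) + u))) *
      (risingFactorial (a + w) j * risingFactorial (a - w) j))
    (fun s => hx.eval_wBasis a _ s)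
    (fun s => by rw [eval_add, eval_mul, eval_mul, hx.eval_wBasis, hx.eval_wBasis, eval_C, eval_C])
    fun w h1 h2 h3 => ?_
  set U := risingFactorial (a - w) j with hU
  set V := risingFactorial (a + w + 1) j with hV
  set U' := risingFactorial (a - w + 1) j with hU'
  set V' := risingFactorial (a + w) j with hV'
  have r1 : V' * (a + w + j) = (a + w) * V := by
    rw [hV', ← risingFactorial_succ, risingFactorial_succ']
  have r2 : U * (a - w + j) = (a - w) * U' := by
    rw [hU, ← risingFactorial_succ, risingFactorial_succ']
  have f0 : risingFactorial (a + w) (j + 1) * risingFactorial (a - w) (j + 1) =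
      U * V' * ((a + w + j) * (a - w + j)) := by
    rw [risingFactorial_succ, risingFactorial_succ]; ring
  have f1 : risingFactorial (a + (w + 1)) (j + 1) * risingFactorial (a - (w + 1)) (j + 1) =
      V * (a + w + 1 + j) * ((a - w - 1) * U) := by
    rw [← add_assoc, risingFactorial_succ, risingFactorial_succ' (a - (w + 1)),
      show a - (w + 1) + 1 = a - w by ring]
    ring
  have f2 : risingFactorial (a + (w - 1)) (j + 1) * risingFactorial (a - (w - 1)) (j + 1) =
      U' * (a - w + 1 + j) * ((a + w - 1) * V') := by
    rw [show a - (w - 1) = a - w + 1 by ring, risingFactorial_succ (a - w + 1),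
      risingFactorial_succ' (a + (w - 1)), show a + (w - 1) + 1 = a + w by ring]
    ring
  have t1 : quartic (linProd ![a, b, c, u] ![-1, -1, -1, -v]) w *
      (V * (a + w + 1 + j) * ((a - w - 1) * U) - U * V' * ((a + w + j) * (a - w + j))) =
      -(U * V' * ((j + 1) * (a + w + j) * ((b + w) * (c + w) * (u + v * w)))) * (2 * w + 1) := by
    rw [quartic_linProd]
    simp only [Matrix.cons_val]
    linear_combination -(b + w) * (c + w) * (u + v * w) * U * (a + w + 1 + j) * (a - w - 1) * r1
  have t2 : quartic (linProd ![a, b, c, u] ![-1, -1, -1, -v]) (-w) *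
      (U' * (a - w + 1 + j) * ((a + w - 1) * V') - U * V' * ((a + w + j) * (a - w + j))) =
      U * V' * ((j + 1) * (a - w + j) * ((b - w) * (c - w) * (u - v * w))) * (2 * w - 1) := by
    rw [quartic_linProd]
    simp only [Matrix.cons_val]
    linear_combination -(b - w) * (c - w) * (u - v * w) * V' * (a - w + 1 + j) * (a + w - 1) * r2
  simp only [f0, f1, f2]
  rw [t1, t2, mul_div_cancel_right₀ _ h2, mul_div_cancel_right₀ _ h3, div_eq_iff h1]
  simp only [wEig, linProd, Matrix.cons_val]
  push_cast
  ring

end IsQuadLattice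
end

/-! ### The families on a quadratic lattice. -/

noncomputable section

open LatticeParams

/-- The coefficients of the Wilson polynomials in the basis `(a + τ)_j (a - τ)_j`. -/
def wilsonCoeff (n : ℕ) (a b c d : ℂ) (j : ℕ) : ℂ :=
  risingFactorial (-n) j * risingFactorial (n + a + b + c + d - 1) j *
    risingFactorial (a + b + j) (n - j) * risingFactorial (a + c + j) (n - j) *
    risingFactorial (a + d + j) (n - j) / (j.factorial : ℂ)

/-- The coefficients of the continuous dual Hahn polynomials in the basis `(a + τ)_j (a - τ)_j`. -/
def dualHahnCoeff (n : ℕ) (a b c : ℂ) (j : ℕ) : ℂ :=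
  risingFactorial (-n) j * risingFactorial (a + b + j) (n - j) *
    risingFactorial (a + c + j) (n - j) / (j.factorial : ℂ)

/-- The polynomial with coefficients `y` in the basis `(a + τ)_j (a - τ)_j`, `j ≤ n`. -/
def wSum (k e a : ℂ) (n : ℕ) (y : ℕ → ℂ) : ℂ[X] :=
  ∑ j ∈ Finset.range (n + 1), C (y j) * wBasis k e a j

theorem natDegree_wSum_le (k e a : ℂ) (n : ℕ) (y : ℕ → ℂ) : (wSum k e a n y).natDegree ≤ n :=
  natDegree_sum_le_of_forall_le _ _ fun _ hj => (natDegree_C_mul_le _ _).trans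
    ((natDegree_wBasis_le _ _ _ _).trans (Nat.lt_succ_iff.1 (Finset.mem_range.1 hj)))

theorem coeff_wSum (k e a : ℂ) (n : ℕ) (y : ℕ → ℂ) :
    (wSum k e a n y).coeff n = y n * (-k⁻¹) ^ n := by
  rw [wSum, finsetSum_coeff, Finset.sum_range_succ, Finset.sum_eq_zero, zero_add,
    coeff_C_mul, coeff_wBasis]
  intro j hj
  rw [coeff_C_mul, coeff_eq_zero_of_natDegree_lt, mul_zero]
  exact (natDegree_wBasis_le _ _ _ _).trans_lt (Finset.mem_range.1 hj)

theorem risingFactorial_neg_ne_zero (n : ℕ) : risingFactorial (-n) n ≠ 0 :=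
  Finset.prod_ne_zero_iff.2 fun i hi h => by
    have h1 : (i : ℂ) = n := by linear_combination h
    have := Finset.mem_range.1 hi
    have : i = n := by exact_mod_cast h1
    omega

theorem wilsonCoeff_self_ne_zero (n : ℕ) {a b c d : ℂ} (h : ∀ m : ℕ, m + (a + b + c + d) ≠ 0) :
    wilsonCoeff n a b c d n ≠ 0 := by
  rw [wilsonCoeff, Nat.sub_self]
  simp only [risingFactorial_zero, mul_one]
  refine div_ne_zero (mul_ne_zero (risingFactorial_neg_ne_zero n) ?_)
    (by exact_mod_cast n.factorial_ne_zero)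
  refine Finset.prod_ne_zero_iff.2 fun i hi => ?_
  have hi := Finset.mem_range.1 hi
  obtain ⟨m, rfl⟩ : ∃ m, n = m + 1 := ⟨n - 1, by omega⟩
  convert h (m + i) using 1
  push_cast; ring

theorem dualHahnCoeff_self_ne_zero (n : ℕ) (a b c : ℂ) : dualHahnCoeff n a b c n ≠ 0 := by
  rw [dualHahnCoeff, Nat.sub_self]
  simp only [risingFactorial_zero, mul_one]
  exact div_ne_zero (risingFactorial_neg_ne_zero n) (by exact_mod_cast n.factorial_ne_zero)

theorem wilsonCoeff_succ_mul (a b c d : ℂ) {n j : ℕ} (hj : j < n) :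
    wilsonCoeff n a b c d (j + 1) *
      (-(2 * (j + 1) * ((a + b + j) * (a + c + j) * (1 * (a + j) + d)))) =
    (wEig (linProd ![a, b, c, d] ![-1, -1, -1, -1]) n -
      wEig (linProd ![a, b, c, d] ![-1, -1, -1, -1]) j) * wilsonCoeff n a b c d j := by
  obtain ⟨m, rfl⟩ : ∃ m, n = j + (m + 1) := ⟨n - j - 1, by omega⟩
  have h1 : (j.factorial : ℂ) ≠ 0 := by exact_mod_cast j.factorial_ne_zero
  have h2 : (j + 1 : ℂ) ≠ 0 := by exact_mod_cast j.succ_ne_zero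
  rw [wilsonCoeff, wilsonCoeff, show j + (m + 1) - (j + 1) = m by omega, Nat.add_sub_cancel_left]
  simp only [risingFactorial_succ' (_ + (j : ℂ)) m, risingFactorial_succ _ j, Nat.factorial_succ,
    Nat.cast_succ, add_assoc _ (j : ℂ) 1]
  simp only [wEig, linProd, Matrix.cons_val]
  push_cast
  generalize risingFactorial (a + b + (j + 1)) m = B1
  generalize risingFactorial (a + c + (j + 1)) m = B2
  generalize risingFactorial (a + d + (j + 1)) m = B3
  generalize risingFactorial (-(j + (m + 1)) : ℂ) j = B4
  generalize risingFactorial (j + (m + 1) + a + b + c + d - 1) j = B5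
  field_simp
  ring

theorem dualHahnCoeff_succ_mul (a b c : ℂ) {n j : ℕ} (hj : j < n) :
    dualHahnCoeff n a b c (j + 1) *
      (-(2 * (j + 1) * ((a + b + j) * (a + c + j) * (0 * (a + j) + 1)))) =
    (wEig (linProd ![a, b, c, 1] ![-1, -1, -1, -0]) n -
      wEig (linProd ![a, b, c, 1] ![-1, -1, -1, -0]) j) * dualHahnCoeff n a b c j := by
  obtain ⟨m, rfl⟩ : ∃ m, n = j + (m + 1) := ⟨n - j - 1, by omega⟩
  have h1 : (j.factorial : ℂ) ≠ 0 := by exact_mod_cast j.factorial_ne_zero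
  have h2 : (j + 1 : ℂ) ≠ 0 := by exact_mod_cast j.succ_ne_zero
  rw [dualHahnCoeff, dualHahnCoeff, show j + (m + 1) - (j + 1) = m by omega,
    Nat.add_sub_cancel_left]
  simp only [risingFactorial_succ' (_ + (j : ℂ)) m, risingFactorial_succ _ j, Nat.factorial_succ,
    Nat.cast_succ, add_assoc _ (j : ℂ) 1]
  simp only [wEig, linProd, Matrix.cons_val]
  push_cast
  generalize risingFactorial (a + b + (j + 1)) m = B1
  generalize risingFactorial (a + c + (j + 1)) m = B2
  generalize risingFactorial (-(j + (m + 1)) : ℂ) j = B4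
  field_simp
  ring

theorem eq_smul_linProd_of_degree_four {h : Fin 5 → ℂ} (h4 : h 4 ≠ 0) :
    ∃ a b c d : ℂ, h = h 4 • linProd ![a, b, c, d] ![-1, -1, -1, -1] := by
  have hd : (quarticPoly h).natDegree = 4 := (natDegree_quarticPoly_le h).antisymm
    (le_natDegree_of_ne_zero (by rwa [show (4 : ℕ) = (4 : Fin 5) from rfl, coeff_quarticPoly]))
  obtain ⟨r, hr⟩ := exists_isRoot_of_natDegree hd
  obtain ⟨b, c, d, hh⟩ := eq_smul_linProd_of_isRoot h4 (by rwa [IsRoot, eval_quarticPoly] at hr)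
  refine ⟨-r, -b, -c, -d, quartic_ext fun w => ?_⟩
  conv_lhs => rw [hh]
  rw [quartic_smul, quartic_smul, quartic_linProd, quartic_linProd]
  simp only [Matrix.cons_val, Pi.one_apply]
  ring

theorem eq_smul_linProd_of_degree_three {h : Fin 5 → ℂ} (h4 : h 4 = 0) (h3 : h 3 ≠ 0) :
    ∃ a b c : ℂ, h = h 3 • linProd ![a, b, c, 1] ![-1, -1, -1, -0] := by
  have hd : (quarticPoly h).natDegree = 3 := by
    refine le_antisymm ?_
      (le_natDegree_of_ne_zero (by rwa [show (3 : ℕ) = (3 : Fin 5) from rfl, coeff_quarticPoly]))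
    rw [quarticPoly, h4, C_0, zero_mul, add_zero]; compute_degree
  obtain ⟨a, ha⟩ := exists_isRoot_of_natDegree hd
  obtain ⟨g, hg, hgd⟩ := exists_eq_sub_mul hd ha
  obtain ⟨b, hb⟩ := exists_isRoot_of_natDegree hgd
  obtain ⟨g₁, rfl, hgd₁⟩ := exists_eq_sub_mul hgd hb
  obtain ⟨c, hc⟩ := exists_isRoot_of_natDegree hgd₁
  obtain ⟨g₂, rfl, hgd₂⟩ := exists_eq_sub_mul hgd₁ hc
  obtain ⟨y, rfl⟩ : ∃ y, g₂ = C y := ⟨_, eq_C_of_natDegree_eq_zero hgd₂⟩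
  have key : h = (-y) • linProd ![-a, -b, -c, 1] ![-1, -1, -1, -0] := quartic_ext fun w => by
    rw [quartic_smul, ← eval_quarticPoly, hg, quartic_linProd]
    simp only [eval_mul, eval_sub, eval_C, eval_X, Matrix.cons_val]
    ring
  have hy : h 3 = -y := by rw [key]; simp [linProd]
  exact ⟨-a, -b, -c, by rw [hy]; exact key⟩

namespace IsQuadLattice

variable {k e : ℂ} {x τ : ℂ → ℂ} {L : ℂ[X] →ₗ[ℂ] ℂ} {P : ℕ → ℂ[X]}

theorem eval_wSum_wilson (hx : IsQuadLattice k e x τ) (n : ℕ) (a b c d : ℂ) (s : ℂ) :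
    (wSum k e a n (wilsonCoeff n a b c d)).eval (x s) = wilson n a b c d (Complex.I * τ s) := by
  have hI : Complex.I * (Complex.I * τ s) = -τ s := by rw [← mul_assoc, Complex.I_mul_I]; ring
  rw [wSum, wilson, eval_finsetSum]
  refine Finset.sum_congr rfl fun j _ => ?_
  rw [eval_mul, eval_C, hx.eval_wBasis, wilsonCoeff, hI, sub_neg_eq_add, ← sub_eq_add_neg]
  ring

theorem eval_wSum_dualHahn (hx : IsQuadLattice k e x τ) (n : ℕ) (a b c : ℂ) (s : ℂ) :
    (wSum k e a n (dualHahnCoeff n a b c)).eval (x s) =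
      continuousDualHahn n a b c (Complex.I * τ s) := by
  have hI : Complex.I * (Complex.I * τ s) = -τ s := by rw [← mul_assoc, Complex.I_mul_I]; ring
  rw [wSum, continuousDualHahn, eval_finsetSum]
  refine Finset.sum_congr rfl fun j _ => ?_
  rw [eval_mul, eval_C, hx.eval_wBasis, dualHahnCoeff, hI, sub_neg_eq_add, ← sub_eq_add_neg]
  ring

/-- The Wilson polynomials are eigenfunctions of the Wilson operator. -/
theorem wHyp_wilson (hx : IsQuadLattice k e x τ) (n : ℕ) (a b c d : ℂ) :
    wHyp k e (linProd ![a, b, c, d] ![-1, -1, -1, -1]) (wSum k e a n (wilsonCoeff n a b c d)) =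
      C (wEig (linProd ![a, b, c, d] ![-1, -1, -1, -1]) n) *
        wSum k e a n (wilsonCoeff n a b c d) :=
  map_sum_eq_of_bidiagonal _ _ _ _ _ n (wHyp_wBasis_zero k e _ a)
    (hx.wHyp_wBasis_succ a b c d 1) fun _ hj => wilsonCoeff_succ_mul a b c d hj

/-- The continuous dual Hahn polynomials are eigenfunctions of the Wilson operator. -/
theorem wHyp_dualHahn (hx : IsQuadLattice k e x τ) (n : ℕ) (a b c : ℂ) :
    wHyp k e (linProd ![a, b, c, 1] ![-1, -1, -1, -0]) (wSum k e a n (dualHahnCoeff n a b c)) =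
      C (wEig (linProd ![a, b, c, 1] ![-1, -1, -1, -0]) n) *
        wSum k e a n (dualHahnCoeff n a b c) :=
  map_sum_eq_of_bidiagonal _ _ _ _ _ n (wHyp_wBasis_zero k e _ a)
    (hx.wHyp_wBasis_succ a b c 1 0) fun _ hj => dualHahnCoeff_succ_mul a b c hj

theorem exists_hyp_iff (hx : IsQuadLattice k e x τ) :
    (∃ φ ψ : ℂ[X], φ.natDegree ≤ 2 ∧ ψ.natDegree ≤ 1 ∧ (φ ≠ 0 ∨ ψ ≠ 0) ∧
        ∀ n, ∃ l : ℂ, (quadParams k e).hyp φ ψ (P n) = C l * P n) ↔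
      ∃ h, h ≠ 0 ∧ ∀ n, ∃ l : ℂ, wHyp k e h (P n) = C l * P n := by
  constructor
  · rintro ⟨φ, ψ, hφ, hψ, hne, h⟩
    obtain ⟨h', rfl, rfl⟩ := hx.exists_quartic hφ hψ
    refine ⟨h', ?_, h⟩
    rintro rfl
    simp [wφ, wψ] at hne
  · rintro ⟨h, hne, H⟩
    refine ⟨_, _, natDegree_wφ_le k e h, natDegree_wψ_le k e h, ?_, H⟩
    by_contra! h0
    exact hne (hx.eq_zero_of_wφ_eq_zero h0.1 h0.2)

theorem adm_ne_zero (hx : IsQuadLattice k e x τ) (hP : IsOPS L P) {h : Fin 5 → ℂ} (hne : h ≠ 0)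
    (H : ∀ n, ∃ l : ℂ, wHyp k e h (P n) = C l * P n) (m : ℕ) :
    (quadParams k e).adm ((wφ k e h).coeff 2) ((wψ k e h).coeff 1) m ≠ 0 := by
  choose l hl using H
  refine LatticeParams.adm_ne_zero hx.nondegenerate hP (natDegree_wφ_le k e h)
    (natDegree_wψ_le k e h) ?_ hl m
  by_contra! h0
  exact hne (hx.eq_zero_of_wφ_eq_zero h0.1 h0.2)

theorem eq_C_mul_of_wHyp_eq (hx : IsQuadLattice k e x τ) (hP : IsOPS L P) {h : Fin 5 → ℂ}
    (hne : h ≠ 0) (H : ∀ n, ∃ l : ℂ, wHyp k e h (P n) = C l * P n) {n : ℕ} {a : ℂ} {y : ℕ → ℂ}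
    (hy : y n ≠ 0) {l : ℂ} (hTg : wHyp k e h (wSum k e a n y) = C l * wSum k e a n y) :
    ∃ κ, P n = C κ * wSum k e a n y :=
  ⟨_, eq_C_mul_of_hyp_eq hx.nondegenerate (natDegree_wφ_le k e h) (natDegree_wψ_le k e h)
    (hx.adm_ne_zero hP hne H) (hP.natDegree_le n) (natDegree_wSum_le k e a n y)
    (by
      rw [coeff_wSum]
      exact mul_ne_zero hy (pow_ne_zero _ (neg_ne_zero.2 (inv_ne_zero hx.k_ne))))
    (H n).choose_spec hTg (hP.coeff_ne n)⟩

/-- The orthogonal polynomials which are eigenfunctions of an operator of Wilson type. -/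
theorem exists_hyp_iff_families (hx : IsQuadLattice k e x τ) (hP : IsOPS L P) :
    (∃ φ ψ : ℂ[X], φ.natDegree ≤ 2 ∧ ψ.natDegree ≤ 1 ∧ (φ ≠ 0 ∨ ψ ≠ 0) ∧
        ∀ n, ∃ l : ℂ, (quadParams k e).hyp φ ψ (P n) = C l * P n) ↔
      (∃ a b c d : ℂ, ∀ n, ∃ κ : ℂ, ∀ s,
        (P n).eval (x s) = κ * wilson n a b c d (Complex.I * τ s)) ∨
      ∃ a b c : ℂ, ∀ n, ∃ κ : ℂ, ∀ s,
        (P n).eval (x s) = κ * continuousDualHahn n a b c (Complex.I * τ s) := by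
  rw [hx.exists_hyp_iff]
  constructor
  · rintro ⟨h, hne, H⟩
    have hadm : ∀ m : ℕ, h 4 * m + h 3 ≠ 0 := fun m => by
      have := hx.adm_ne_zero hP hne H m
      rw [hx.adm_eq] at this
      exact right_ne_zero_of_mul this
    by_cases h4 : h 4 = 0
    · have h3 : h 3 ≠ 0 := by simpa [h4] using hadm 0
      obtain ⟨a, b, c, hh⟩ := eq_smul_linProd_of_degree_three h4 h3
      refine Or.inr ⟨a, b, c, fun n => ?_⟩
      obtain ⟨κ, hκ⟩ := hx.eq_C_mul_of_wHyp_eq hP hne H (dualHahnCoeff_self_ne_zero n a b c)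
        (l := h 3 * wEig (linProd ![a, b, c, 1] ![-1, -1, -1, -0]) n)
        (by rw [hh, wHyp_smul, hx.wHyp_dualHahn, C_mul, mul_assoc, ← hh])
      exact ⟨κ, fun s => by rw [hκ, eval_mul, eval_C, hx.eval_wSum_dualHahn]⟩
    · obtain ⟨a, b, c, d, hh⟩ := eq_smul_linProd_of_degree_four h4
      refine Or.inl ⟨a, b, c, d, fun n => ?_⟩
      -- Here h₃ = h₄(a + b + c + d), so this is admissibility divided by h₄; it keeps the Wilson
      -- polynomial at full degree.
      have hσ : ∀ m : ℕ, m + (a + b + c + d) ≠ 0 := fun m hm => by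
        apply hadm m
        have h3 := congrFun hh 3
        simp [linProd] at h3
        rw [h3]
        linear_combination h 4 * hm
      obtain ⟨κ, hκ⟩ := hx.eq_C_mul_of_wHyp_eq hP hne H (wilsonCoeff_self_ne_zero n hσ)
        (l := h 4 * wEig (linProd ![a, b, c, d] ![-1, -1, -1, -1]) n)
        (by rw [hh, wHyp_smul, hx.wHyp_wilson, C_mul, mul_assoc, ← hh])
      exact ⟨κ, fun s => by rw [hκ, eval_mul, eval_C, hx.eval_wSum_wilson]⟩
  · have key : ∀ {n : ℕ} {κ l : ℂ} {h : Fin 5 → ℂ} {g : ℂ[X]}, wHyp k e h g = C l * g →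
        (∀ s, (P n).eval (x s) = κ * g.eval (x s)) → ∃ l : ℂ, wHyp k e h (P n) = C l * P n := by
      intro n κ l h g hg hκ
      have : P n = C κ * g := hx.eq_of_eval_eq fun s _ _ _ => by rw [hκ, eval_mul, eval_C]
      exact ⟨l, by rw [this, map_C_mul_eq, hg]; ring⟩
    have hu : ∀ i, (![-1, -1, -1, -1] : Fin 4 → ℂ) i ≠ 0 := by simp [Fin.forall_fin_succ]
    rintro (⟨a, b, c, d, H⟩ | ⟨a, b, c, H⟩)
    · refine ⟨linProd ![a, b, c, d] ![-1, -1, -1, -1], linProd_ne_zero fun i => Or.inr (hu i),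
        fun n => ?_⟩
      obtain ⟨κ, hκ⟩ := H n
      exact key (hx.wHyp_wilson n a b c d) fun s => by rw [hκ, hx.eval_wSum_wilson]
    · refine ⟨linProd ![a, b, c, 1] ![-1, -1, -1, -0], linProd_ne_zero ?_, fun n => ?_⟩
      · simp [Fin.forall_fin_succ]
      obtain ⟨κ, hκ⟩ := H n
      exact key (hx.wHyp_dualHahn n a b c) fun s => by rw [hκ, hx.eval_wSum_dualHahn]

end IsQuadLattice

/-! ### The two concrete lattices and the conclusion. -/

theorem isQLattice_qQuadraticLattice {q c₁ c₂ : ℂ} (c₃ : ℂ) (hq0 : q ≠ 0)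
    (hq : ∀ k : ℕ, 0 < k → q ^ k ≠ 1) (h1 : c₁ ≠ 0) (h2 : c₂ ≠ 0) :
    IsQLattice (q ^ (1 / 2 : ℂ)) (c₁ * (c₂ / c₁) ^ (1 / 2 : ℂ)) c₃ (qQuadraticLattice q c₁ c₂ c₃)
      (latticeExp q c₁ c₂) := by
  have hsq : ∀ y : ℂ, y ≠ 0 → (y ^ (1 / 2 : ℂ)) ^ 2 = y := fun y hy => by
    rw [← Complex.cpow_nat_mul]; norm_num
  have hv := hsq (c₂ / c₁) (div_ne_zero h2 h1)
  have hv0 : (c₂ / c₁) ^ (1 / 2 : ℂ) ≠ 0 := by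
    intro h; rw [h] at hv; exact div_ne_zero h2 h1 (by rw [← hv]; ring)
  have hp0 : q ^ (1 / 2 : ℂ) ≠ 0 := (Complex.cpow_ne_zero_iff_of_exponent_ne_zero (by norm_num)).2 hq0
  have hqs : ∀ s : ℂ, q ^ s ≠ 0 := fun s => by
    rw [Complex.cpow_def_of_ne_zero hq0]; exact Complex.exp_ne_zero _
  refine ⟨hp0, mul_ne_zero h1 hv0, fun n hn => ?_, fun s => ?_, fun s => mul_ne_zero hv0 (hqs s),
    fun s => ?_, fun w hw => ?_⟩
  · rw [hsq q hq0]; exact hq n hn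
  · have e1 := hqs s
    rw [qQuadraticLattice, latticeExp, Complex.cpow_neg]
    have e2 : c₂ = c₁ * ((c₂ / c₁) ^ (1 / 2 : ℂ)) ^ 2 := by rw [hv]; field_simp
    generalize (c₂ / c₁) ^ (1 / 2 : ℂ) = v at *
    rw [e2]
    field_simp
    ring
  · rw [latticeExp, latticeExp, Complex.cpow_add _ _ hq0]; ring
  -- Since q ≠ 1, its principal logarithm is nonzero, so q^s takes every nonzero value.
  · have hlog : Complex.log q ≠ 0 := fun h => hq 1 one_pos (by
      rw [pow_one, ← Complex.exp_log hq0, h, Complex.exp_zero])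
    refine ⟨Complex.log (w / (c₂ / c₁) ^ (1 / 2 : ℂ)) / Complex.log q, ?_⟩
    rw [latticeExp, Complex.cpow_def_of_ne_zero hq0, mul_div_cancel₀ _ hlog,
      Complex.exp_log (div_ne_zero hw hv0), mul_div_cancel₀ _ hv0]

/-- Completing the square. -/
theorem isQuadLattice_quadraticLattice {c₄ : ℂ} (c₅ c₆ : ℂ) (h4 : c₄ ≠ 0) :
    IsQuadLattice c₄ (c₆ - c₅ ^ 2 / (4 * c₄)) (quadraticLattice c₄ c₅ c₆)
      (fun s => s + c₅ / c₄ / 2) := by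
  refine ⟨h4, fun s => ?_, fun s h => by ring, fun w => ⟨w - c₅ / c₄ / 2, by ring⟩⟩
  rw [quadraticLattice]
  field_simp
  ring

theorem corollary4p3 (P : ℕ → ℝ[X]) (hP : IsMonicOPS P) :
    (∀ q c₁ c₂ c₃ : ℂ, q ≠ 0 → (∀ k : ℕ, 0 < k → q ^ k ≠ 1) → c₁ ≠ 0 → c₂ ≠ 0 →
      (FirstStructureRelation (qQuadraticLattice q c₁ c₂ c₃) P ↔
        IsAskeyWilsonFamily q c₁ c₂ c₃ P ∨ IsContinuousQHermiteFamily q c₁ c₂ c₃ P ∨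
          IsAskeyWilsonLimitFamily q c₁ c₂ c₃ P)) ∧
    (∀ c₄ c₅ c₆ : ℂ, c₄ ≠ 0 →
      (FirstStructureRelation (quadraticLattice c₄ c₅ c₆) P ↔
        IsWilsonFamily c₄ c₅ c₆ P ∨ IsContinuousDualHahnFamily c₄ c₅ c₆ P)) := by
  obtain ⟨L, hL⟩ := hP.exists_isOPS
  constructor
  · intro q c₁ c₂ c₃ hq0 hq h1 h2
    have hx := isQLattice_qQuadraticLattice c₃ hq0 hq h1 h2
    have hp : (q ^ (1 / 2 : ℂ)) ^ 2 = q := by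
      rw [← Complex.cpow_nat_mul]; norm_num
    rw [hx.isLattice.firstStructureRelation_iff hx.nondegenerate P,
      structure_iff hx.nondegenerate hL, hx.exists_hyp_iff_families hL, hp]
    simp only [eval_map_algebraMap]
    rfl
  · intro c₄ c₅ c₆ h4
    have hx := isQuadLattice_quadraticLattice c₅ c₆ h4
    rw [hx.isLattice.firstStructureRelation_iff hx.nondegenerate P,
      structure_iff hx.nondegenerate hL, hx.exists_hyp_iff_families hL]
    simp only [eval_map_algebraMap]
    rfl
end
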